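/- **Setting.** Let $X\subseteq\mathbb R^n$, $Y\subseteq\mathbb R^m$ be nonempty closed convex sets with diameters at most $R>0$ and $R'>0$, let $0<\mu\le L$, and let $f:X\times Y\to\mathbb R$ be differentiable and $L$-smooth (its gradient is $L$-Lipschitz for the Euclidean norm on $X\times Y$), convex in $x$ for every $y$ and $\mu$-strongly concave in $y$ for every $x$. Put $F(x)=\max_{y\in Y}f(x,y)$ and $\log_+z=\max\{1,\log z\}$. An algorithm accesses $f$ only through gradient queries $(x,y)\mapsto(\nabla_xf(x,y),\nabla_yf(x,y))$; it knows $X,Y,L,\mu,R,R'$, the target accuracy $\varepsilon>0$ and an initial point $(x_{\rm init},y_{\rm init})\in X\times Y$. Subscripts $X,Y$ on $\mathrm{Proj}$ denote Euclidean projection. **Subroutines.** * $\mathrm{AGD}(x,N)$: a projected gradient step $y=w=\mathrm{Proj}_Y(y_{\rm init}+\frac1L\nabla_yf(x,y_{\rm init}))$, then $N$ times, with $\theta=\sqrt{\mu/L}$: $z=\frac{y+\theta w}{1+\theta}$, $w\leftarrow\mathrm{Proj}_Y\big((1-\theta)w+\theta z+\frac\theta\mu\nabla_yf(x,z)\big)$,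 $y\leftarrow(1-\theta)y+\theta w$; return $y$. For each accuracy $\delta>0$ a number of steps $N(\delta)$ is fixed. * $\mathrm{MirrorProx}(s;x_0,y_0;N)$: $N$ mirror-prox (extragradient) steps with step size $\eta=1/(L+\mu)$ on $\phi(x,y)=f(x,y)+\frac\mu2\|x-s\|^2$ from $(x_0,y_0)$: $u_t=\mathrm{Proj}_X(x_t-\eta\nabla_x\phi(x_t,y_t))$, $v_t=\mathrm{Proj}_Y(y_t+\eta\nabla_y\phi(x_t,y_t))$, $x_{t+1}=\mathrm{Proj}_X(x_t-\eta\nabla_x\phi(u_t,v_t))$, $y_{t+1}=\mathrm{Proj}_Y(y_t+\eta\nabla_y\phi(u_t,v_t))$; return the average of $(u_0,v_0),\dots,(u_{N-1},v_{N-1})$. * $\mathrm{ApproxProx}^\delta(s;x_0,x_{\rm prev})$: the $x$-part of $\mathrm{MirrorProx}(s;x_0,\mathrm{AGD}(x_{\rm prev},N(\delta));N_{1})$. * $\mathrm{MLMC}^\delta(s,x_{\rm prev})$: draw $J\ge2$ with $\mathbb P(J=j)=2^{-(j-1)}$; put $\delta_j=2^{-3}4^{-j}\delta$, $x^{(0)}=\mathrm{ApproxProx}^{\delta_0}(s;s,x_{\rm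 prev})$ and $x^{(j)}=\mathrm{ApproxProx}^{\delta_j}(s;x^{(j-1)},x^{(j-1)})$ for $1\le j\le J$; return $x^{(1)}+2^{J-1}(x^{(J)}-x^{(J-1)})$. * $\mathrm{WarmStart}$: start from $(x_{\rm init},\mathrm{AGD}(x_{\rm init},N(LR^2/2)))$, apply $\mathrm{MirrorProx}(x_{\rm init};\,\cdot\,;N_{2})$ successively $K_{0}$ times, return the $x$-part. * $\mathrm{Loop}_\sigma(x;T)$: set $x_0=v_0=x$, $\alpha_0=1$; for $t=0,\dots,T-1$ let $\alpha_{t+1}\in[0,1]$ solve $\alpha_{t+1}^{-2}-\alpha_{t+1}^{-1}=\alpha_t^{-2}$, $s_t=(1-\alpha_{t+1})x_t+\alpha_{t+1}v_t$, $\delta_{t+1}=\sigma\,\frac{\alpha_{t+1}^2\mu R^2}{4(t+1)^2}$, $x_{t+1}=\mathrm{ApproxProx}^{\delta_{t+1}}(s_t;s_t,x_t)$, $\tilde x_{t+1}=\mathrm{MLMC}^{\delta_{t+1}}(s_t,x_t)$, $v_{t+1}=\mathrm{Proj}_X\big(v_t-\alpha_{t+1}^{-1}(s_t-\tilde x_{t+1})\big)$;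 return $x_T$. *RECAPP with additive error* returns $\mathrm{Loop}_1(\mathrm{WarmStart};T)$. *Restarted RECAPP with additive error* sets $x^{(0)}=\mathrm{WarmStart}$, $x^{(k+1)}=\mathrm{Loop}_{2^{-(k+1)}}(x^{(k)};T)$ for $0\le k<K$, and returns $x^{(K)}$. **Theorem.** There is a universal constant $C$ such that for all $0<\mu\le L$, $R,R'>0$ there are iteration numbers, depending only on $L,\mu,R,R'$, with $N_{1},N_{2}\le C\frac L\mu$, $K_{0}\le C\log_+\frac L\mu$ and $N(\delta)\le C\sqrt{L/\mu}\,\log_+\frac{L R'^2}{\delta}$ for all $\delta>0$, for which the following hold. 1. For every $\varepsilon>0$ there is $T\le CR\sqrt{\mu/\varepsilon}$ (depending only on $L,\mu,R,R',\varepsilon$) such that for every problem in the setting with these constants, in any dimensions and from any initial point, RECAPP with additive error returns a random $x\in X$ with $\mathbb E F(x)-\min_XF\le\varepsilon$, and its expected number of gradient queries is at most $$C\Big(\frac{LR}{\sqrt{\mu\varepsilon}}+\frac L\mu\log_+\frac L\mu+\sqrt{\frac L\mu}\log_+\frac{R'}R+R\sqrt{\frac L\varepsilon}\log_+\frac{L(R+R')^2}{\varepsilon}\Big).$$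 2. For all $0<\gamma\le\mu$ and $\varepsilon>0$ there are $T\le C\sqrt{\mu/\gamma}$ and $K\le C\log_+\frac{LR^2}\varepsilon$ (depending only on $L,\mu,R,R',\gamma,\varepsilon$) such that for every problem in the setting with these constants for which $F$ is moreover $\gamma$-strongly convex on $X$, restarted RECAPP with additive error returns a random $x\in X$ with $\mathbb EF(x)-\min_XF\le\varepsilon$, and its expected number of gradient queries is at most $$C\Big(\frac{L}{\sqrt{\mu\gamma}}\log_+\frac{LR^2}\varepsilon+\frac L\mu\log_+\frac L\mu+\sqrt{\frac L\mu}\log_+\frac{R'}R+\sqrt{\frac L\gamma}\,\log_+\frac{\mu L(R+R')^2}{\gamma\varepsilon}\,\log_+\frac{LR^2}\varepsilon\Big).$$ -/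

import Mathlib

open scoped ENNReal

noncomputable section

namespace Recapp

/-! ### Randomized programs with oracle access -/

/-- A randomized program that may query an oracle (queries in `Q`, answers in `A`), may draw a
natural number from a given distribution, and eventually returns a value in `α`. The program itself
has no access to the oracle other than through `query`. -/
inductive Prog (Q A α : Type) : Type
  | ret (a : α) : Prog Q A α
  | query (q : Q) (k : A → Prog Q A α) : Prog Q A α
  | sample (p : PMF ℕ) (k : ℕ → Prog Q A α) : Prog Q A α

namespace Prog

variable {Q A α β : Type}

/-- Sequential composition. -/
def bind : Prog Q A α → (α → Prog Q A β) → Prog Q A β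
  | ret a, h => h a
  | query q k, h => query q (fun r => (k r).bind h)
  | sample p k, h => sample p (fun n => (k n).bind h)

instance : Monad (Prog Q A) where
  pure := ret
  bind := bind

/-- The joint law of the returned value and the number of oracle queries made, when the queries are
answered by `O`. -/
def run (O : Q → A) : Prog Q A α → PMF (α × ℕ)
  | ret a => PMF.pure (a, 0)
  | query q k => ((k (O q)).run O).map (fun r => (r.1, r.2 + 1))
  | sample p k => p.bind (fun n => (k n).run O)

/-- One oracle query. -/
def ask (q : Q) : Prog Q A A := query q ret

/-- One random draw. -/
def draw (p : PMF ℕ) : Prog Q A ℕ := sample p ret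

/-- The loop `for i = 0, …, n - 1 do a ← step i a`. -/
def loop : ℕ → (ℕ → α → Prog Q A α) → α → Prog Q A α
  | 0, _, a => ret a
  | n + 1, step, a => (loop n step a).bind (step n)

end Prog

open Prog

/-- Expectation of a nonnegative quantity under a discrete distribution. -/
def expect {α : Type} (p : PMF α) (h : α → ℝ≥0∞) : ℝ≥0∞ := ∑' a, p a * h a

/-- A point of `K` minimizing `h` over `K`. -/
def argminOn {V : Type} [Nonempty V] (K : Set V) (h : V → ℝ) : V :=
  Classical.epsilon fun p => p ∈ K ∧ ∀ q ∈ K, h p ≤ h q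

section Algorithms

variable {V E F : Type}
variable [NormedAddCommGroup V] [InnerProductSpace ℝ V]
variable [NormedAddCommGroup E] [InnerProductSpace ℝ E]
variable [NormedAddCommGroup F] [InnerProductSpace ℝ F]

/-- Euclidean projection onto `K`. -/
def proj (K : Set V) (z : V) : V := argminOn K fun p => ‖z - p‖

/-- `argmin_{p ∈ K} ⟨g, p⟩ + ‖p - z‖² / 2`. -/
def proxStep (K : Set V) (g z : V) : V :=
  argminOn K fun p => inner ℝ g p + ‖p - z‖ ^ 2 / 2

/-- Programs with access to a gradient oracle: the query `(x, y)` is meant to be answered by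
`(∇ₓ f (x, y), ∇_y f (x, y))`. -/
abbrev GradProg (E F α : Type) : Type := Prog (E × F) (E × F) α

/-- The data of the problem that the algorithm knows: the domains, the smoothness and strong
concavity constants, the diameter bound of `X`, and an initial point. -/
structure Input (E F : Type) where
  X : Set E
  Y : Set F
  L : ℝ
  μ : ℝ
  R : ℝ
  xinit : E
  yinit : F

/-- Iteration numbers of the subroutines: mirror-prox inside an approximate prox step, accelerated
gradient descent for a given accuracy, and mirror-prox and its epochs inside the warm start. -/
structure Budget where
  mirrorIters : ℕ
  agdIters : ℝ → ℕ
  warmIters : ℕ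
  warmEpochs : ℕ

/-- One step of Nesterov's accelerated gradient method (constrained form, for strongly concave
objectives, all queries inside the domain) for maximizing `f (x, ·)` over `Y`. -/
def agdStep (P : Input E F) (x : E) (r : F × F) : GradProg E F (F × F) := do
  let θ : ℝ := √(P.μ / P.L)
  let z : F := (1 + θ)⁻¹ • (r.1 + θ • r.2)
  let g ← ask (x, z)
  let w : F := proxStep P.Y (-((θ / P.μ) • g.2)) ((1 - θ) • r.2 + θ • z)
  return ((1 - θ) • r.1 + θ • w, w)

/-- Accelerated gradient descent for the best response `argmax_{y ∈ Y} f (x, y)`: a projected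
gradient step from `P.yinit` followed by `N` accelerated steps. -/
def agd (P : Input E F) (x : E) (N : ℕ) : GradProg E F F := do
  let g ← ask (x, P.yinit)
  let y : F := proxStep P.Y (-(P.L⁻¹ • g.2)) P.yinit
  let r ← loop N (fun _ => agdStep P x) (y, y)
  return r.1

/-- The gradient of `φ (x, y) = f (x, y) + (μ / 2) ‖x - s‖²`, by one query. -/
def askReg (P : Input E F) (s : E) (z : E × F) : GradProg E F (E × F) := do
  let g ← ask z
  return (g.1 + P.μ • (z.1 - s), g.2)

/-- One mirror-prox iteration on `φ` with step size `1 / (L + μ)`; the second component of the state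
accumulates the extrapolated points. -/
def mirrorStep (P : Input E F) (s : E) (r : (E × F) × (E × F)) :
    GradProg E F ((E × F) × (E × F)) := do
  let η : ℝ := (P.L + P.μ)⁻¹
  let g ← askReg P s r.1
  let u : E := proxStep P.X (η • g.1) r.1.1
  let v : F := proxStep P.Y (-(η • g.2)) r.1.2
  let h ← askReg P s (u, v)
  return ((proxStep P.X (η • h.1) r.1.1, proxStep P.Y (-(η • h.2)) r.1.2), r.2 + (u, v))

/-- `N` iterations of mirror-prox on `φ (x, y) = f (x, y) + (μ / 2) ‖x - s‖²` from `z`, returning the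
average of the extrapolated points. -/
def mirrorProx (P : Input E F) (s : E) (z : E × F) (N : ℕ) : GradProg E F (E × F) := do
  let r ← loop N (fun _ => mirrorStep P s) (z, 0)
  return (N : ℝ)⁻¹ • r.2

/-- Approximate prox step with additive error `δ` and prox-center `s`: mirror-prox started from
`xstart` and from a `δ`-accurate best response to `xprev`. -/
def approxProx (P : Input E F) (b : Budget) (δ : ℝ) (s xstart xprev : E) : GradProg E F E := do
  let y ← agd P xprev (b.agdIters δ)
  let z ← mirrorProx P s (xstart, y) b.mirrorIters
  return z.1

/-- The law of `G` with `ℙ (G = k) = 2 ^ (-(k + 1))`, `k = 0, 1, 2, …`. -/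
def geomHalf : PMF ℕ :=
  ⟨fun k => 2⁻¹ ^ (k + 1), by
    have h := ENNReal.summable.hasSum (f := fun k : ℕ => (2⁻¹ : ℝ≥0∞) ^ (k + 1))
    rwa [ENNReal.tsum_geometric_add_one, ENNReal.one_sub_inv_two, inv_inv,
      ENNReal.inv_mul_cancel (by norm_num) (by norm_num)] at h⟩

/-- Multilevel Monte Carlo estimator of the prox point of `s`. With `J = G + 2`, so that
`ℙ (J = j) = 2 ^ (-(j - 1))` for `j ≥ 2`, and additive errors `δ_j = 2⁻³ 4⁻ʲ δ`, it computes
`x⁽⁰⁾, …, x⁽ᴶ⁾` by approximate prox steps and returns `x⁽¹⁾ + 2 ^ (J - 1) (x⁽ᴶ⁾ - x⁽ᴶ⁻¹⁾)`. -/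
def unbiasedProx (P : Input E F) (b : Budget) (δ : ℝ) (s xprev : E) : GradProg E F E := do
  let x0 ← approxProx P b (δ / 8) s s xprev
  let G ← draw geomHalf
  let x1 ← approxProx P b (δ / 8 / 4) s x0 x0
  let r ← loop (G + 1) (fun i (r : E × E) => do
    let x ← approxProx P b (δ / 8 / 4 ^ (i + 2)) s r.2 r.2
    return (r.2, x)) (x1, x1)
  return x1 + (2 : ℝ) ^ (G + 1) • (r.2 - r.1)

/-- `α₀ = 1` and `αₜ₊₁ ∈ [0, 1]` solves `1 / αₜ₊₁² - 1 / αₜ₊₁ = 1 / αₜ²`; see `alpha_spec`. -/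
def alpha : ℕ → ℝ
  | 0 => 1
  | t + 1 => 2 / (1 + √(1 + 4 / alpha t ^ 2))

theorem alpha_pos (t : ℕ) : 0 < alpha t := by
  cases t with
  | zero => simp [alpha]
  | succ t => rw [alpha]; positivity

theorem alpha_spec (t : ℕ) : alpha (t + 1) ≤ 1 ∧
    1 / alpha (t + 1) ^ 2 - 1 / alpha (t + 1) = 1 / alpha t ^ 2 := by
  have h0 := alpha_pos t
  have hs : √(1 + 4 / alpha t ^ 2) ^ 2 = 1 + 4 / alpha t ^ 2 := Real.sq_sqrt (by positivity)
  have h1 : 1 ≤ √(1 + 4 / alpha t ^ 2) := by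
    rw [Real.one_le_sqrt]
    have : 0 ≤ 4 / alpha t ^ 2 := by positivity
    linarith
  have hs' : √(1 + 4 / alpha t ^ 2) ^ 2 = 1 + 4 * (1 / alpha t ^ 2) := by rw [hs]; ring
  constructor
  · rw [alpha, div_le_one (by linarith)]; linarith
  · rw [alpha]
    generalize √(1 + 4 / alpha t ^ 2) = q at *
    have hq : 1 + q ≠ 0 := by linarith
    have e : 1 / alpha t ^ 2 = (q ^ 2 - 1) / 4 := by linarith
    rw [e]; field_simp; ring

/-- The iterations `t = 0, …, T - 1` of the accelerated proximal point method with `λ = μ`, started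
from `x₀ = v₀ = x`, with additive errors `δₜ = σ αₜ² μ R² / (4 t²)` for `t = 1, …, T`. -/
def recappLoop (P : Input E F) (b : Budget) (σ : ℝ) (T : ℕ) (x : E) : GradProg E F E := do
  let r ← loop T (fun t (r : E × E) => do
    let a : ℝ := alpha (t + 1)
    let s : E := (1 - a) • r.1 + a • r.2
    let δ : ℝ := σ * (a ^ 2 * P.μ * P.R ^ 2 / (4 * ((t + 1 : ℕ) : ℝ) ^ 2))
    let x' ← approxProx P b δ s s r.1
    let xt ← unbiasedProx P b δ s r.1
    return (x', proj P.X (r.2 - a⁻¹ • (s - xt)))) (x, x)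
  return r.1

/-- Warm start: an `L R² / 2`-accurate best response to `xinit`, then epochs of mirror-prox on
`f (x, y) + (μ / 2) ‖x - xinit‖²`. -/
def warmStart (P : Input E F) (b : Budget) : GradProg E F E := do
  let y ← agd P P.xinit (b.agdIters (P.L * P.R ^ 2 / 2))
  let z ← loop b.warmEpochs (fun _ z => mirrorProx P P.xinit z b.warmIters) (P.xinit, y)
  return z.1

/-- RECAPP with additive error. -/
def recapp (P : Input E F) (b : Budget) (T : ℕ) : GradProg E F E := do
  let x ← warmStart P b
  recappLoop P b 1 T x

/-- Restarted RECAPP with additive error; the additive errors are halved in each epoch. -/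
def restartedRecapp (P : Input E F) (b : Budget) (T K : ℕ) : GradProg E F E := do
  let x ← warmStart P b
  loop K (fun k x => recappLoop P b ((1 / 2) ^ (k + 1)) T x) x

/-! ### The problem class -/

/-- `max_{y ∈ Y} f (x, y)`. -/
def maxFun (Y : Set F) (f : E → F → ℝ) (x : E) : ℝ := sSup (f x '' Y)

/-- `X`, `Y` are closed convex sets with diameters at most `R`, `R'`, the initial point lies in
`X × Y`, and `f` is differentiable on `X × Y` with gradient `g`, `L`-smooth (Euclidean norm on the
product), convex in `x` and `μ`-strongly concave in `y`. -/
structure IsMaxProblem (P : Input E F) (R' : ℝ) (f : E → F → ℝ) (g : E × F → E × F) : Prop where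
  closedX : IsClosed P.X
  closedY : IsClosed P.Y
  convexX : Convex ℝ P.X
  convexY : Convex ℝ P.Y
  xinit_mem : P.xinit ∈ P.X
  yinit_mem : P.yinit ∈ P.Y
  diamX : ∀ x ∈ P.X, ∀ x' ∈ P.X, ‖x - x'‖ ≤ P.R
  diamY : ∀ y ∈ P.Y, ∀ y' ∈ P.Y, ‖y - y'‖ ≤ R'
  hasGradient : ∀ z ∈ P.X ×ˢ P.Y, HasFDerivWithinAt (fun w : E × F => f w.1 w.2)
    ((innerSL ℝ (g z).1).coprod (innerSL ℝ (g z).2)) (P.X ×ˢ P.Y) z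
  smooth : ∀ z ∈ P.X ×ˢ P.Y, ∀ z' ∈ P.X ×ˢ P.Y,
    √(‖(g z).1 - (g z').1‖ ^ 2 + ‖(g z).2 - (g z').2‖ ^ 2) ≤
      P.L * √(‖z.1 - z'.1‖ ^ 2 + ‖z.2 - z'.2‖ ^ 2)
  convex_left : ∀ y ∈ P.Y, ConvexOn ℝ P.X fun x => f x y
  strongConcave_right : ∀ x ∈ P.X, StrongConcaveOn P.Y P.μ (f x)

/-- The program `A`, with the gradient oracle `g`, always returns a point of `X`, its output is
`ε`-optimal for `max_y f (·, y)` over `X` in expectation, and its expected number of gradient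
queries is at most `N`. -/
def Solves (P : Input E F) (f : E → F → ℝ) (g : E × F → E × F) (A : GradProg E F E)
    (ε N : ℝ) : Prop :=
  (∀ r ∈ (A.run g).support, r.1 ∈ P.X) ∧
  expect (A.run g) (fun r => ENNReal.ofReal (maxFun P.Y f r.1 - sInf (maxFun P.Y f '' P.X))) ≤
    ENNReal.ofReal ε ∧
  expect (A.run g) (fun r => (r.2 : ℝ≥0∞)) ≤ ENNReal.ofReal N

end Algorithms

/-- The logarithm as used inside complexity bounds: `max {1, log z}`. -/
def logB (z : ℝ) : ℝ := max 1 (Real.log z)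

end Recapp

end

open Recapp

noncomputable section

namespace Recapp

/-! ### A calculus for randomized oracle programs -/

section Expect

variable {α β : Type}

/-! The outer method is an accelerated proximal point iteration on F; each prox point p of a center
s is approximated by mirror-prox on f plus (μ/2)‖x - s‖². The crux is that O(L/μ) mirror-prox steps
and one approximate best response suffice. Mirror-prox needs a good starting y, and the best
response to the previous iterate x is good enough: strong concavity gives (μ/2)‖y*(x) - y*(p)‖² ≤
`breg p x` (`half_sq_bestResp_le_breg`). The prox gap is then at most 1/32 of S = (μ/2)‖s - p‖² +
`breg p x` + δ (`approxProx_det`). The accelerated descent inequality contains negative multiples of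
‖s - p‖² and of `breg p x`, which absorb this relative error, so that only δ survives
(`maxFun_sub_le_of_proxGap_le`).

The update of v needs an unbiased estimate of p with small second moment. An approximate prox step
draws nothing at random, so the levels form one fixed sequence converging geometrically to p. The
factor attached to a level cancels its probability, hence the expectation telescopes to p
(`hasSum_multilevel_sub`), while the squared error stays below a fixed multiple of S/μ
(`norm_multilevel_sub_sq_le`). In expectation the potential (F(x_t) - F(u))/α_t² + (μ/2)‖v_t - u‖²
therefore grows by at most δ/α² per step (`recappStep_spec`), and these increments sum to at most
σμR²/2. As 1/α_T ≥ (T + 2)/2, the final gap is O(μR²/T²) once the initial gap is O(μR²). The warm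
start achieves this with logarithmically many epochs of mirror-prox, because the regularized saddle
problem is strongly convex-concave (`warmStart_det`).

If F is γ-strongly convex, the distance term of the initial potential is at most μ/γ times the gap,
so an epoch of order √(μ/γ) steps quarters the expected gap up to the additive error
(`restartedRecapp_spec`). For the query count, the logarithm in the cost of a prox step grows
linearly with the level while the probability of a level halves, so the expected cost of an
iteration is a convergent series (`stepQueries_stdBudget_le`). -/

theorem expect_pure (a : α) (h : α → ℝ≥0∞) : expect (PMF.pure a) h = h a := by
  classical
  unfold expect
  rw [tsum_eq_single a]
  · simp
  · intro b hb
    simp [PMF.pure_apply, hb]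

theorem expect_bind (p : PMF α) (k : α → PMF β) (h : β → ℝ≥0∞) :
    expect (p.bind k) h = expect p fun a => expect (k a) h := by
  unfold expect
  simp only [PMF.bind_apply, ← ENNReal.tsum_mul_right, ← ENNReal.tsum_mul_left]
  rw [ENNReal.tsum_comm]
  simp only [mul_assoc]

theorem expect_map (p : PMF α) (φ : α → β) (h : β → ℝ≥0∞) :
    expect (p.map φ) h = expect p fun a => h (φ a) := by
  rw [← PMF.bind_pure_comp, expect_bind]
  simp only [Function.comp_apply, expect_pure]

theorem expect_add_one (p : PMF α) (h : α → ℝ≥0∞) :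
    expect p (fun a => h a + 1) = expect p h + 1 := by
  unfold expect
  simp only [mul_add, mul_one]
  rw [ENNReal.tsum_add, p.tsum_coe]

end Expect

namespace Prog

variable {Q A α β : Type} (O : Q → A)

/-- Expected value of `h` at the returned value. -/
def ev : Prog Q A α → (α → ℝ≥0∞) → ℝ≥0∞
  | ret a, h => h a
  | query q k, h => ev (k (O q)) h
  | sample p k, h => ∑' n, p n * ev (k n) h

/-- Expected number of queries. -/
def cost : Prog Q A α → ℝ≥0∞
  | ret _ => 0
  | query q k => cost (k (O q)) + 1
  | sample p k => ∑' n, p n * cost (k n)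

/-- Every run returns a value with property `S`. -/
def Always (S : α → Prop) : Prog Q A α → Prop
  | ret a => S a
  | query q k => Always S (k (O q))
  | sample _ k => ∀ n, Always S (k n)

/-- The program makes no random draw, returns `a`, and makes `n` queries. -/
def Det : Prog Q A α → α → ℕ → Prop
  | ret a, b, n => b = a ∧ n = 0
  | query q k, b, n => ∃ m, n = m + 1 ∧ Det (k (O q)) b m
  | sample _ _, _, _ => False

variable {O}

/-- With its companion for `cost`, this ties the structural recursions, along which all later bounds
are composed, to the joint law used in `Solves`. -/
theorem expect_run_fst (A' : Prog Q A α) (h : α → ℝ≥0∞) :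
    expect (A'.run O) (fun r => h r.1) = A'.ev O h := by
  induction A' with
  | ret a => simp [run, ev, expect_pure]
  | query q k ih => rw [run, ev, expect_map]; exact ih _
  | sample p k ih => rw [run, ev, expect_bind]; simp only [ih]; rfl

theorem expect_run_snd (A' : Prog Q A α) :
    expect (A'.run O) (fun r => (r.2 : ℝ≥0∞)) = A'.cost O := by
  induction A' with
  | ret a => simp [run, cost, expect_pure]
  | query q k ih =>
    rw [run, cost, expect_map, ← ih, ← expect_add_one]
    simp
  | sample p k ih => rw [run, cost, expect_bind]; simp only [ih]; rfl

theorem Always.of_mem_support {S : α → Prop} {A' : Prog Q A α} (hA : A'.Always O S) :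
    ∀ r ∈ (A'.run O).support, S r.1 := by
  induction A' with
  | ret a =>
    intro r hr
    simp only [run, PMF.support_pure, Set.mem_singleton_iff] at hr
    subst hr; exact hA
  | query q k ih =>
    intro r hr
    simp only [run, PMF.support_map, Set.mem_image] at hr
    obtain ⟨r', hr', rfl⟩ := hr
    exact ih _ hA r' hr'
  | sample p k ih =>
    intro r hr
    simp only [run, PMF.mem_support_bind_iff] at hr
    obtain ⟨n, -, hn⟩ := hr
    exact ih _ (hA n) r hn

theorem always_true (A' : Prog Q A α) : A'.Always O fun _ => True := by
  induction A' with
  | ret a => trivial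
  | query q k ih => exact ih _
  | sample p k ih => exact ih

theorem ev_bind (A' : Prog Q A α) (k : α → Prog Q A β) (h : β → ℝ≥0∞) :
    (A' >>= k).ev O h = A'.ev O fun a => (k a).ev O h := by
  change (A'.bind k).ev O h = _
  induction A' with
  | ret a => rfl
  | query q k' ih => exact ih _
  | sample p k' ih => simp only [bind, ev, ih]

theorem always_bind {S : α → Prop} {S' : β → Prop} {A' : Prog Q A α} {k : α → Prog Q A β}
    (hA : A'.Always O S) (hk : ∀ a, S a → (k a).Always O S') : (A' >>= k).Always O S' := by
  change (A'.bind k).Always O S'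
  induction A' with
  | ret a => exact hk a hA
  | query q k' ih => exact ih _ hA
  | sample p k' ih => exact fun n => ih n (hA n)

theorem ev_mono {S : α → Prop} {A' : Prog Q A α} (hA : A'.Always O S) {h h' : α → ℝ≥0∞}
    (hh : ∀ a, S a → h a ≤ h' a) : A'.ev O h ≤ A'.ev O h' := by
  induction A' with
  | ret a => exact hh a hA
  | query q k ih => exact ih _ hA
  | sample p k ih => exact ENNReal.tsum_le_tsum fun n => mul_le_mul_right (ih n (hA n)) _

theorem ev_add_const (A' : Prog Q A α) (h : α → ℝ≥0∞) (c : ℝ≥0∞) :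
    A'.ev O (fun a => h a + c) = A'.ev O h + c := by
  induction A' with
  | ret a => rfl
  | query q k ih => exact ih _
  | sample p k ih =>
    simp only [ev, ih, mul_add]
    rw [ENNReal.tsum_add, ENNReal.tsum_mul_right, p.tsum_coe, one_mul]

theorem ev_const_mul (A' : Prog Q A α) (h : α → ℝ≥0∞) (c : ℝ≥0∞) :
    A'.ev O (fun a => c * h a) = c * A'.ev O h := by
  induction A' with
  | ret a => rfl
  | query q k ih => exact ih _
  | sample p k ih =>
    simp only [ev, ih]
    rw [← ENNReal.tsum_mul_left]
    exact tsum_congr fun n => by ring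

theorem cost_bind_le {S : α → Prop} {A' : Prog Q A α} {k : α → Prog Q A β} {c : ℝ≥0∞}
    (hA : A'.Always O S) (hk : ∀ a, S a → (k a).cost O ≤ c) :
    (A' >>= k).cost O ≤ A'.cost O + c := by
  change (A'.bind k).cost O ≤ _
  induction A' with
  | ret a => simpa [bind, cost] using hk a hA
  | query q k' ih =>
    simp only [bind, cost]
    calc _ ≤ (k' (O q)).cost O + c + 1 := by gcongr; exact ih _ hA
      _ = _ := by ring
  | sample p k' ih =>
    simp only [bind, cost]
    calc _ ≤ ∑' n, p n * ((k' n).cost O + c) :=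
          ENNReal.tsum_le_tsum fun n => mul_le_mul_right (ih n (hA n)) _
      _ = _ := by
          simp only [mul_add]
          rw [ENNReal.tsum_add, ENNReal.tsum_mul_right, p.tsum_coe, one_mul]

theorem ev_pure (a : α) (h : α → ℝ≥0∞) : (pure a : Prog Q A α).ev O h = h a := rfl

theorem cost_pure (a : α) : (pure a : Prog Q A α).cost O = 0 := rfl

theorem always_pure {S : α → Prop} {a : α} (ha : S a) : (pure a : Prog Q A α).Always O S := ha

theorem ev_draw_bind (p : PMF ℕ) (k : ℕ → Prog Q A β) (h : β → ℝ≥0∞) :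
    (draw p >>= k).ev O h = ∑' n, p n * (k n).ev O h := rfl

theorem cost_draw_bind (p : PMF ℕ) (k : ℕ → Prog Q A β) :
    (draw p >>= k).cost O = ∑' n, p n * (k n).cost O := rfl

theorem always_draw_bind {S : β → Prop} {p : PMF ℕ} {k : ℕ → Prog Q A β}
    (hk : ∀ n, (k n).Always O S) : (draw p >>= k).Always O S := hk

theorem Det.pure (a : α) : Det O (pure a : Prog Q A α) a 0 := ⟨rfl, rfl⟩

theorem Det.ask (q : Q) : Det O (ask q : Prog Q A A) (O q) 1 := ⟨0, rfl, rfl, rfl⟩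

theorem Det.bind {A' : Prog Q A α} {k : α → Prog Q A β} {a : α} {b : β} {n m : ℕ}
    (hA : Det O A' a n) (hk : Det O (k a) b m) : Det O (A' >>= k) b (n + m) := by
  change Det O (A'.bind k) b (n + m)
  induction A' generalizing n with
  | ret a' => obtain ⟨rfl, rfl⟩ := hA; simpa [Prog.bind] using hk
  | query q k' ih =>
    obtain ⟨l, rfl, hl⟩ := hA
    exact ⟨l + m, by ring, ih _ hl⟩
  | sample p k' ih => exact hA.elim

theorem Det.ev_bind {A' : Prog Q A α} {a : α} {n : ℕ} (hA : Det O A' a n) (k : α → Prog Q A β)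
    (h : β → ℝ≥0∞) : (A' >>= k).ev O h = (k a).ev O h := by
  change (A'.bind k).ev O h = _
  induction A' generalizing n with
  | ret a' => obtain ⟨rfl, rfl⟩ := hA; rfl
  | query q k' ih =>
    obtain ⟨l, rfl, hl⟩ := hA
    exact ih _ hl
  | sample p k' ih => exact hA.elim

theorem Det.cost_bind {A' : Prog Q A α} {a : α} {n : ℕ} (hA : Det O A' a n)
    (k : α → Prog Q A β) : (A' >>= k).cost O = n + (k a).cost O := by
  change (A'.bind k).cost O = _
  induction A' generalizing n with
  | ret a' => obtain ⟨rfl, rfl⟩ := hA; simp [Prog.bind]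
  | query q k' ih =>
    obtain ⟨l, rfl, hl⟩ := hA
    simp only [Prog.bind, cost, ih _ hl]
    push_cast; ring
  | sample p k' ih => exact hA.elim

theorem Det.always_bind {A' : Prog Q A α} {a : α} {n : ℕ} (hA : Det O A' a n)
    {k : α → Prog Q A β} {S : β → Prop} (hk : (k a).Always O S) : (A' >>= k).Always O S := by
  change (A'.bind k).Always O S
  induction A' generalizing n with
  | ret a' => obtain ⟨rfl, rfl⟩ := hA; exact hk
  | query q k' ih =>
    obtain ⟨l, rfl, hl⟩ := hA
    exact ih _ hl
  | sample p k' ih => exact hA.elim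

theorem Det.cost_eq {A' : Prog Q A α} {a : α} {n : ℕ} (hA : Det O A' a n) : A'.cost O = n := by
  induction A' generalizing n with
  | ret a' => obtain ⟨rfl, rfl⟩ := hA; simp [cost]
  | query q k' ih =>
    obtain ⟨l, rfl, hl⟩ := hA
    simp [cost, ih _ hl]
  | sample p k' ih => exact hA.elim

theorem Det.always {A' : Prog Q A α} {a : α} {n : ℕ} (hA : Det O A' a n) {S : α → Prop}
    (ha : S a) : A'.Always O S := by
  induction A' generalizing n with
  | ret a' => obtain ⟨rfl, rfl⟩ := hA; exact ha
  | query q k' ih =>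
    obtain ⟨l, rfl, hl⟩ := hA
    exact ih _ hl
  | sample p k' ih => exact hA.elim

theorem Det.loop {step : ℕ → α → Prog Q A α} {s : ℕ → α} {c : ℕ → ℕ} (n : ℕ)
    (h : ∀ i < n, Det O (step i (s i)) (s (i + 1)) (c i)) :
    Det O (loop n step (s 0)) (s n) (∑ i ∈ Finset.range n, c i) := by
  induction n with
  | zero => exact ⟨rfl, rfl⟩
  | succ n ih =>
    rw [Finset.sum_range_succ]
    exact (ih fun i hi => h i (by omega)).bind (h n (by omega))

theorem Det.loop_inv {step : ℕ → α → Prog Q A α} {I : ℕ → α → Prop} {c : ℕ}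
    (h : ∀ i a, I i a → ∃ b, Det O (step i a) b c ∧ I (i + 1) b) (n : ℕ) {a : α} (ha : I 0 a) :
    ∃ b, Det O (Prog.loop n step a) b (n * c) ∧ I n b := by
  induction n with
  | zero => exact ⟨a, ⟨rfl, by simp⟩, ha⟩
  | succ n ih =>
    obtain ⟨b, hb, hI⟩ := ih
    obtain ⟨b', hb', hI'⟩ := h n b hI
    refine ⟨b', ?_, hI'⟩
    rw [add_mul, one_mul]
    exact hb.bind hb'

theorem always_loop {step : ℕ → α → Prog Q A α} {S : α → Prop}
    (h : ∀ i a, S a → (step i a).Always O S) (n : ℕ) {a : α} (ha : S a) :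
    (Prog.loop n step a).Always O S := by
  induction n with
  | zero => exact ha
  | succ n ih => exact always_bind ih (h n)

/-- A supermartingale argument with additive errors; constants pass through `ev` because each draw
has total mass one. The invariant `S` is carried along since one-step bounds hold only at feasible
states. -/
theorem ev_loop_le {step : ℕ → α → Prog Q A α} {S : α → Prop} {Φ : ℕ → α → ℝ≥0∞} {e : ℕ → ℝ≥0∞}
    (h : ∀ i a, S a → (step i a).Always O S)
    (hΦ : ∀ i a, S a → (step i a).ev O (Φ (i + 1)) ≤ Φ i a + e i) (n : ℕ) {a : α} (ha : S a) :
    (Prog.loop n step a).ev O (Φ n) ≤ Φ 0 a + ∑ i ∈ Finset.range n, e i := by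
  induction n with
  | zero => simp [Prog.loop, ev]
  | succ n ih =>
    calc (Prog.loop (n + 1) step a).ev O (Φ (n + 1))
        = (Prog.loop n step a).ev O fun b => (step n b).ev O (Φ (n + 1)) := ev_bind _ _ _
      _ ≤ (Prog.loop n step a).ev O fun b => Φ n b + e n :=
          ev_mono (always_loop h n ha) (hΦ n)
      _ ≤ _ := by
          rw [ev_add_const, Finset.sum_range_succ, ← add_assoc]
          gcongr

theorem cost_loop_le {step : ℕ → α → Prog Q A α} {S : α → Prop} {c : ℝ≥0∞} (n : ℕ)
    (h : ∀ i a, S a → (step i a).Always O S)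
    (hc : ∀ i < n, ∀ a, S a → (step i a).cost O ≤ c) {a : α} (ha : S a) :
    (Prog.loop n step a).cost O ≤ n * c := by
  induction n with
  | zero => simp [Prog.loop, cost]
  | succ n ih =>
    calc (Prog.loop (n + 1) step a).cost O
        ≤ (Prog.loop n step a).cost O + c :=
          cost_bind_le (always_loop h n ha) (hc n (by omega))
      _ ≤ n * c + c := by gcongr; exact ih fun i hi => hc i (by omega)
      _ = _ := by push_cast; ring

end Prog

/-! ### Projections and first-order inequalities -/

theorem argminOn_spec {V : Type} [Nonempty V] {K : Set V} {h : V → ℝ}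
    (hex : ∃ p ∈ K, ∀ q ∈ K, h p ≤ h q) :
    argminOn K h ∈ K ∧ ∀ q ∈ K, h (argminOn K h) ≤ h q :=
  Classical.epsilon_spec (p := fun p => p ∈ K ∧ ∀ q ∈ K, h p ≤ h q) hex

section Convex

variable {V : Type} [NormedAddCommGroup V] [InnerProductSpace ℝ V]

open Filter Topology

/-- A complete convex set has a point nearest to `z`. -/
theorem exists_isMinOn_norm_sub {K : Set V} (hne : K.Nonempty) (hK : IsComplete K)
    (hc : Convex ℝ K) (z : V) : ∃ p ∈ K, ∀ q ∈ K, ‖z - p‖ ≤ ‖z - q‖ := by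
  obtain ⟨p, hp, h⟩ := exists_norm_eq_iInf_of_complete_convex hne hK hc z
  refine ⟨p, hp, fun q hq => ?_⟩
  rw [h]
  exact ciInf_le (f := fun w : K => ‖z - w‖) ⟨0, by rintro _ ⟨x, rfl⟩; positivity⟩ ⟨q, hq⟩

/-- The variational characterization of the nearest point. -/
theorem inner_le_zero_of_isMinOn_norm_sub {K : Set V} (hc : Convex ℝ K) {z p : V} (hp : p ∈ K)
    (h : ∀ q ∈ K, ‖z - p‖ ≤ ‖z - q‖) : ∀ q ∈ K, inner ℝ (z - p) (q - p) ≤ 0 := by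
  rw [← norm_eq_iInf_iff_real_inner_le_zero hc hp]
  have : Nonempty K := ⟨⟨p, hp⟩⟩
  refine le_antisymm (le_ciInf fun w => h w w.2) ?_
  exact ciInf_le (f := fun w : K => ‖z - w‖) ⟨0, by rintro _ ⟨x, rfl⟩; positivity⟩ ⟨p, hp⟩

theorem proj_spec {K : Set V} (hne : K.Nonempty) (hK : IsComplete K) (hc : Convex ℝ K) (z : V) :
    proj K z ∈ K ∧ ∀ q ∈ K, ‖proj K z - q‖ ^ 2 ≤ ‖z - q‖ ^ 2 := by
  obtain ⟨hp, h⟩ := argminOn_spec (exists_isMinOn_norm_sub hne hK hc z)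
  refine ⟨hp, fun q hq => ?_⟩
  have h1 := inner_le_zero_of_isMinOn_norm_sub hc hp h q hq
  change inner ℝ (z - proj K z) (q - proj K z) ≤ 0 at h1
  have h2 : ‖z - q‖ ^ 2 = ‖z - proj K z‖ ^ 2 - 2 * inner ℝ (z - proj K z) (q - proj K z)
      + ‖proj K z - q‖ ^ 2 := by
    rw [← norm_neg (proj K z - q), neg_sub, ← norm_sub_sq_real]; congr 2; abel
  nlinarith [sq_nonneg ‖z - proj K z‖]

/-- Completing the square makes the minimizer the point of `K` nearest to `z - g`; the three-point
inequality is the variational inequality of that nearest point, expanded. -/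
theorem proxStep_spec {K : Set V} (hne : K.Nonempty) (hK : IsComplete K) (hc : Convex ℝ K)
    (g z : V) : proxStep K g z ∈ K ∧ ∀ q ∈ K, inner ℝ g (proxStep K g z - q) +
      ‖proxStep K g z - z‖ ^ 2 / 2 + ‖proxStep K g z - q‖ ^ 2 / 2 ≤ ‖q - z‖ ^ 2 / 2 := by
  have key : ∀ p : V, inner ℝ g p + ‖p - z‖ ^ 2 / 2 =
      ‖z - g - p‖ ^ 2 / 2 + (inner ℝ g z - ‖g‖ ^ 2 / 2) := by
    intro p
    have : ‖z - g - p‖ ^ 2 = ‖(p - z) + g‖ ^ 2 := by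
      rw [← norm_neg]; congr 2; abel
    rw [this, norm_add_sq_real, inner_sub_left, real_inner_comm g p, real_inner_comm g z]; ring
  obtain ⟨p, hp, h⟩ := exists_isMinOn_norm_sub hne hK hc (z - g)
  have hsq : ∀ {a b : V}, ‖a‖ ≤ ‖b‖ ↔ ‖a‖ ^ 2 / 2 ≤ ‖b‖ ^ 2 / 2 := by
    intro a b
    rw [div_le_div_iff_of_pos_right two_pos, pow_le_pow_iff_left₀ (norm_nonneg _) (norm_nonneg _)
      two_ne_zero]
  have hex : ∃ p ∈ K, ∀ q ∈ K, inner ℝ g p + ‖p - z‖ ^ 2 / 2 ≤ inner ℝ g q + ‖q - z‖ ^ 2 / 2 :=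
    ⟨p, hp, fun q hq => by rw [key, key]; have := hsq.1 (h q hq); linarith⟩
  obtain ⟨hp', h'⟩ := argminOn_spec hex
  refine ⟨hp', fun q hq => ?_⟩
  change ∀ q ∈ K, inner ℝ g (proxStep K g z) + ‖proxStep K g z - z‖ ^ 2 / 2 ≤ _ at h'
  change proxStep K g z ∈ K at hp'
  generalize proxStep K g z = w at *
  have h1 := inner_le_zero_of_isMinOn_norm_sub hc hp' (z := z - g)
    (fun q hq => hsq.2 (by have := h' q hq; rw [key, key] at this; linarith)) q hq
  have h2 : ‖q - z‖ ^ 2 = ‖w - q‖ ^ 2 - 2 * inner ℝ (z - w) (q - w) + ‖w - z‖ ^ 2 := by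
    rw [← norm_neg (w - q), neg_sub, ← norm_neg (w - z), neg_sub,
      real_inner_comm, ← norm_sub_sq_real]
    congr 2; abel
  have h3 : inner ℝ (z - g - w) (q - w) = inner ℝ (z - w) (q - w) + inner ℝ g (w - q) := by
    rw [← neg_sub q w, inner_neg_right, ← sub_eq_add_neg, ← inner_sub_left]; congr 1; abel
  linarith

/-- A quadratic that is nonnegative on `(0, 1]` and vanishes at `0` has nonnegative slope there. -/
theorem nonneg_of_forall_quadratic_nonneg {a b : ℝ}
    (h : ∀ t : ℝ, 0 < t → t ≤ 1 → 0 ≤ t * a + t ^ 2 * b) : 0 ≤ a := by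
  have h1 : Tendsto (fun t : ℝ => a + t * b) (𝓝[>] 0) (𝓝 (a + 0 * b)) :=
    Tendsto.mono_left (Continuous.tendsto (by fun_prop) _) nhdsWithin_le_nhds
  have h2 : 0 ≤ a + 0 * b := by
    refine ge_of_tendsto h1 ?_
    rw [← nhdsWithin_Ioc_eq_nhdsGT zero_lt_one]
    filter_upwards [self_mem_nhdsWithin] with t ht
    have h3 := h t ht.1 ht.2
    have h4 : t * a + t ^ 2 * b = t * (a + t * b) := by ring
    rw [h4] at h3
    exact nonneg_of_mul_nonneg_right h3 ht.1
  linarith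

theorem strongConvexOn_quadratic_growth {K : Set V} {h : V → ℝ} {m : ℝ} (hm : StrongConvexOn K m h)
    {p q : V} (hp : p ∈ K) (hmin : ∀ w ∈ K, h p ≤ h w) (hq : q ∈ K) :
    h p + m / 2 * ‖q - p‖ ^ 2 ≤ h q := by
  have : 0 ≤ h q - h p - m / 2 * ‖q - p‖ ^ 2 := by
    refine nonneg_of_forall_quadratic_nonneg (b := m / 2 * ‖q - p‖ ^ 2) fun t ht ht1 => ?_
    have h1 := hm.2 hp hq (sub_nonneg.2 ht1) ht.le (by ring)
    have h2 := hmin _ (hm.1 hp hq (sub_nonneg.2 ht1) ht.le (by ring))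
    rw [norm_sub_rev p q] at h1
    simp only [smul_eq_mul] at h1
    nlinarith
  linarith

variable {K : Set V} {h : V → ℝ} {g : V → V}

/-- Along a segment of `K`, a function with gradient `g` has derivative `⟨g, w - z⟩`. -/
theorem hasDerivWithinAt_segment (hc : Convex ℝ K)
    (hg : ∀ z ∈ K, HasFDerivWithinAt h (innerSL ℝ (g z)) K z) {z w : V} (hz : z ∈ K) (hw : w ∈ K)
    {t : ℝ} (ht : t ∈ Set.Icc (0 : ℝ) 1) :
    HasDerivWithinAt (fun t : ℝ => h (z + t • (w - z)))
      (inner ℝ (g (z + t • (w - z))) (w - z)) (Set.Icc 0 1) t := by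
  have hmem : ∀ t ∈ Set.Icc (0 : ℝ) 1, z + t • (w - z) ∈ K :=
    fun t ht => hc.add_smul_sub_mem hz hw ht
  have hl : HasDerivWithinAt (fun t : ℝ => z + t • (w - z)) (w - z) (Set.Icc 0 1) t := by
    simpa using (((hasDerivAt_id t).smul_const (w - z)).const_add z).hasDerivWithinAt
  exact (hg _ (hmem t ht)).comp_hasDerivWithinAt t hl hmem

theorem le_of_gradient_lipschitz (hc : Convex ℝ K)
    (hg : ∀ z ∈ K, HasFDerivWithinAt h (innerSL ℝ (g z)) K z) {L : ℝ}
    (hL : ∀ z ∈ K, ∀ w ∈ K, ‖g z - g w‖ ≤ L * ‖z - w‖) {z w : V} (hz : z ∈ K) (hw : w ∈ K) :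
    h w ≤ h z + inner ℝ (g z) (w - z) + L / 2 * ‖w - z‖ ^ 2 := by
  set ψ : ℝ → ℝ := fun t => h (z + t • (w - z)) - t * inner ℝ (g z) (w - z)
    - L / 2 * ‖w - z‖ ^ 2 * t ^ 2 with hψ
  have hd : ∀ t ∈ Set.Icc (0 : ℝ) 1, HasDerivWithinAt ψ
      (inner ℝ (g (z + t • (w - z))) (w - z) - inner ℝ (g z) (w - z)
        - L / 2 * ‖w - z‖ ^ 2 * (2 * t)) (Set.Icc 0 1) t := by
    intro t ht
    have h1 := hasDerivWithinAt_segment hc hg hz hw ht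
    have h2 : HasDerivWithinAt (fun t : ℝ => t * inner ℝ (g z) (w - z)) (inner ℝ (g z) (w - z))
        (Set.Icc 0 1) t := by simpa using ((hasDerivAt_id t).mul_const _).hasDerivWithinAt
    have h3 : HasDerivWithinAt (fun t : ℝ => L / 2 * ‖w - z‖ ^ 2 * t ^ 2)
        (L / 2 * ‖w - z‖ ^ 2 * (2 * t)) (Set.Icc 0 1) t := by
      simpa using ((hasDerivAt_pow 2 t).const_mul _).hasDerivWithinAt
    exact (h1.sub h2).sub h3
  have hanti : AntitoneOn ψ (Set.Icc 0 1) := by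
    refine antitoneOn_of_hasDerivWithinAt_nonpos (convex_Icc 0 1)
      (fun t ht => (hd t ht).continuousWithinAt)
      (fun t ht => (hd t (interior_subset ht)).mono interior_subset) ?_
    intro t ht
    have ht' := interior_subset ht
    rw [← inner_sub_left]
    have h1 := real_inner_le_norm (g (z + t • (w - z)) - g z) (w - z)
    have h2 := hL _ (hc.add_smul_sub_mem hz hw ht') _ hz
    rw [add_sub_cancel_left, norm_smul, Real.norm_eq_abs, abs_of_nonneg ht'.1] at h2
    have h3 := mul_le_mul_of_nonneg_right h2 (norm_nonneg (w - z))
    nlinarith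
  have := hanti (Set.left_mem_Icc.2 zero_le_one) (Set.right_mem_Icc.2 zero_le_one) zero_le_one
  simp only [hψ, one_smul, zero_smul, add_sub_cancel, add_zero] at this
  nlinarith

theorem gradient_le_of_strongConvexOn (hc : Convex ℝ K)
    (hg : ∀ z ∈ K, HasFDerivWithinAt h (innerSL ℝ (g z)) K z) {m : ℝ}
    (hm : StrongConvexOn K m h) {z w : V} (hz : z ∈ K) (hw : w ∈ K) :
    h z + inner ℝ (g z) (w - z) + m / 2 * ‖w - z‖ ^ 2 ≤ h w := by
  have hd := (hasDerivWithinAt_segment hc hg hz hw (t := 0) ⟨le_rfl, zero_le_one⟩)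
  rw [zero_smul, add_zero] at hd
  have h1 : Tendsto (fun t : ℝ => t⁻¹ * (h (z + t • (w - z)) - h z)) (𝓝[>] 0)
      (𝓝 (inner ℝ (g z) (w - z))) := by
    have := (hasDerivWithinAt_iff_tendsto_slope.1 hd).mono_left
      (nhdsWithin_mono (0 : ℝ) (s := Set.Ioc 0 1) fun t ht => ⟨⟨ht.1.le, ht.2⟩, ht.1.ne'⟩)
    rw [nhdsWithin_Ioc_eq_nhdsGT zero_lt_one] at this
    simpa [slope_fun_def] using this
  have h2 : Tendsto (fun t : ℝ => h w - h z - (1 - t) * (m / 2 * ‖w - z‖ ^ 2)) (𝓝[>] 0)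
      (𝓝 (h w - h z - (1 - 0) * (m / 2 * ‖w - z‖ ^ 2))) := by
    refine Tendsto.mono_left (Continuous.tendsto ?_ _) nhdsWithin_le_nhds
    fun_prop
  have h3 := le_of_tendsto_of_tendsto h1 h2 ?_
  · linarith
  · rw [← nhdsWithin_Ioc_eq_nhdsGT zero_lt_one]
    filter_upwards [self_mem_nhdsWithin] with t ht
    rw [inv_mul_le_iff₀ ht.1]
    have := hm.2 hz hw (sub_nonneg.2 ht.2) ht.1.le (by ring)
    have e : (1 - t) • z + t • w = z + t • (w - z) := by module
    rw [e, norm_sub_rev z w] at this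
    simp only [smul_eq_mul] at this
    linarith

end Convex

/-! ### The maximum function -/

section MaxFun

variable {E F : Type}
variable [NormedAddCommGroup E] [InnerProductSpace ℝ E]
variable [NormedAddCommGroup F] [InnerProductSpace ℝ F]

/-- The best response `argmax_{y ∈ Y} f (x, y)`. -/
def bestResp (P : Input E F) (f : E → F → ℝ) (x : E) : F := argminOn P.Y fun y => -f x y

/-- The gradient `∇ₓ f (x, y)` at the best response `y` to `x`. -/
def maxGrad (P : Input E F) (f : E → F → ℝ) (g : E × F → E × F) (x : E) : E :=
  (g (x, bestResp P f x)).1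

/-- The Bregman divergence of the maximum function. -/
def breg (P : Input E F) (f : E → F → ℝ) (g : E × F → E × F) (p x : E) : ℝ :=
  maxFun P.Y f x - maxFun P.Y f p - inner ℝ (maxGrad P f g p) (x - p)

/-- First-order characterization of `p = argmin_{x ∈ X} F x + (μ / 2) ‖x - s‖²`. -/
def IsProx (P : Input E F) (f : E → F → ℝ) (g : E × F → E × F) (s p : E) : Prop :=
  p ∈ P.X ∧ ∀ x ∈ P.X, 0 ≤ inner ℝ (maxGrad P f g p + P.μ • (p - s)) (x - p)

variable {P : Input E F} {R' : ℝ} {f : E → F → ℝ} {g : E × F → E × F}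

omit [InnerProductSpace ℝ F] in
/-- The regularized maximum function grows quadratically away from the prox point. -/
theorem IsProx.breg_add_le {s p x : E} (hp : IsProx P f g s p) (hx : x ∈ P.X) :
    breg P f g p x + P.μ / 2 * ‖x - p‖ ^ 2 ≤
      maxFun P.Y f x + P.μ / 2 * ‖x - s‖ ^ 2 - (maxFun P.Y f p + P.μ / 2 * ‖p - s‖ ^ 2) := by
  have h1 := hp.2 x hx
  have h2 : ‖x - s‖ ^ 2 = ‖x - p‖ ^ 2 + 2 * inner ℝ (p - s) (x - p) + ‖p - s‖ ^ 2 := by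
    rw [real_inner_comm, ← norm_add_sq_real]; congr 2; abel
  rw [inner_add_left, inner_smul_left] at h1
  simp only [conj_trivial] at h1
  rw [breg, h2]
  linarith

namespace IsMaxProblem

/-! ### First-order inequalities of f in each variable. -/

section Gradients

variable (hP : IsMaxProblem P R' f g)
include hP

theorem smooth_sq {x x' : E} {y y' : F} (hx : x ∈ P.X) (hx' : x' ∈ P.X)
    (hy : y ∈ P.Y) (hy' : y' ∈ P.Y) :
    ‖(g (x, y)).1 - (g (x', y')).1‖ ^ 2 + ‖(g (x, y)).2 - (g (x', y')).2‖ ^ 2 ≤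
      P.L ^ 2 * (‖x - x'‖ ^ 2 + ‖y - y'‖ ^ 2) := by
  have h := hP.smooth (x, y) ⟨hx, hy⟩ (x', y') ⟨hx', hy'⟩
  have h2 := pow_le_pow_left₀ (Real.sqrt_nonneg _) h 2
  rwa [mul_pow, Real.sq_sqrt (by positivity), Real.sq_sqrt (by positivity)] at h2

theorem smooth_right {x x' : E} {y y' : F} (hx : x ∈ P.X) (hx' : x' ∈ P.X)
    (hy : y ∈ P.Y) (hy' : y' ∈ P.Y) :
    ‖(g (x, y)).2 - (g (x', y')).2‖ ≤ P.L * √(‖x - x'‖ ^ 2 + ‖y - y'‖ ^ 2) := by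
  refine le_trans ?_ (hP.smooth (x, y) ⟨hx, hy⟩ (x', y') ⟨hx', hy'⟩)
  exact Real.le_sqrt_of_sq_le (by linarith [sq_nonneg ‖(g (x, y)).1 - (g (x', y')).1‖])

theorem smooth_left {x x' : E} {y y' : F} (hx : x ∈ P.X) (hx' : x' ∈ P.X)
    (hy : y ∈ P.Y) (hy' : y' ∈ P.Y) :
    ‖(g (x, y)).1 - (g (x', y')).1‖ ≤ P.L * √(‖x - x'‖ ^ 2 + ‖y - y'‖ ^ 2) := by
  refine le_trans ?_ (hP.smooth (x, y) ⟨hx, hy⟩ (x', y') ⟨hx', hy'⟩)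
  exact Real.le_sqrt_of_sq_le (by linarith [sq_nonneg ‖(g (x, y)).2 - (g (x', y')).2‖])

theorem hasGradient_left {y : F} (hy : y ∈ P.Y) {x : E} (hx : x ∈ P.X) :
    HasFDerivWithinAt (fun x => f x y) (innerSL ℝ (g (x, y)).1) P.X x := by
  have h1 := hP.hasGradient (x, y) ⟨hx, hy⟩
  have h2 : HasFDerivWithinAt (fun x : E => (x, y)) (ContinuousLinearMap.inl ℝ E F) P.X x :=
    (hasFDerivAt_prodMk_left x y).hasFDerivWithinAt
  have h3 := h1.comp x h2 (t := P.X ×ˢ P.Y) (fun x' hx' => ⟨hx', hy⟩)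
  refine h3.congr_fderiv ?_
  ext; simp

theorem hasGradient_right {x : E} (hx : x ∈ P.X) {y : F} (hy : y ∈ P.Y) :
    HasFDerivWithinAt (fun y => -f x y) (innerSL ℝ (-(g (x, y)).2)) P.Y y := by
  have h1 := hP.hasGradient (x, y) ⟨hx, hy⟩
  have h2 : HasFDerivWithinAt (fun y : F => (x, y)) (ContinuousLinearMap.inr ℝ E F) P.Y y :=
    (hasFDerivAt_prodMk_right x y).hasFDerivWithinAt
  have h3 := (h1.comp y h2 (t := P.X ×ˢ P.Y) (fun y' hy' => ⟨hx, hy'⟩)).neg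
  refine h3.congr_fderiv ?_
  ext; simp

theorem strongConvexOn_neg_right {x : E} (hx : x ∈ P.X) :
    StrongConvexOn P.Y P.μ fun y => -f x y :=
  (hP.strongConcave_right x hx).neg

theorem gradient_le_left {x x' : E} {y : F} (hx : x ∈ P.X) (hx' : x' ∈ P.X) (hy : y ∈ P.Y) :
    f x y + inner ℝ (g (x, y)).1 (x' - x) ≤ f x' y := by
  have := gradient_le_of_strongConvexOn hP.convexX (g := fun x => (g (x, y)).1)
    (fun z hz => hP.hasGradient_left hy hz)
    (strongConvexOn_zero.2 (hP.convex_left y hy)) hx hx'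
  simpa using this

theorem le_gradient_right {x : E} {y y' : F} (hx : x ∈ P.X) (hy : y ∈ P.Y) (hy' : y' ∈ P.Y) :
    f x y' + P.μ / 2 * ‖y' - y‖ ^ 2 ≤ f x y + inner ℝ (g (x, y)).2 (y' - y) := by
  have := gradient_le_of_strongConvexOn hP.convexY (g := fun y => -(g (x, y)).2)
    (fun z hz => hP.hasGradient_right hx hz) (hP.strongConvexOn_neg_right hx) hy hy'
  simp only [inner_neg_left] at this
  linarith

theorem gradient_sub_le_right {x : E} {y y' : F} (hx : x ∈ P.X) (hy : y ∈ P.Y)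
    (hy' : y' ∈ P.Y) :
    f x y + inner ℝ (g (x, y)).2 (y' - y) - P.L / 2 * ‖y' - y‖ ^ 2 ≤ f x y' := by
  have := le_of_gradient_lipschitz hP.convexY (g := fun y => -(g (x, y)).2) (L := P.L)
    (fun z hz => hP.hasGradient_right hx hz) (fun z hz w hw => by
      have := hP.smooth_right hx hx hz hw
      rw [sub_self, norm_zero, zero_pow two_ne_zero, zero_add, Real.sqrt_sq (norm_nonneg _)] at this
      rwa [neg_sub_neg, norm_sub_rev]) hy hy'
  simp only [inner_neg_left] at this
  linarith

end Gradients

variable [ProperSpace E] [ProperSpace F] (hP : IsMaxProblem P R' f g)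

include hP in
omit [ProperSpace F] in
theorem isCompactX : IsCompact P.X := by
  refine Metric.isCompact_of_isClosed_isBounded hP.closedX (Metric.isBounded_iff.2 ⟨P.R, ?_⟩)
  intro x hx y hy
  rw [dist_eq_norm]; exact hP.diamX x hx y hy

include hP in
omit [ProperSpace E] in
theorem isCompactY : IsCompact P.Y := by
  refine Metric.isCompact_of_isClosed_isBounded hP.closedY (Metric.isBounded_iff.2 ⟨R', ?_⟩)
  intro x hx y hy
  rw [dist_eq_norm]; exact hP.diamY x hx y hy

/-! ### Best responses and the geometry of F. -/

section BestResp

include hP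
omit [ProperSpace E]

theorem bestResp_spec {x : E} (hx : x ∈ P.X) :
    bestResp P f x ∈ P.Y ∧ ∀ y ∈ P.Y, f x y ≤ f x (bestResp P f x) := by
  have hc : ContinuousOn (fun y => -f x y) P.Y :=
    fun y hy => (hP.hasGradient_right hx hy).continuousWithinAt
  obtain ⟨y, hy, hmin⟩ := hP.isCompactY.exists_isMinOn ⟨_, hP.yinit_mem⟩ hc
  have := argminOn_spec (h := fun y => -f x y) ⟨y, hy, fun q hq => hmin hq⟩
  exact ⟨this.1, fun y hy => neg_le_neg_iff.1 (this.2 y hy)⟩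

theorem bestResp_mem {x : E} (hx : x ∈ P.X) : bestResp P f x ∈ P.Y := (hP.bestResp_spec hx).1

theorem add_sq_le_bestResp {x : E} (hx : x ∈ P.X) {y : F} (hy : y ∈ P.Y) :
    f x y + P.μ / 2 * ‖y - bestResp P f x‖ ^ 2 ≤ f x (bestResp P f x) := by
  obtain ⟨h1, h2⟩ := hP.bestResp_spec hx
  have := strongConvexOn_quadratic_growth (hP.strongConvexOn_neg_right hx) h1
    (fun w hw => neg_le_neg (h2 w hw)) hy
  linarith

theorem maxFun_eq {x : E} (hx : x ∈ P.X) : maxFun P.Y f x = f x (bestResp P f x) := by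
  obtain ⟨h1, h2⟩ := hP.bestResp_spec hx
  refine IsGreatest.csSup_eq ⟨⟨_, h1, rfl⟩, ?_⟩
  rintro _ ⟨y, hy, rfl⟩
  exact h2 y hy

theorem le_maxFun {x : E} (hx : x ∈ P.X) {y : F} (hy : y ∈ P.Y) : f x y ≤ maxFun P.Y f x := by
  rw [hP.maxFun_eq hx]; exact (hP.bestResp_spec hx).2 y hy

theorem inner_bestResp_nonpos {x : E} (hx : x ∈ P.X) {y : F} (hy : y ∈ P.Y) :
    inner ℝ (g (x, bestResp P f x)).2 (y - bestResp P f x) ≤ 0 := by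
  obtain ⟨h1, h2⟩ := hP.bestResp_spec hx
  rw [← neg_nonneg]
  refine nonneg_of_forall_quadratic_nonneg
    (b := P.L / 2 * ‖y - bestResp P f x‖ ^ 2) fun t ht ht1 => ?_
  have hm := hP.convexY.add_smul_sub_mem h1 hy ⟨ht.le, ht1⟩
  have h3 := hP.gradient_sub_le_right hx h1 hm
  have h4 := h2 _ hm
  rw [add_sub_cancel_left, inner_smul_right, norm_smul, mul_pow, Real.norm_eq_abs, sq_abs] at h3
  linarith

/-- Two uses of strong concavity of f(x', ·) between the best responses y₁, y₂ give μ‖y₂ - y₁‖² ≤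
⟨∇_y f(x', y₁), y₂ - y₁⟩. Optimality of y₁ at x allows ∇_y f(x, y₁) to be subtracted, and smoothness
bounds the difference. -/
theorem mul_norm_bestResp_sub_le (hL : 0 ≤ P.L) {x x' : E} (hx : x ∈ P.X)
    (hx' : x' ∈ P.X) : P.μ * ‖bestResp P f x' - bestResp P f x‖ ≤ P.L * ‖x' - x‖ := by
  have m1 := hP.bestResp_mem hx
  have m2 := hP.bestResp_mem hx'
  set y1 := bestResp P f x
  set y2 := bestResp P f x'
  have h1 := hP.inner_bestResp_nonpos hx m2
  have h2 := hP.add_sq_le_bestResp hx' m1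
  have h3 := hP.le_gradient_right hx' m1 m2
  have h4 := hP.smooth_right hx' hx m1 m1
  rw [sub_self, norm_zero, zero_pow two_ne_zero, add_zero, Real.sqrt_sq (norm_nonneg _)] at h4
  have h5 : inner ℝ ((g (x', y1)).2 - (g (x, y1)).2) (y2 - y1) ≤ P.L * ‖x' - x‖ * ‖y2 - y1‖ :=
    (real_inner_le_norm _ _).trans (by gcongr)
  rw [inner_sub_left] at h5
  change f x' y1 + P.μ / 2 * ‖y1 - y2‖ ^ 2 ≤ f x' y2 at h2
  change inner ℝ (g (x, y1)).2 (y2 - y1) ≤ 0 at h1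
  rw [norm_sub_rev y1 y2] at h2
  by_cases h0 : ‖y2 - y1‖ = 0
  · rw [h0, mul_zero]; positivity
  · have : 0 < ‖y2 - y1‖ := lt_of_le_of_ne (norm_nonneg _) (Ne.symm h0)
    refine le_of_mul_le_mul_right ?_ this
    nlinarith

/-- The maximum function lies above its linearizations. -/
theorem maxFun_ge {x x' : E} (hx : x ∈ P.X) (hx' : x' ∈ P.X) :
    maxFun P.Y f x + inner ℝ (maxGrad P f g x) (x' - x) +
      P.μ / 2 * ‖bestResp P f x' - bestResp P f x‖ ^ 2 ≤ maxFun P.Y f x' := by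
  have m1 := hP.bestResp_mem hx
  have h1 := hP.add_sq_le_bestResp hx' m1
  have h2 := hP.gradient_le_left hx hx' m1
  rw [hP.maxFun_eq hx, hP.maxFun_eq hx', maxGrad]
  rw [norm_sub_rev] at h1
  linarith

/-- A replacement for Danskin's theorem: convexity at x' bounds the increase of F by the slope at
(x', y*(x')), and Lipschitz best responses compare this with the slope at (x, y*(x)). Together with
`maxFun_ge` it yields continuity and first-order conditions without differentiating F; the size of
the quadratic coefficient never enters a rate. -/
theorem maxFun_le (hμ : 0 < P.μ) (hL : 0 ≤ P.L) {x x' : E} (hx : x ∈ P.X) (hx' : x' ∈ P.X) :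
    maxFun P.Y f x' ≤ maxFun P.Y f x + inner ℝ (maxGrad P f g x) (x' - x) +
      P.L * (1 + P.L / P.μ) * ‖x' - x‖ ^ 2 := by
  have m1 := hP.bestResp_mem hx
  have m2 := hP.bestResp_mem hx'
  have h1 := hP.gradient_le_left hx' hx m2
  have h2 := (hP.bestResp_spec hx).2 _ m2
  have h3 := hP.smooth_left hx' hx m2 m1
  have h4 := hP.mul_norm_bestResp_sub_le hL hx hx'
  have h5 : inner ℝ ((g (x', bestResp P f x')).1 - (g (x, bestResp P f x)).1) (x' - x) ≤
      P.L * ((1 + P.L / P.μ) * ‖x' - x‖) * ‖x' - x‖ := by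
    refine (real_inner_le_norm _ _).trans (mul_le_mul_of_nonneg_right ?_ (norm_nonneg _))
    refine h3.trans (mul_le_mul_of_nonneg_left ?_ hL)
    have h6 : ‖bestResp P f x' - bestResp P f x‖ ≤ P.L / P.μ * ‖x' - x‖ := by
      rw [div_mul_eq_mul_div, le_div_iff₀ hμ]; linarith
    refine Real.sqrt_le_iff.2 ⟨by positivity, ?_⟩
    have h7 := pow_le_pow_left₀ (norm_nonneg _) h6 2
    have : 0 ≤ P.L / P.μ * ‖x' - x‖ ^ 2 := by positivity
    nlinarith
  rw [inner_sub_left] at h5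
  have h6 : inner ℝ (g (x', bestResp P f x')).1 (x - x') =
      - inner ℝ (g (x', bestResp P f x')).1 (x' - x) := by rw [← inner_neg_right, neg_sub]
  rw [hP.maxFun_eq hx, hP.maxFun_eq hx', maxGrad]
  nlinarith

/-- The quadratic slack in `maxFun_ge`. It lets the Bregman divergence of F pay for starting
mirror-prox at the best response to an old iterate. -/
theorem half_sq_bestResp_le_breg {p x : E} (hp : p ∈ P.X) (hx : x ∈ P.X) :
    P.μ / 2 * ‖bestResp P f x - bestResp P f p‖ ^ 2 ≤ breg P f g p x := by
  have := hP.maxFun_ge hp hx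
  rw [breg]; linarith

theorem breg_nonneg (hμ : 0 < P.μ) {p x : E} (hp : p ∈ P.X) (hx : x ∈ P.X) :
    0 ≤ breg P f g p x :=
  le_trans (by positivity) (hP.half_sq_bestResp_le_breg hp hx)

theorem continuousOn_maxFun (hμ : 0 < P.μ) (hL : 0 ≤ P.L) : ContinuousOn (maxFun P.Y f) P.X := by
  intro x hx
  refine tendsto_of_tendsto_of_tendsto_of_le_of_le' (g := fun x' => maxFun P.Y f x +
      inner ℝ (maxGrad P f g x) (x' - x)) (h := fun x' => maxFun P.Y f x +
      inner ℝ (maxGrad P f g x) (x' - x) + P.L * (1 + P.L / P.μ) * ‖x' - x‖ ^ 2) ?_ ?_ ?_ ?_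
  · have : Continuous fun x' => maxFun P.Y f x + inner ℝ (maxGrad P f g x) (x' - x) := by fun_prop
    simpa using (this.tendsto x).mono_left nhdsWithin_le_nhds
  · have : Continuous fun x' => maxFun P.Y f x + inner ℝ (maxGrad P f g x) (x' - x) +
      P.L * (1 + P.L / P.μ) * ‖x' - x‖ ^ 2 := by fun_prop
    simpa using (this.tendsto x).mono_left nhdsWithin_le_nhds
  · filter_upwards [self_mem_nhdsWithin] with x' hx'
    have := hP.maxFun_ge hx hx'
    have h0 := hP.half_sq_bestResp_le_breg hx hx'
    rw [← sub_nonneg]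
    have : 0 ≤ P.μ / 2 * ‖bestResp P f x' - bestResp P f x‖ ^ 2 := by positivity
    linarith
  · filter_upwards [self_mem_nhdsWithin] with x' hx'
    exact hP.maxFun_le hμ hL hx hx'

end BestResp

include hP

/-- Compactness gives a minimizer of the regularized F. Moving from it by t towards x, with
`maxFun_le` as upper model, leaves a nonnegative quadratic in t whose slope is the variational
inequality. -/
theorem exists_isProx (hμ : 0 < P.μ) (hL : 0 ≤ P.L) (s : E) : ∃ p, IsProx P f g s p := by
  have hc : ContinuousOn (fun x => maxFun P.Y f x + P.μ / 2 * ‖x - s‖ ^ 2) P.X :=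
    (hP.continuousOn_maxFun hμ hL).add (by fun_prop)
  obtain ⟨p, hp, hmin⟩ := hP.isCompactX.exists_isMinOn ⟨_, hP.xinit_mem⟩ hc
  refine ⟨p, hp, fun x hx => ?_⟩
  refine nonneg_of_forall_quadratic_nonneg
    (b := (P.L * (1 + P.L / P.μ) + P.μ / 2) * ‖x - p‖ ^ 2) fun t ht ht1 => ?_
  have hm := hP.convexX.add_smul_sub_mem hp hx ⟨ht.le, ht1⟩
  have h1 := hP.maxFun_le hμ hL hp hm
  have h2 : maxFun P.Y f p + P.μ / 2 * ‖p - s‖ ^ 2 ≤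
    maxFun P.Y f (p + t • (x - p)) + P.μ / 2 * ‖p + t • (x - p) - s‖ ^ 2 := hmin hm
  have h3 : ‖p + t • (x - p) - s‖ ^ 2 =
      t ^ 2 * ‖x - p‖ ^ 2 + 2 * (t * inner ℝ (p - s) (x - p)) + ‖p - s‖ ^ 2 := by
    have e : p + t • (x - p) - s = t • (x - p) + (p - s) := by abel
    rw [e, norm_add_sq_real, norm_smul, mul_pow, Real.norm_eq_abs, sq_abs, inner_smul_left,
      real_inner_comm]
    simp
  rw [add_sub_cancel_left, inner_smul_right, norm_smul, mul_pow, Real.norm_eq_abs, sq_abs] at h1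
  rw [inner_add_left, inner_smul_left]
  simp only [conj_trivial]
  rw [h3] at h2
  linarith

theorem exists_minimizer (hμ : 0 < P.μ) (hL : 0 ≤ P.L) :
    ∃ u ∈ P.X, (∀ x ∈ P.X, maxFun P.Y f u ≤ maxFun P.Y f x) ∧
      sInf (maxFun P.Y f '' P.X) = maxFun P.Y f u := by
  obtain ⟨u, hu, hmin⟩ := hP.isCompactX.exists_isMinOn ⟨_, hP.xinit_mem⟩
    (hP.continuousOn_maxFun hμ hL)
  refine ⟨u, hu, fun x hx => hmin hx, IsLeast.csInf_eq ⟨⟨u, hu, rfl⟩, ?_⟩⟩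
  rintro _ ⟨x, hx, rfl⟩
  exact hmin hx

end IsMaxProblem

end MaxFun

open Prog

/-! ### Accelerated gradient descent and mirror-prox -/

section SaddleAlgorithms

section Aux

variable {V : Type} [NormedAddCommGroup V] [InnerProductSpace ℝ V]

theorem norm_combo_sq (t : ℝ) (a b : V) : ‖(1 - t) • a + t • b‖ ^ 2 =
    (1 - t) * ‖a‖ ^ 2 + t * ‖b‖ ^ 2 - t * (1 - t) * ‖a - b‖ ^ 2 := by
  rw [norm_add_sq_real, norm_sub_sq_real, norm_smul, norm_smul, inner_smul_left, inner_smul_right,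
    mul_pow, mul_pow, Real.norm_eq_abs, Real.norm_eq_abs, sq_abs, sq_abs]
  simp only [conj_trivial]
  ring

theorem norm_combo_sq_le {t : ℝ} (h0 : 0 ≤ t) (h1 : t ≤ 1) (a b : V) :
    ‖(1 - t) • a + t • b‖ ^ 2 ≤ (1 - t) * ‖a‖ ^ 2 + t * ‖b‖ ^ 2 := by
  rw [norm_combo_sq]
  have : 0 ≤ t * (1 - t) * ‖a - b‖ ^ 2 := by
    have := sub_nonneg.2 h1
    positivity
  linarith

omit [InnerProductSpace ℝ V] in
theorem norm_sub_sq_le_two_mul (a b c : V) :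
    ‖a - c‖ ^ 2 ≤ 2 * ‖a - b‖ ^ 2 + 2 * ‖b - c‖ ^ 2 := by
  have h := norm_sub_le_norm_sub_add_norm_sub a b c
  nlinarith [sq_nonneg (‖a - b‖ - ‖b - c‖), norm_nonneg (a - c)]

theorem proxStep_inv_smul_spec {K : Set V} (hne : K.Nonempty) (hK : IsComplete K)
    (hc : Convex ℝ K) {c : ℝ} (hc0 : 0 < c) (g z : V) :
    proxStep K (c⁻¹ • g) z ∈ K ∧ ∀ q ∈ K, inner ℝ g (proxStep K (c⁻¹ • g) z - q) +
      c / 2 * ‖proxStep K (c⁻¹ • g) z - z‖ ^ 2 + c / 2 * ‖proxStep K (c⁻¹ • g) z - q‖ ^ 2 ≤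
        c / 2 * ‖q - z‖ ^ 2 := by
  obtain ⟨h1, h2⟩ := proxStep_spec hne hK hc (c⁻¹ • g) z
  refine ⟨h1, fun q hq => ?_⟩
  have := mul_le_mul_of_nonneg_left (h2 q hq) hc0.le
  rw [inner_smul_left] at this
  simp only [conj_trivial] at this
  have e : c * (c⁻¹ * inner ℝ g (proxStep K (c⁻¹ • g) z - q)) =
    inner ℝ g (proxStep K (c⁻¹ • g) z - q) := by field_simp
  linarith

/-- Young's inequality, weighted so that the gradient differences cost exactly the squares that the
two prox inequalities supply at step size 1/(L + μ). -/
theorem extragradient_cross_le {p q c d e k L μ : ℝ} (hL : 0 < L) (hμ : 0 < μ)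
    (h : p ^ 2 + q ^ 2 ≤ L ^ 2 * (c ^ 2 + d ^ 2)) :
    p * e + μ * (c * e) + q * k ≤ (L + μ) / 2 * (c ^ 2 + d ^ 2 + e ^ 2 + k ^ 2) := by
  have h1 : p * e + q * k ≤ L / 2 * (c ^ 2 + d ^ 2) + L / 2 * (e ^ 2 + k ^ 2) := by
    refine le_of_mul_le_mul_left ?_ hL
    nlinarith [sq_nonneg (p - L * e), sq_nonneg (q - L * k)]
  have h2 : μ * (c * e) ≤ μ * ((c ^ 2 + e ^ 2) / 2) :=
    mul_le_mul_of_nonneg_left (by nlinarith [sq_nonneg (c - e)]) hμ.le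
  have h3 : 0 ≤ μ * (d ^ 2 + k ^ 2) := by positivity
  linarith

end Aux

variable {E F : Type}
variable [NormedAddCommGroup E] [InnerProductSpace ℝ E]
variable [NormedAddCommGroup F] [InnerProductSpace ℝ F]
variable {P : Input E F} {R' : ℝ} {f : E → F → ℝ} {g : E × F → E × F}

namespace IsMaxProblem

/-! ### Accelerated gradient descent for the best response. -/

section AGD

variable [ProperSpace F] (hP : IsMaxProblem P R' f g)
include hP

/-- The energy couples the value gap at y with the distance of w. Smoothness at the new y, strong
concavity from z towards the old y and towards y', and the prox inequality for w' combine with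
weights 1 - θ and θ into a contraction. -/
theorem agdStep_det (hμ : 0 < P.μ) (hμL : P.μ ≤ P.L) {x : E} (hx : x ∈ P.X) {r : F × F}
    (hr1 : r.1 ∈ P.Y) (hr2 : r.2 ∈ P.Y) {y' : F} (hy' : y' ∈ P.Y) :
    ∃ r' : F × F, Det g (agdStep P x r) r' 1 ∧ r'.1 ∈ P.Y ∧ r'.2 ∈ P.Y ∧
      f x y' - f x r'.1 + P.μ / 2 * ‖r'.2 - y'‖ ^ 2 ≤
        (1 - √(P.μ / P.L)) * (f x y' - f x r.1 + P.μ / 2 * ‖r.2 - y'‖ ^ 2) := by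
  have hL : 0 < P.L := hμ.trans_le hμL
  obtain ⟨y, w⟩ := r
  simp only at hr1 hr2
  set θ := √(P.μ / P.L) with hθ
  have hθ0 : 0 < θ := Real.sqrt_pos.2 (div_pos hμ hL)
  have hθ1 : θ ≤ 1 := Real.sqrt_le_one.2 ((div_le_one hL).2 hμL)
  have hθ2 : P.L * θ ^ 2 = P.μ := by
    rw [hθ, Real.sq_sqrt (div_pos hμ hL).le]; field_simp
  set z : F := (1 + θ)⁻¹ • (y + θ • w) with hz
  have hzY : z ∈ P.Y := by
    rw [hz, smul_add, smul_smul]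
    exact hP.convexY hr1 hr2 (by positivity) (by positivity) (by field_simp)
  set c : F := (1 - θ) • w + θ • z with hc
  set G := (g (x, z)).2 with hG
  obtain ⟨hw, hprox⟩ := proxStep_spec ⟨_, hP.yinit_mem⟩ hP.closedY.isComplete hP.convexY
    (-((θ / P.μ) • G)) c
  set w' := proxStep P.Y (-((θ / P.μ) • G)) c with hw'
  have hy1 : (1 - θ) • y + θ • w' ∈ P.Y :=
    hP.convexY hr1 hw (sub_nonneg.2 hθ1) hθ0.le (by ring)
  refine ⟨((1 - θ) • y + θ • w', w'), Det.bind (Det.ask _) (Det.pure _), hy1, hw, ?_⟩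
  simp only
  have h1 := hP.gradient_sub_le_right hx hzY hy1
  have h2 := hP.le_gradient_right hx hzY hr1
  have h3 := hP.le_gradient_right hx hzY hy'
  have h4 := hprox _ hy'
  -- The extrapolation weights of z are chosen for this identity: the displacement of y is θ times
  -- the displacement of the prox step.
  have e1 : (1 - θ) • y + θ • w' - z = θ • (w' - c) := by
    have : y = (1 + θ) • z - θ • w := by
      rw [hz, smul_smul, mul_inv_cancel₀ (by positivity)]; simp
    rw [this, hc]; module
  have e2 : inner ℝ G ((1 - θ) • y + θ • w' - z) =
      (1 - θ) * inner ℝ G (y - z) + θ * inner ℝ G (y' - z) + θ * inner ℝ G (w' - y') := by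
    rw [← inner_smul_right, ← inner_smul_right, ← inner_smul_right, ← inner_add_right,
      ← inner_add_right]
    congr 1; module
  have e3 : ‖(1 - θ) • y + θ • w' - z‖ ^ 2 = θ ^ 2 * ‖w' - c‖ ^ 2 := by
    rw [e1, norm_smul, mul_pow, Real.norm_eq_abs, sq_abs]
  have e4 : ‖y' - c‖ ^ 2 ≤ (1 - θ) * ‖w - y'‖ ^ 2 + θ * ‖y' - z‖ ^ 2 := by
    have e : y' - c = (1 - θ) • (y' - w) + θ • (y' - z) := by rw [hc]; module
    rw [e, norm_sub_rev w y']
    exact norm_combo_sq_le hθ0.le hθ1 _ _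
  rw [inner_neg_left, inner_smul_left] at h4
  simp only [conj_trivial] at h4
  have h5 := mul_le_mul_of_nonneg_left h4 hμ.le
  have e5 : P.μ * (-(θ / P.μ * inner ℝ G (w' - y')) + ‖w' - c‖ ^ 2 / 2 + ‖w' - y'‖ ^ 2 / 2) =
      -(θ * inner ℝ G (w' - y')) + P.μ * ‖w' - c‖ ^ 2 / 2 + P.μ * ‖w' - y'‖ ^ 2 / 2 := by
    field_simp
  rw [e5] at h5
  rw [e2, e3] at h1
  have h6 := mul_le_mul_of_nonneg_left h2 (sub_nonneg.2 hθ1)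
  have h7 := mul_le_mul_of_nonneg_left h3 hθ0.le
  have h8 := mul_le_mul_of_nonneg_left e4 hμ.le
  -- Since Lθ² = μ, the smoothness loss equals the squared displacement gained in the prox step.
  have h9 : P.L / 2 * (θ ^ 2 * ‖w' - c‖ ^ 2) = P.μ * ‖w' - c‖ ^ 2 / 2 := by rw [← hθ2]; ring
  have h10 : 0 ≤ (1 - θ) * (P.μ / 2 * ‖y - z‖ ^ 2) := by
    have := sub_nonneg.2 hθ1
    positivity
  linarith

theorem agd_det (hμ : 0 < P.μ) (hμL : P.μ ≤ P.L) {x : E} (hx : x ∈ P.X) (N : ℕ) :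
    ∃ y : F, Det g (agd P x N) y (1 + N) ∧ y ∈ P.Y ∧
      P.μ / 2 * ‖y - bestResp P f x‖ ^ 2 ≤ (1 - √(P.μ / P.L)) ^ N * (P.L * R' ^ 2 / 2) := by
  have hL : 0 < P.L := hμ.trans_le hμL
  obtain ⟨hb, hmax⟩ := hP.bestResp_spec hx
  set b := bestResp P f x
  set G := (g (x, P.yinit)).2 with hG
  obtain ⟨hy0, hprox⟩ := proxStep_inv_smul_spec ⟨_, hP.yinit_mem⟩ hP.closedY.isComplete
    hP.convexY hL (-G) P.yinit
  rw [smul_neg] at hy0 hprox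
  set y0 := proxStep P.Y (-(P.L⁻¹ • G)) P.yinit with hy0'
  -- The projected gradient step bounds the whole initial energy, value gap included, by L/2 times
  -- the squared distance from `yinit` to the best response; μ ≤ L absorbs the distance term.
  have h0 : f x b - f x y0 + P.μ / 2 * ‖y0 - b‖ ^ 2 ≤ P.L * R' ^ 2 / 2 := by
    have h1 := hP.gradient_sub_le_right hx hP.yinit_mem hy0
    have h2 := hP.le_gradient_right hx hP.yinit_mem hb
    have h3 := hprox b hb
    have h4 := pow_le_pow_left₀ (norm_nonneg _) (hP.diamY b hb _ hP.yinit_mem) 2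
    have e : inner ℝ G (y0 - b) = inner ℝ G (y0 - P.yinit) - inner ℝ G (b - P.yinit) := by
      rw [← inner_sub_right]; congr 1; abel
    rw [inner_neg_left, e] at h3
    have h5 : 0 ≤ P.μ / 2 * ‖b - P.yinit‖ ^ 2 := by positivity
    have h6 := mul_le_mul_of_nonneg_left h4 hL.le
    have h7 := mul_le_mul_of_nonneg_right hμL (sq_nonneg ‖y0 - b‖)
    linarith
  obtain ⟨r, hr, hr1, hr2, hE⟩ := Det.loop_inv (O := g) (step := fun _ => agdStep P x) (c := 1)
    (I := fun i r => r.1 ∈ P.Y ∧ r.2 ∈ P.Y ∧ f x b - f x r.1 + P.μ / 2 * ‖r.2 - b‖ ^ 2 ≤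
      (1 - √(P.μ / P.L)) ^ i * (P.L * R' ^ 2 / 2))
    (fun i r ⟨hr1, hr2, hE⟩ => by
      obtain ⟨r', hd, h1, h2, h3⟩ := hP.agdStep_det hμ hμL hx hr1 hr2 hb
      refine ⟨r', hd, h1, h2, h3.trans ?_⟩
      rw [pow_succ' (1 - √(P.μ / P.L)), mul_assoc]
      refine mul_le_mul_of_nonneg_left hE (sub_nonneg.2 ?_)
      exact Real.sqrt_le_one.2 ((div_le_one hL).2 hμL)) N (a := (y0, y0))
    ⟨hy0, hy0, by simpa using h0⟩
  rw [mul_one] at hr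
  refine ⟨r.1, ?_, hr1, ?_⟩
  · refine Det.bind (Det.ask _) ?_
    exact Det.bind (m := 0) (k := fun r : F × F => (pure r.1 : GradProg E F F)) hr (Det.pure _)
  have h1 := hP.add_sq_le_bestResp hx hr1
  have h2 : 0 ≤ P.μ / 2 * ‖r.2 - b‖ ^ 2 := by positivity
  change f x r.1 + P.μ / 2 * ‖r.1 - b‖ ^ 2 ≤ f x b at h1
  linarith

end AGD

/-! ### Mirror-prox on the regularized saddle function. -/

section MirrorProx

variable [CompleteSpace E] [CompleteSpace F] (hP : IsMaxProblem P R' f g)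
include hP

/-- The extragradient argument: the gradient at (u, v) is tested through the final point, and its
mismatch with the gradient at (a, b) is absorbed by the squared displacements. What remains
telescopes over iterations. -/
theorem mirrorStep_det (hμ : 0 < P.μ) (hL : 0 < P.L) (s : E) {a : E} (ha : a ∈ P.X)
    {b : F} (hb : b ∈ P.Y) (acc : E × F) :
    ∃ u ∈ P.X, ∃ v ∈ P.Y, ∃ a' ∈ P.X, ∃ b' ∈ P.Y,
      Det g (mirrorStep P s ((a, b), acc)) ((a', b'), acc + (u, v)) 2 ∧ ∀ x ∈ P.X, ∀ y ∈ P.Y,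
        f u y + P.μ / 2 * ‖u - s‖ ^ 2 - (f x v + P.μ / 2 * ‖x - s‖ ^ 2) ≤
          (P.L + P.μ) / 2 * (‖a - x‖ ^ 2 + ‖b - y‖ ^ 2) -
            (P.L + P.μ) / 2 * (‖a' - x‖ ^ 2 + ‖b' - y‖ ^ 2) := by
  have hc : 0 < P.L + P.μ := by linarith
  have hX := proxStep_inv_smul_spec ⟨_, hP.xinit_mem⟩ hP.closedX.isComplete hP.convexX hc
  have hY := proxStep_inv_smul_spec ⟨_, hP.yinit_mem⟩ hP.closedY.isComplete hP.convexY hc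
  set g1 : E := (g (a, b)).1 + P.μ • (a - s) with hg1
  set g2 : F := (g (a, b)).2 with hg2
  obtain ⟨hu, hu'⟩ := hX g1 a
  obtain ⟨hv, hv'⟩ := hY (-g2) b
  rw [smul_neg] at hv hv'
  set u := proxStep P.X ((P.L + P.μ)⁻¹ • g1) a with hu0
  set v := proxStep P.Y (-((P.L + P.μ)⁻¹ • g2)) b with hv0
  set h1 : E := (g (u, v)).1 + P.μ • (u - s) with hh1
  set h2 : F := (g (u, v)).2 with hh2
  obtain ⟨ha', ha''⟩ := hX h1 a
  obtain ⟨hb', hb''⟩ := hY (-h2) b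
  rw [smul_neg] at hb' hb''
  set a' := proxStep P.X ((P.L + P.μ)⁻¹ • h1) a with ha0
  set b' := proxStep P.Y (-((P.L + P.μ)⁻¹ • h2)) b with hb0
  refine ⟨u, hu, v, hv, a', ha', b', hb', ?_, fun x hx y hy => ?_⟩
  · refine Det.bind (n := 1) (m := 1) (a := (g1, g2)) ?_ ?_
    · exact Det.bind (n := 1) (m := 0) (Det.ask _) (Det.pure _)
    · refine Det.bind (n := 1) (m := 0) (a := (h1, h2)) ?_ (Det.pure _)
      exact Det.bind (n := 1) (m := 0) (Det.ask _) (Det.pure _)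
  have A1 := ha'' x hx
  have A2 := hu' a' ha'
  have B1 := hb'' y hy
  have B2 := hv' b' hb'
  have S := hP.smooth_sq hu ha hv hb
  have C1 := hP.gradient_le_left hu hx hv
  have C2 := hP.le_gradient_right hu hv hy
  have C3 : ‖x - s‖ ^ 2 = ‖u - s‖ ^ 2 - 2 * inner ℝ (u - s) (u - x) + ‖u - x‖ ^ 2 := by
    rw [← norm_sub_sq_real]; congr 2; abel
  have D1 : inner ℝ (h1 - g1) (u - a') ≤ ‖(g (u, v)).1 - (g (a, b)).1‖ * ‖u - a'‖ +
      P.μ * (‖u - a‖ * ‖u - a'‖) := by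
    have e : h1 - g1 = ((g (u, v)).1 - (g (a, b)).1) + P.μ • (u - a) := by
      rw [hh1, hg1]; module
    rw [e, inner_add_left, inner_smul_left]
    have i1 := real_inner_le_norm ((g (u, v)).1 - (g (a, b)).1) (u - a')
    have i2 := mul_le_mul_of_nonneg_left (real_inner_le_norm (u - a) (u - a')) hμ.le
    simp only [conj_trivial]
    linarith
  have D2 : - inner ℝ (h2 - g2) (v - b') ≤ ‖(g (u, v)).2 - (g (a, b)).2‖ * ‖v - b'‖ := by
    rw [← inner_neg_left]
    refine (real_inner_le_norm _ _).trans ?_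
    rw [norm_neg]
  have D3 := extragradient_cross_le (e := ‖u - a'‖) (k := ‖v - b'‖) hL hμ S
  have E1 : inner ℝ h1 (u - x) = inner ℝ h1 (a' - x) + inner ℝ g1 (u - a') +
      inner ℝ (h1 - g1) (u - a') := by
    rw [inner_sub_left, ← sub_eq_zero]
    have : u - x = (u - a') + (a' - x) := by abel
    rw [this, inner_add_right]; ring
  have E2 : inner ℝ h2 (v - y) = inner ℝ h2 (b' - y) + inner ℝ g2 (v - b') +
      inner ℝ (h2 - g2) (v - b') := by
    rw [inner_sub_left, ← sub_eq_zero]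
    have : v - y = (v - b') + (b' - y) := by abel
    rw [this, inner_add_right]; ring
  have E3 : inner ℝ h1 (u - x) = -inner ℝ (g (u, v)).1 (x - u) +
      P.μ * inner ℝ (u - s) (u - x) := by
    rw [hh1, inner_add_left, inner_smul_left, ← inner_neg_right, neg_sub]; simp
  have E4 : inner ℝ h2 (v - y) = - inner ℝ (g (u, v)).2 (y - v) := by
    rw [← inner_neg_right, neg_sub]
  rw [inner_neg_left] at B1 B2
  have n1 : 0 ≤ P.μ / 2 * ‖u - x‖ ^ 2 := by positivity
  have n2 : 0 ≤ P.μ / 2 * ‖y - v‖ ^ 2 := by positivity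
  have n3 : 0 ≤ P.μ / 2 * ‖v - b‖ ^ 2 := by positivity
  have n4 : 0 ≤ P.μ / 2 * ‖v - b'‖ ^ 2 := by positivity
  rw [C3]
  rw [norm_sub_rev x a] at A1
  rw [norm_sub_rev y b] at B1
  linarith

/-- The invariant is the duality gap at the running average, kept below the telescoped distances by
convexity in x and concavity in y. `N` must be positive, as otherwise the returned average is 0 and
need not be feasible. -/
theorem mirrorProx_det (hμ : 0 < P.μ) (hL : 0 < P.L) (s : E) {x₀ : E} (hx₀ : x₀ ∈ P.X)
    {y₀ : F} (hy₀ : y₀ ∈ P.Y) {N : ℕ} (hN : 0 < N) :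
    ∃ u ∈ P.X, ∃ v ∈ P.Y, Det g (mirrorProx P s (x₀, y₀) N) (u, v) (2 * N) ∧
      ∀ x ∈ P.X, ∀ y ∈ P.Y,
        N * (f u y + P.μ / 2 * ‖u - s‖ ^ 2 - (f x v + P.μ / 2 * ‖x - s‖ ^ 2)) ≤
          (P.L + P.μ) / 2 * (‖x₀ - x‖ ^ 2 + ‖y₀ - y‖ ^ 2) := by
  obtain ⟨r, hr, hr1, hr2, u, hu, v, hv, hacc, hE⟩ := Det.loop_inv (O := g)
    (step := fun _ => mirrorStep P s) (c := 2)
    (I := fun i r => r.1.1 ∈ P.X ∧ r.1.2 ∈ P.Y ∧ ∃ u ∈ P.X, ∃ v ∈ P.Y,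
      r.2 = (i : ℝ) • (u, v) ∧ ∀ x ∈ P.X, ∀ y ∈ P.Y,
        i * (f u y + P.μ / 2 * ‖u - s‖ ^ 2 - (f x v + P.μ / 2 * ‖x - s‖ ^ 2)) ≤
          (P.L + P.μ) / 2 * (‖x₀ - x‖ ^ 2 + ‖y₀ - y‖ ^ 2) -
            (P.L + P.μ) / 2 * (‖r.1.1 - x‖ ^ 2 + ‖r.1.2 - y‖ ^ 2))
    (fun i r ⟨hr1, hr2, u, hu, v, hv, hacc, hE⟩ => by
      obtain ⟨⟨a, b⟩, acc⟩ := r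
      simp only at hr1 hr2 hacc hE
      obtain ⟨u', hu', v', hv', a', ha', b', hb', hd, hE'⟩ := hP.mirrorStep_det hμ hL s hr1 hr2 acc
      have hi : (0 : ℝ) < (i : ℝ) + 1 := by positivity
      have w1 : (0 : ℝ) ≤ 1 - ((i : ℝ) + 1)⁻¹ := by
        rw [sub_nonneg]; exact inv_le_one_of_one_le₀ (by linarith [Nat.cast_nonneg (α := ℝ) i])
      have w2 : (0 : ℝ) ≤ ((i : ℝ) + 1)⁻¹ := by positivity
      have w3 : (1 - ((i : ℝ) + 1)⁻¹) + ((i : ℝ) + 1)⁻¹ = 1 := by ring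
      have w4 : ((i : ℝ) + 1) * (1 - ((i : ℝ) + 1)⁻¹) = i := by field_simp; ring
      have w5 : ((i : ℝ) + 1) * ((i : ℝ) + 1)⁻¹ = 1 := mul_inv_cancel₀ hi.ne'
      refine ⟨((a', b'), acc + (u', v')), hd, ha', hb', _, hP.convexX hu hu' w1 w2 w3, _,
        hP.convexY hv hv' w1 w2 w3, ?_, fun x hx y hy => ?_⟩
      · simp only [hacc, Nat.cast_add, Nat.cast_one, Prod.smul_mk, Prod.mk_add_mk, smul_add,
          smul_smul, w4, w5, one_smul]
      · have h1 := (hP.convex_left y hy).2 hu hu' w1 w2 w3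
        have h2 := (hP.strongConcave_right x hx).2 hv hv' w1 w2 w3
        have h3 := norm_combo_sq_le w2 (by linarith) (u - s) (u' - s)
        have e3 : (1 - ((i : ℝ) + 1)⁻¹) • (u - s) + ((i : ℝ) + 1)⁻¹ • (u' - s) =
            (1 - ((i : ℝ) + 1)⁻¹) • u + ((i : ℝ) + 1)⁻¹ • u' - s := by module
        rw [e3] at h3
        have n4 : 0 ≤ (1 - ((i : ℝ) + 1)⁻¹) * ((i : ℝ) + 1)⁻¹ * (P.μ / 2 * ‖v - v'‖ ^ 2) := by
          positivity
        simp only [smul_eq_mul] at h1 h2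
        have h4 := hE x hx y hy
        have h5 := hE' x hx y hy
        push_cast
        set ubar := (1 - ((i : ℝ) + 1)⁻¹) • u + ((i : ℝ) + 1)⁻¹ • u'
        set vbar := (1 - ((i : ℝ) + 1)⁻¹) • v + ((i : ℝ) + 1)⁻¹ • v'
        have h6 : f ubar y + P.μ / 2 * ‖ubar - s‖ ^ 2 - (f x vbar + P.μ / 2 * ‖x - s‖ ^ 2) ≤
            (1 - ((i : ℝ) + 1)⁻¹) *
              (f u y + P.μ / 2 * ‖u - s‖ ^ 2 - (f x v + P.μ / 2 * ‖x - s‖ ^ 2)) +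
            ((i : ℝ) + 1)⁻¹ *
              (f u' y + P.μ / 2 * ‖u' - s‖ ^ 2 - (f x v' + P.μ / 2 * ‖x - s‖ ^ 2)) := by
          have := mul_le_mul_of_nonneg_left h3 (half_pos hμ).le
          linarith
        have h7 := mul_le_mul_of_nonneg_left h6 hi.le
        rw [mul_add, ← mul_assoc, ← mul_assoc, w4, w5, one_mul] at h7
        linarith) N (a := ((x₀, y₀), 0))
    -- Before the first iteration the average carries weight zero, so any feasible pair serves.
    ⟨hx₀, hy₀, x₀, hx₀, y₀, hy₀, by simp, fun x hx y hy => by simp⟩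
  have hN' : (N : ℝ) ≠ 0 := by positivity
  refine ⟨u, hu, v, hv, ?_, fun x hx y hy => ?_⟩
  · have e : (N : ℝ)⁻¹ • r.2 = (u, v) := by
      rw [hacc, smul_smul, inv_mul_cancel₀ hN', one_smul]
    rw [mul_comm, ← e]
    exact Det.bind (m := 0) (k := fun r : (E × F) × E × F =>
      (pure ((N : ℝ)⁻¹ • r.2) : GradProg E F (E × F))) hr (Det.pure _)
  · have := hE x hx y hy
    have h0 : 0 ≤ (P.L + P.μ) / 2 * (‖r.1.1 - x‖ ^ 2 + ‖r.1.2 - y‖ ^ 2) := by positivity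
    linarith

end MirrorProx

end IsMaxProblem

end SaddleAlgorithms

/-! ### Approximate prox steps and the multilevel estimator -/

section ProxSteps

/-! ### Moments of the multilevel estimator. -/

section Geometric

theorem geomHalf_apply (k : ℕ) : geomHalf k = ENNReal.ofReal ((1 / 2) ^ (k + 1)) := by
  change (2⁻¹ : ℝ≥0∞) ^ (k + 1) = _
  rw [ENNReal.ofReal_pow (by norm_num), one_div, ENNReal.ofReal_inv_of_pos two_pos]
  simp

theorem tsum_geomHalf_mul_ofReal {w : ℕ → ℝ} {S : ℝ} (hw : ∀ k, 0 ≤ w k)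
    (h : HasSum (fun k : ℕ => (1 / 2 : ℝ) ^ (k + 1) * w k) S) :
    ∑' k, geomHalf k * ENNReal.ofReal (w k) = ENNReal.ofReal S := by
  rw [← h.tsum_eq, ENNReal.ofReal_tsum_of_nonneg
    (fun k => mul_nonneg (by positivity) (hw k)) h.summable]
  refine tsum_congr fun k => ?_
  rw [geomHalf_apply, ENNReal.ofReal_mul (by positivity)]

theorem hasSum_half_pow_succ : HasSum (fun k : ℕ => (1 / 2 : ℝ) ^ (k + 1)) 1 := by
  have := (hasSum_geometric_of_lt_one (r := (1 / 2 : ℝ)) (by norm_num) (by norm_num)).mul_left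
    (1 / 2 : ℝ)
  simp only [← pow_succ'] at this
  norm_num at this ⊢
  exact this

variable {V : Type} [NormedAddCommGroup V] [InnerProductSpace ℝ V]

/-- The value of the multilevel estimator when the level is `k + 2`. -/
def multilevel (x : ℕ → V) (k : ℕ) : V := x 1 + (2 : ℝ) ^ (k + 1) • (x (k + 2) - x (k + 1))

/-- The factor 4^(k+1) from squaring cancels the decay of consecutive levels. The constant is 11/2 =
2·(1/4) + 2·(5/2), from the base level and from the correction. -/
theorem norm_multilevel_sub_sq_le {x : ℕ → V} {p : V} {D : ℝ}
    (h : ∀ j, ‖x j - p‖ ^ 2 ≤ D / 4 ^ j) (k : ℕ) :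
    ‖multilevel x k - p‖ ^ 2 ≤ 11 / 2 * D := by
  have h1 := h 1
  have h2 := h (k + 1)
  have h3 := h (k + 2)
  have e : multilevel x k - p = (x 1 - p) - (2 : ℝ) ^ (k + 1) • (x (k + 1) - x (k + 2)) := by
    rw [multilevel]; module
  have h4 := norm_sub_sq_le_two_mul (x 1 - p) 0 ((2 : ℝ) ^ (k + 1) • (x (k + 1) - x (k + 2)))
  have h5 := norm_sub_sq_le_two_mul (x (k + 1)) p (x (k + 2))
  rw [sub_zero, zero_sub, norm_neg, norm_smul, mul_pow, norm_pow, Real.norm_ofNat, ← pow_mul,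
    mul_comm (k + 1) 2, pow_mul] at h4
  rw [norm_sub_rev p] at h5
  rw [e]
  have h4k : (0 : ℝ) < 4 ^ (k + 1) := by positivity
  have e2 : D / 4 ^ (k + 2) = D / 4 ^ (k + 1) / 4 := by rw [pow_succ _ (k + 1)]; field_simp
  have h6 : ‖x (k + 1) - x (k + 2)‖ ^ 2 ≤ 5 / 2 * (D / 4 ^ (k + 1)) := by
    rw [e2] at h3; linarith
  have h7 := mul_le_mul_of_nonneg_left h6 h4k.le
  have e3 : (4 : ℝ) ^ (k + 1) * (5 / 2 * (D / 4 ^ (k + 1))) = 5 / 2 * D := by field_simp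
  rw [e3] at h7
  norm_num at h4 h1
  linarith

/-- The multilevel estimator is unbiased. -/
theorem hasSum_multilevel_sub [CompleteSpace V] {x : ℕ → V} {p : V} {D : ℝ}
    (h : ∀ j, ‖x j - p‖ ^ 2 ≤ D / 4 ^ j) :
    HasSum (fun k : ℕ => (1 / 2 : ℝ) ^ (k + 1) • (multilevel x k - p)) 0 := by
  have hD : 0 ≤ D := by have := (sq_nonneg _).trans (h 0); simpa using this
  have hx : ∀ j, ‖x j - p‖ ≤ √D * (1 / 2) ^ j := by
    intro j
    refine abs_le_of_sq_le_sq' ?_ (by positivity) |>.2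
    refine (h j).trans (le_of_eq ?_)
    rw [mul_pow, Real.sq_sqrt hD, ← pow_mul, mul_comm j 2, pow_mul]
    norm_num
    rw [div_eq_mul_inv, ← inv_pow]; norm_num
  have hs : Summable fun j : ℕ => √D * (1 / 2 : ℝ) ^ j :=
    (summable_geometric_of_lt_one (by norm_num) (by norm_num)).mul_left _
  have ht : Filter.Tendsto x Filter.atTop (nhds p) := by
    rw [tendsto_iff_norm_sub_tendsto_zero]
    exact squeeze_zero (fun _ => norm_nonneg _) hx hs.tendsto_atTop_zero
  have hsum : Summable fun j => x j - p := Summable.of_norm_bounded hs hx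
  have hd : HasSum (fun k : ℕ => x (k + 2) - x (k + 1)) (p - x 1) := by
    have hs1 : Summable fun k : ℕ => x (k + 2) - x (k + 1) := by
      have := ((summable_nat_add_iff 2).2 hsum).sub ((summable_nat_add_iff 1).2 hsum)
      simpa using this
    refine (hs1.hasSum_iff_tendsto_nat).2 ?_
    have e : ∀ n, ∑ k ∈ Finset.range n, (x (k + 2) - x (k + 1)) = x (n + 1) - x 1 :=
      fun n => Finset.sum_range_sub (fun k => x (k + 1)) n
    simp only [e]
    exact ((Filter.tendsto_add_atTop_iff_nat 1).2 ht).sub_const _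
  -- The base level enters with total mass one; in the correction the weight and the factor 2^(k+1)
  -- cancel, leaving the telescoping sum.
  have hc := hasSum_half_pow_succ.smul_const (x 1 - p)
  have := hc.add hd
  rw [one_smul, sub_add_sub_cancel, sub_self] at this
  convert this using 1
  ext k
  rw [multilevel, add_sub_right_comm, smul_add, smul_smul, ← mul_pow]
  norm_num

end Geometric

variable {E F : Type}
variable [NormedAddCommGroup E] [InnerProductSpace ℝ E]
variable [NormedAddCommGroup F] [InnerProductSpace ℝ F]
variable {P : Input E F} {R' : ℝ} {f : E → F → ℝ} {g : E × F → E × F} {b : Budget}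

/-- The iteration numbers suffice for the accuracies that the analysis asks for. -/
structure IsSufficient (P : Input E F) (R' : ℝ) (b : Budget) : Prop where
  mu_pos : 0 < P.μ
  mu_le : P.μ ≤ P.L
  R_pos : 0 < P.R
  mirror : 512 * P.L ≤ b.mirrorIters * P.μ
  warm : 512 * P.L ≤ b.warmIters * P.μ
  agd : ∀ δ, 0 < δ → (1 - √(P.μ / P.L)) ^ b.agdIters δ * (P.L * R' ^ 2 / 2) ≤ δ

omit [NormedAddCommGroup E] [InnerProductSpace ℝ E] [NormedAddCommGroup F]
  [InnerProductSpace ℝ F] in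
theorem IsSufficient.L_pos (hb : IsSufficient P R' b) : 0 < P.L := hb.mu_pos.trans_le hb.mu_le

theorem iters_pos {L μ κ : ℝ} {N : ℕ} (hL : 0 < L) (hκ : 0 < κ) (h : κ * L ≤ N * μ) : 0 < N := by
  rcases Nat.eq_zero_or_pos N with rfl | h0
  · have : 0 < κ * L := by positivity
    simp at h; linarith
  · exact h0

/-- Gap of the regularized maximum function. -/
def proxGap (P : Input E F) (f : E → F → ℝ) (s p x : E) : ℝ :=
  maxFun P.Y f x + P.μ / 2 * ‖x - s‖ ^ 2 - (maxFun P.Y f p + P.μ / 2 * ‖p - s‖ ^ 2)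

/-- The number of queries of an approximate prox step. -/
def proxQueries (b : Budget) (δ : ℝ) : ℕ := 1 + b.agdIters δ + 2 * b.mirrorIters

namespace IsMaxProblem

variable [ProperSpace E] [ProperSpace F] (hP : IsMaxProblem P R' f g)

section
include hP
omit [ProperSpace E]

theorem proxGap_nonneg (hμ : 0 < P.μ) {s p : E} (hp : IsProx P f g s p) {x : E} (hx : x ∈ P.X) :
    0 ≤ proxGap P f s p x := by
  have h1 := hp.breg_add_le hx
  have h2 := hP.breg_nonneg hμ hp.1 hx
  have h3 : 0 ≤ P.μ / 2 * ‖x - p‖ ^ 2 := by positivity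
  rw [proxGap]; linarith

/-- Testing the duality gap at p and y*(u) produces the prox gap, but the starting distance is then
measured to y*(u). Replacing it by y*(p) costs ‖y*(u) - y*(p)‖², again controlled by the prox gap
and hence absorbed; dropping from 512 to 256 leaves room for that. -/
theorem mirrorProx_proxGap_le (hμ : 0 < P.μ) (hμL : P.μ ≤ P.L) {s p : E} (hp : IsProx P f g s p)
    {x₀ : E} {y₀ : F} {N : ℕ} (hN : 512 * P.L ≤ N * P.μ) {u : E} (hu : u ∈ P.X) {v : F}
    (hv : v ∈ P.Y)
    (h : ∀ x ∈ P.X, ∀ y ∈ P.Y,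
      N * (f u y + P.μ / 2 * ‖u - s‖ ^ 2 - (f x v + P.μ / 2 * ‖x - s‖ ^ 2)) ≤
        (P.L + P.μ) / 2 * (‖x₀ - x‖ ^ 2 + ‖y₀ - y‖ ^ 2)) :
    256 * proxGap P f s p u ≤ P.μ * (‖x₀ - p‖ ^ 2 + 2 * ‖y₀ - bestResp P f p‖ ^ 2) := by
  have hL : 0 < P.L := hμ.trans_le hμL
  have h1 := h p hp.1 _ (hP.bestResp_mem hu)
  rw [← hP.maxFun_eq hu] at h1
  have h2 := hP.le_maxFun hp.1 hv
  have h3 := hp.breg_add_le hu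
  have h4 := hP.half_sq_bestResp_le_breg hp.1 hu
  have h5 := norm_sub_sq_le_two_mul y₀ (bestResp P f p) (bestResp P f u)
  rw [norm_sub_rev (bestResp P f p)] at h5
  have hg := hP.proxGap_nonneg hμ hp hu
  change breg P f g p u + P.μ / 2 * ‖u - p‖ ^ 2 ≤ proxGap P f s p u at h3
  have h6 : N * proxGap P f s p u ≤ N * (maxFun P.Y f u + P.μ / 2 * ‖u - s‖ ^ 2 -
      (f p v + P.μ / 2 * ‖p - s‖ ^ 2)) :=
    mul_le_mul_of_nonneg_left (by rw [proxGap]; linarith) (Nat.cast_nonneg _)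
  have h7 : N * proxGap P f s p u ≤ P.L * (‖x₀ - p‖ ^ 2 + ‖y₀ - bestResp P f u‖ ^ 2) := by
    refine (h6.trans h1).trans (mul_le_mul_of_nonneg_right (by linarith) (by positivity))
  have h8 : 512 * proxGap P f s p u ≤ P.μ * (‖x₀ - p‖ ^ 2 + ‖y₀ - bestResp P f u‖ ^ 2) := by
    refine le_of_mul_le_mul_left ?_ hL
    calc P.L * (512 * proxGap P f s p u) = (512 * P.L) * proxGap P f s p u := by ring
      _ ≤ (N * P.μ) * proxGap P f s p u := mul_le_mul_of_nonneg_right hN hg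
      _ = P.μ * (N * proxGap P f s p u) := by ring
      _ ≤ P.μ * (P.L * (‖x₀ - p‖ ^ 2 + ‖y₀ - bestResp P f u‖ ^ 2)) :=
        mul_le_mul_of_nonneg_left h7 hμ.le
      _ = _ := by ring
  have h9 := mul_le_mul_of_nonneg_left h5 hμ.le
  have h10 : 0 ≤ P.μ / 2 * ‖u - p‖ ^ 2 := by positivity
  linarith

end

include hP

/-- The starting y differs from y*(p) by the AGD error, paid by δ, and by the best-response shift,
paid by the Bregman term. Both enter with coefficient 8, and 8/256 = 1/32. -/
theorem approxProx_det (hb : IsSufficient P R' b) {δ : ℝ} (hδ : 0 < δ) {s : E}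
    {x₀ x' : E} (hx₀ : x₀ ∈ P.X) (hx' : x' ∈ P.X) :
    ∃ x ∈ P.X, Det g (approxProx P b δ s x₀ x') x (proxQueries b δ) ∧
      ∀ p, IsProx P f g s p →
        proxGap P f s p x ≤ 1 / 32 * (P.μ / 2 * ‖x₀ - p‖ ^ 2 + breg P f g p x' + δ) := by
  have hμ := hb.mu_pos
  obtain ⟨y, hy, hyY, hyδ⟩ := hP.agd_det hμ hb.mu_le hx' (b.agdIters δ)
  obtain ⟨u, hu, v, hv, hd, h⟩ := hP.mirrorProx_det hμ hb.L_pos s hx₀ hyY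
    (iters_pos hb.L_pos (by norm_num) hb.mirror)
  refine ⟨u, hu, ?_, fun p hp => ?_⟩
  · exact Det.bind (n := 1 + b.agdIters δ) (m := 2 * b.mirrorIters) hy
      (Det.bind (m := 0) hd (Det.pure _))
  have h1 := hP.mirrorProx_proxGap_le hμ hb.mu_le hp hb.mirror hu hv h
  have h2 := norm_sub_sq_le_two_mul y (bestResp P f x') (bestResp P f p)
  have h3 := hP.half_sq_bestResp_le_breg hp.1 hx'
  have h4 := hyδ.trans (hb.agd δ hδ)
  have h5 := mul_le_mul_of_nonneg_left h2 hμ.le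
  have h6 : 0 ≤ P.μ * ‖x₀ - p‖ ^ 2 := by positivity
  linarith

/-- The multilevel estimator is `multilevel x G` for a random `G` and a sequence `x` that converges
geometrically to the prox point. -/
theorem unbiasedProx_spec (hb : IsSufficient P R' b) {δ : ℝ} (hδ : 0 < δ) {s x' : E}
    (hs : s ∈ P.X) (hx' : x' ∈ P.X) {p : E} (hp : IsProx P f g s p) :
    ∃ x : ℕ → E, (∀ j, ‖x j - p‖ ^ 2 ≤
        1 / (16 * P.μ) * (P.μ / 2 * ‖s - p‖ ^ 2 + breg P f g p x' + δ) / 4 ^ j) ∧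
      (∀ {β : Type} (k : E → GradProg E F β) (h : β → ℝ≥0∞),
        (unbiasedProx P b δ s x' >>= k).ev g h =
          ∑' n, geomHalf n * (k (multilevel x n)).ev g h) ∧
      (∀ {β : Type} (k : E → GradProg E F β) (S : β → Prop), (∀ z, (k z).Always g S) →
        (unbiasedProx P b δ s x' >>= k).Always g S) ∧
      (unbiasedProx P b δ s x').cost g = proxQueries b (δ / 8) + ∑' n, geomHalf n *
        (∑ j ∈ Finset.range (n + 2), proxQueries b (δ / 8 / 4 ^ (j + 1)) : ℕ) := by
  have hμ := hb.mu_pos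
  obtain ⟨x0, hx0, hd0, hg0⟩ := hP.approxProx_det hb (δ := δ / 8) (by positivity) (s := s) hs hx'
  have hstep : ∀ j : ℕ, ∀ x ∈ P.X, ∃ x1 ∈ P.X,
      Det g (approxProx P b (δ / 8 / 4 ^ (j + 1)) s x x) x1
        (proxQueries b (δ / 8 / 4 ^ (j + 1))) ∧
      ∀ p, IsProx P f g s p → proxGap P f s p x1 ≤
        1 / 32 * (P.μ / 2 * ‖x - p‖ ^ 2 + breg P f g p x + δ / 8 / 4 ^ (j + 1)) :=
    fun j x hx => hP.approxProx_det hb (by positivity) hx hx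
  choose! φ hφX hφD hφG using hstep
  -- Levels do not depend on the draw, so one infinite sequence describes all runs; the draw only
  -- selects where it is cut.
  let x : ℕ → E := fun j => Nat.rec x0 (fun j x => φ j x) j
  have hxX : ∀ j, x j ∈ P.X := fun j => by
    induction j with
    | zero => exact hx0
    | succ j ih => exact hφX j _ ih
  have hxD : ∀ j, Det g (approxProx P b (δ / 8 / 4 ^ (j + 1)) s (x j) (x j)) (x (j + 1))
      (proxQueries b (δ / 8 / 4 ^ (j + 1))) := fun j => hφD j _ (hxX j)
  set B := 1 / 32 * (P.μ / 2 * ‖s - p‖ ^ 2 + breg P f g p x' + δ) with hB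
  have hbx' := hP.breg_nonneg hμ hp.1 hx'
  have hns : 0 ≤ P.μ / 2 * ‖s - p‖ ^ 2 := by positivity
  have hBδ : 1 / 32 * δ ≤ B := by rw [hB]; linarith
  -- From level 1 on, both error terms of a prox step refer to the previous level, and that level's
  -- prox gap bounds them together. The decay of the errors δ_j preserves the ratio 1/4.
  have hD : ∀ j, breg P f g p (x j) + P.μ / 2 * ‖x j - p‖ ^ 2 ≤ B / 4 ^ j := fun j => by
    have h1 : ∀ j, breg P f g p (x j) + P.μ / 2 * ‖x j - p‖ ^ 2 ≤ proxGap P f s p (x j) :=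
      fun j => hp.breg_add_le (hxX j)
    induction j with
    | zero =>
      refine (h1 0).trans ((hg0 p hp).trans ?_)
      rw [hB, pow_zero]; linarith
    | succ j ih =>
      refine (h1 (j + 1)).trans ((hφG j _ (hxX j) p hp).trans ?_)
      have h4 : (0 : ℝ) < 4 ^ j := by positivity
      change 1 / 32 * (P.μ / 2 * ‖x j - p‖ ^ 2 + breg P f g p (x j) + δ / 8 / 4 ^ (j + 1)) ≤ _
      have e1 : B / 4 ^ (j + 1) = B / 4 ^ j / 4 := by rw [pow_succ]; field_simp
      have e2 : δ / 8 / 4 ^ (j + 1) = δ / 4 ^ j / 32 := by rw [pow_succ]; field_simp; norm_num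
      have h5 := div_le_div_of_nonneg_right hBδ h4.le
      rw [mul_div_assoc] at h5
      have h6 : 0 ≤ δ / 4 ^ j := by positivity
      rw [e1, e2]
      linarith
  have hbody : ∀ n : ℕ, Det g (do
      let x1 ← approxProx P b (δ / 8 / 4) s x0 x0
      let r ← loop (n + 1) (fun i (r : E × E) => do
        let x ← approxProx P b (δ / 8 / 4 ^ (i + 2)) s r.2 r.2
        return (r.2, x)) (x1, x1)
      return x1 + (2 : ℝ) ^ (n + 1) • (r.2 - r.1) : GradProg E F E) (multilevel x n)
      (∑ j ∈ Finset.range (n + 2), proxQueries b (δ / 8 / 4 ^ (j + 1))) := by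
    intro n
    have h1 := hxD 0
    rw [zero_add, pow_one] at h1
    -- The loop starts from (x₁, x₁) rather than (x₀, x₁); at least one iteration runs, so the
    -- irregular first component is overwritten.
    let st : ℕ → E × E := fun i => if i = 0 then (x 1, x 1) else (x i, x (i + 1))
    have hst : ∀ i, (st i).2 = x (i + 1) := fun i => by
      by_cases hi : i = 0
      · simp [st, hi]
      · simp [st, hi]
    have h2 := Det.loop (O := g) (step := fun i (r : E × E) => (do
        let x ← approxProx P b (δ / 8 / 4 ^ (i + 2)) s r.2 r.2
        return (r.2, x) : GradProg E F (E × E))) (s := st)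
        (c := fun i => proxQueries b (δ / 8 / 4 ^ (i + 2))) (n + 1) (fun i _ => by
      have h3 := hxD (i + 1)
      rw [← hst i] at h3
      have e : st (i + 1) = ((st i).2, x (i + 2)) := by rw [hst]; simp [st]
      rw [e]
      exact Det.bind (m := 0) h3 (Det.pure _))
    rw [Finset.sum_range_succ' _ (n + 1), add_comm (Finset.sum _ _), zero_add,
      pow_one]
    refine Det.bind h1 ?_
    refine Det.bind (m := 0) h2 ?_
    have e : st (n + 1) = (x (n + 1), x (n + 2)) := by simp [st]
    rw [e]
    exact Det.pure _
  refine ⟨x, fun j => ?_, fun k h => ?_, fun k S hk => ?_, ?_⟩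
  · have h1 := hD j
    have h2 := hP.breg_nonneg hμ hp.1 (hxX j)
    have e : 1 / (16 * P.μ) * (P.μ / 2 * ‖s - p‖ ^ 2 + breg P f g p x' + δ) / 4 ^ j =
        (2 / P.μ) * (B / 4 ^ j) := by rw [hB]; field_simp; norm_num
    rw [e]
    have h3 : P.μ / 2 * ‖x j - p‖ ^ 2 ≤ B / 4 ^ j := by linarith
    calc ‖x j - p‖ ^ 2 = (2 / P.μ) * (P.μ / 2 * ‖x j - p‖ ^ 2) := by field_simp
      _ ≤ _ := mul_le_mul_of_nonneg_left h3 (by positivity)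
  · rw [Prog.ev_bind, unbiasedProx, hd0.ev_bind, Prog.ev_draw_bind]
    refine tsum_congr fun n => ?_
    rw [← Prog.ev_bind, (hbody n).ev_bind]
  · refine Prog.always_bind (S := fun _ => True) ?_ (fun a _ => hk a)
    rw [unbiasedProx]
    exact hd0.always_bind (Prog.always_draw_bind fun n => (hbody n).always trivial)
  · rw [unbiasedProx, hd0.cost_bind, Prog.cost_draw_bind]
    congr 1
    exact tsum_congr fun n => by rw [(hbody n).cost_eq]

end IsMaxProblem

end ProxSteps

/-! ### The accelerated proximal point loop -/

section AcceleratedLoop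

/-- With q = 1/α_t, both bounds follow from 2q ≤ √(1 + (2q)²) ≤ 1 + 2q. -/
theorem one_div_alpha_succ (t : ℕ) :
    1 / alpha t + 1 / 2 ≤ 1 / alpha (t + 1) ∧ 1 / alpha (t + 1) ≤ 1 / alpha t + 1 := by
  have h0 := alpha_pos t
  have h1 : 1 / alpha (t + 1) = (1 + √(1 + 4 / alpha t ^ 2)) / 2 := by rw [alpha, one_div_div]
  have e : 4 / alpha t ^ 2 = (2 * (1 / alpha t)) ^ 2 := by field_simp; norm_num
  have h2 : 0 < 1 / alpha t := by positivity
  rw [h1, e]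
  constructor
  · have : 2 * (1 / alpha t) ≤ √(1 + (2 * (1 / alpha t)) ^ 2) :=
      Real.le_sqrt_of_sq_le (by linarith)
    linarith
  · have : √(1 + (2 * (1 / alpha t)) ^ 2) ≤ 1 + 2 * (1 / alpha t) :=
      Real.sqrt_le_iff.2 ⟨by positivity, by nlinarith⟩
    linarith

theorem one_div_alpha_bounds (t : ℕ) :
    ((t : ℝ) + 2) / 2 ≤ 1 / alpha t ∧ 1 / alpha t ≤ t + 1 := by
  induction t with
  | zero => simp [alpha]
  | succ t ih =>
    have := one_div_alpha_succ t
    push_cast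
    constructor <;> linarith [this.1, this.2, ih.1, ih.2]

theorem alpha_le (t : ℕ) : alpha t ≤ 2 / (t + 2) := by
  have h := (one_div_alpha_bounds t).1
  rw [← one_div_div, le_one_div (alpha_pos t) (by positivity)]
  exact h

theorem le_alpha (t : ℕ) : 1 / ((t : ℝ) + 1) ≤ alpha t := by
  rw [one_div_le (by positivity) (alpha_pos t)]
  exact (one_div_alpha_bounds t).2

variable {E F : Type}
variable [NormedAddCommGroup E] [InnerProductSpace ℝ E]
variable [NormedAddCommGroup F] [InnerProductSpace ℝ F]
variable {P : Input E F} {R' : ℝ} {f : E → F → ℝ} {g : E × F → E × F} {b : Budget}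

/-- The additive error of iteration `t + 1`. -/
def loopError (P : Input E F) (σ : ℝ) (t : ℕ) : ℝ :=
  σ * (alpha (t + 1) ^ 2 * P.μ * P.R ^ 2 / (4 * ((t + 1 : ℕ) : ℝ) ^ 2))

/-- The prox center of iteration `t + 1`. -/
def loopCenter (t : ℕ) (r : E × E) : E := (1 - alpha (t + 1)) • r.1 + alpha (t + 1) • r.2

/-- One iteration of the accelerated proximal point method. -/
def recappStep (P : Input E F) (b : Budget) (σ : ℝ) (t : ℕ) (r : E × E) :
    GradProg E F (E × E) := do
  let x' ← approxProx P b (loopError P σ t) (loopCenter t r) (loopCenter t r) r.1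
  let xt ← unbiasedProx P b (loopError P σ t) (loopCenter t r) r.1
  return (x', proj P.X (r.2 - (alpha (t + 1))⁻¹ • (loopCenter t r - xt)))

theorem recappLoop_eq (P : Input E F) (b : Budget) (σ : ℝ) (T : ℕ) (x : E) :
    recappLoop P b σ T x = (do
      let r ← loop T (recappStep P b σ) (x, x)
      return r.1) := rfl

/-- The potential of the accelerated proximal point method with respect to a minimizer `u`. -/
def loopPotential (P : Input E F) (f : E → F → ℝ) (u : E) (t : ℕ) (r : E × E) : ℝ :=
  (maxFun P.Y f r.1 - maxFun P.Y f u) / alpha t ^ 2 + P.μ / 2 * ‖r.2 - u‖ ^ 2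

namespace IsMaxProblem

section Descent

variable [ProperSpace F] (hP : IsMaxProblem P R' f g)
include hP

/-- Progress of one accelerated step whose prox step has a small relative error. -/
theorem maxFun_sub_le_of_proxGap_le (hμ : 0 < P.μ) {α δ : ℝ} (hα : 0 < α) (hα' : α ≤ 3 / 4)
    (hδ : 0 ≤ δ) {x v u x' s p : E} (hx : x ∈ P.X) (hu : u ∈ P.X) (hx' : x' ∈ P.X)
    (hs : s = (1 - α) • x + α • v) (hp : IsProx P f g s p)
    (hgap : proxGap P f s p x' ≤ 1 / 32 * (P.μ / 2 * ‖s - p‖ ^ 2 + breg P f g p x + δ)) :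
    maxFun P.Y f x' - maxFun P.Y f u ≤ (1 - α) * (maxFun P.Y f x - maxFun P.Y f u) +
      P.μ * α * inner ℝ (s - p) (v - u) - P.μ / 2 * ‖s - p‖ ^ 2 -
      11 / 64 * (P.μ / 2 * ‖s - p‖ ^ 2 + breg P f g p x + δ) + δ := by
  have hw : (1 - α) • x + α • u ∈ P.X := hP.convexX hx hu (by linarith) hα.le (by ring)
  -- Testing prox optimality at (1 - α)x + αu makes the displacement from s equal to -α(v - u),
  -- which is the term that the update of v cancels.
  have h1 := hp.2 _ hw
  have h2 := hP.breg_nonneg hμ hp.1 hu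
  have h3 := hp.breg_add_le hx'
  have h4 := hP.breg_nonneg hμ hp.1 hx'
  have h5 := hP.breg_nonneg hμ hp.1 hx
  have e1 : (1 - α) • x + α • u - p = (s - p) - α • (v - u) := by rw [hs]; module
  have e2 : inner ℝ (maxGrad P f g p) ((1 - α) • x + α • u - p) =
      (1 - α) * inner ℝ (maxGrad P f g p) (x - p) + α * inner ℝ (maxGrad P f g p) (u - p) := by
    rw [← inner_smul_right, ← inner_smul_right, ← inner_add_right]; congr 1; module
  have e3 : inner ℝ (P.μ • (p - s)) ((1 - α) • x + α • u - p) =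
      - (P.μ * ‖s - p‖ ^ 2) + P.μ * α * inner ℝ (s - p) (v - u) := by
    rw [e1, inner_sub_right, inner_smul_right, inner_smul_left, inner_smul_left, ← neg_sub s p,
      inner_neg_left, inner_neg_left, real_inner_self_eq_norm_sq]
    simp only [conj_trivial]; ring
  rw [inner_add_left, e2, e3] at h1
  have h6 := norm_sub_sq_le_two_mul s x' p
  rw [norm_sub_rev s x'] at h6
  have h7 := mul_le_mul_of_nonneg_left h6 hμ.le
  change breg P f g p x' + P.μ / 2 * ‖x' - p‖ ^ 2 ≤ proxGap P f s p x' at h3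
  have h8 : proxGap P f s p x' = maxFun P.Y f x' + P.μ / 2 * ‖x' - s‖ ^ 2 -
    (maxFun P.Y f p + P.μ / 2 * ‖s - p‖ ^ 2) := by rw [proxGap, norm_sub_rev p s]
  have h9 : breg P f g p x = maxFun P.Y f x - maxFun P.Y f p -
    inner ℝ (maxGrad P f g p) (x - p) := rfl
  have h10 : breg P f g p u = maxFun P.Y f u - maxFun P.Y f p -
    inner ℝ (maxGrad P f g p) (u - p) := rfl
  have h11 : 0 ≤ P.μ * ‖s - p‖ ^ 2 := by positivity
  -- This is where α ≤ 3/4 is used. The prox error is spent twice, in the value and in ‖x' - s‖², so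
  -- the budget is 2/32 + 11/64 = 15/64 ≤ 1/4.
  have h12 : 1 / 4 * breg P f g p x ≤ (1 - α) * breg P f g p x :=
    mul_le_mul_of_nonneg_right (by linarith) h5
  have h13 := mul_nonneg hα.le h2
  have h14 : (1 - α) * inner ℝ (maxGrad P f g p) (x - p) =
      (1 - α) * (maxFun P.Y f x - maxFun P.Y f p) - (1 - α) * breg P f g p x := by rw [h9]; ring
  have h15 : α * inner ℝ (maxGrad P f g p) (u - p) =
      α * (maxFun P.Y f u - maxFun P.Y f p) - α * breg P f g p u := by rw [h10]; ring
  rw [h14, h15] at h1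
  linarith

end Descent

variable [ProperSpace E] [ProperSpace F] (hP : IsMaxProblem P R' f g)
include hP

omit [ProperSpace E] [ProperSpace F] in
theorem loopCenter_mem (t : ℕ) {r : E × E} (h1 : r.1 ∈ P.X) (h2 : r.2 ∈ P.X) :
    loopCenter t r ∈ P.X :=
  hP.convexX h1 h2 (by linarith [(alpha_spec t).1]) (alpha_pos _).le (by ring)

/-- The second moment of the estimator costs 11/64 of S, scaled by 1/α²; the descent inequality
reserved exactly this amount. Unbiasedness removes the cross term and the recursion for α matches
the value terms. -/
theorem recappStep_spec (hb : IsSufficient P R' b) {σ : ℝ} (hσ : 0 < σ) {u : E} (hu : u ∈ P.X)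
    (hmin : ∀ x ∈ P.X, maxFun P.Y f u ≤ maxFun P.Y f x) (t : ℕ) {r : E × E}
    (hr1 : r.1 ∈ P.X) (hr2 : r.2 ∈ P.X) :
    (recappStep P b σ t r).Always g (fun r => r.1 ∈ P.X ∧ r.2 ∈ P.X) ∧
    (recappStep P b σ t r).ev g (fun r => ENNReal.ofReal (loopPotential P f u (t + 1) r)) ≤
      ENNReal.ofReal (loopPotential P f u t r) +
        ENNReal.ofReal (σ * (P.μ * P.R ^ 2 / (4 * ((t : ℝ) + 1) ^ 2))) ∧
    (recappStep P b σ t r).cost g ≤ proxQueries b (loopError P σ t) +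
      (proxQueries b (loopError P σ t / 8) + ∑' n, geomHalf n *
        (∑ j ∈ Finset.range (n + 2), proxQueries b (loopError P σ t / 8 / 4 ^ (j + 1)) : ℕ)) := by
  have hμ := hb.mu_pos
  have hR := hb.R_pos
  obtain ⟨x, v⟩ := r
  simp only at hr1 hr2
  have hα := alpha_pos (t + 1)
  have hα1 : alpha (t + 1) ≤ 3 / 4 := by
    refine (alpha_le _).trans ?_
    push_cast
    rw [div_le_div_iff₀ (by positivity) (by norm_num)]
    linarith [Nat.cast_nonneg (α := ℝ) t]
  have hα2 := (alpha_spec t).2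
  have hδ : 0 < loopError P σ t := by rw [loopError]; positivity
  have hδ' : loopError P σ t / alpha (t + 1) ^ 2 =
      σ * (P.μ * P.R ^ 2 / (4 * ((t : ℝ) + 1) ^ 2)) := by
    rw [loopError]; push_cast; field_simp
  have hs := hP.loopCenter_mem t (r := (x, v)) hr1 hr2
  have hs0 : loopCenter t (x, v) = (1 - alpha (t + 1)) • x + alpha (t + 1) • v := rfl
  rw [recappStep]
  simp only
  set α := alpha (t + 1)
  set δ := loopError P σ t
  set s := loopCenter t (x, v)
  obtain ⟨p, hp⟩ := hP.exists_isProx hμ hb.L_pos.le s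
  obtain ⟨x', hx', hd, hgap⟩ := hP.approxProx_det hb hδ (s := s) hs hr1
  obtain ⟨z, hz, hev, halw, hcost⟩ := hP.unbiasedProx_spec hb hδ hs hr1 hp
  have hproj := proj_spec ⟨_, hP.xinit_mem⟩ hP.closedX.isComplete hP.convexX
  have hX : ∀ xt : E, (pure (x', proj P.X (v - α⁻¹ • (s - xt))) : GradProg E F (E × E)).Always g
      (fun r => r.1 ∈ P.X ∧ r.2 ∈ P.X) := fun xt => always_pure ⟨hx', (hproj _).1⟩
  refine ⟨?_, ?_, ?_⟩
  · exact hd.always_bind (halw _ _ hX)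
  · rw [hd.ev_bind, hev]
    simp only [ev_pure]
    set S := P.μ / 2 * ‖s - p‖ ^ 2 + breg P f g p x + δ with hS
    -- The displacement from u after an update with the exact prox point, before projection; only
    -- the estimator noise is random.
    set a : E := (v - u) - α⁻¹ • (s - p) with ha
    set M := 11 / 2 * (1 / (16 * P.μ) * S) with hM
    have hkey := hP.maxFun_sub_le_of_proxGap_le hμ hα hα1 hδ.le hr1 hu hx' hs0 hp (hgap p hp)
    have hx'u := sub_nonneg.2 (hmin x' hx')
    have hxu := sub_nonneg.2 (hmin x hr1)
    set c := (maxFun P.Y f x' - maxFun P.Y f u) / α ^ 2 with hc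
    have hc0 : 0 ≤ c := by positivity
    have hnear : ∀ n, ‖proj P.X (v - α⁻¹ • (s - multilevel z n)) - u‖ ^ 2 ≤
        ‖a‖ ^ 2 + 2 * (α⁻¹ * inner ℝ a (multilevel z n - p)) + α⁻¹ ^ 2 * M := by
      intro n
      refine ((hproj _).2 u hu).trans ?_
      have e : v - α⁻¹ • (s - multilevel z n) - u = a + α⁻¹ • (multilevel z n - p) := by
        rw [ha]; module
      rw [e, norm_add_sq_real, norm_smul, mul_pow, inner_smul_right, Real.norm_eq_abs, sq_abs]
      have := mul_le_mul_of_nonneg_left (norm_multilevel_sub_sq_le hz n) (sq_nonneg α⁻¹)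
      rw [← hM] at this
      linarith
    have hsum : HasSum (fun n : ℕ => (1 / 2 : ℝ) ^ (n + 1) * (c + P.μ / 2 * (‖a‖ ^ 2 +
        2 * (α⁻¹ * inner ℝ a (multilevel z n - p)) + α⁻¹ ^ 2 * M)))
        (c + P.μ / 2 * (‖a‖ ^ 2 + α⁻¹ ^ 2 * M)) := by
      have h1 := (hasSum_multilevel_sub hz).mapL (innerSL ℝ a)
      have h2 := hasSum_half_pow_succ.mul_right (c + P.μ / 2 * (‖a‖ ^ 2 + α⁻¹ ^ 2 * M))
      have h3 := h2.add (h1.mul_left (P.μ * α⁻¹))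
      rw [map_zero, mul_zero, add_zero, one_mul] at h3
      refine (congrArg (fun w : ℕ → ℝ => HasSum w (c + P.μ / 2 * (‖a‖ ^ 2 + α⁻¹ ^ 2 * M))) ?_).mpr h3
      funext n
      rw [innerSL_apply_apply, inner_smul_right]; ring
    -- The cross term may be negative, but the whole expression dominates a square, so no truncation
    -- by `ENNReal.ofReal` spoils the cancellation in the sum.
    have hnonneg : ∀ n, 0 ≤ c + P.μ / 2 * (‖a‖ ^ 2 +
        2 * (α⁻¹ * inner ℝ a (multilevel z n - p)) + α⁻¹ ^ 2 * M) := fun n => by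
      have := (sq_nonneg _).trans (hnear n)
      positivity
    calc ∑' n, geomHalf n * ENNReal.ofReal (loopPotential P f u (t + 1)
          (x', proj P.X (v - α⁻¹ • (s - multilevel z n))))
        ≤ ∑' n, geomHalf n * ENNReal.ofReal (c + P.μ / 2 * (‖a‖ ^ 2 +
            2 * (α⁻¹ * inner ℝ a (multilevel z n - p)) + α⁻¹ ^ 2 * M)) := by
          refine ENNReal.tsum_le_tsum fun n => mul_le_mul_right (ENNReal.ofReal_le_ofReal ?_) _
          exact add_le_add_right (mul_le_mul_of_nonneg_left (hnear n) (half_pos hμ).le) _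
      _ = ENNReal.ofReal (c + P.μ / 2 * (‖a‖ ^ 2 + α⁻¹ ^ 2 * M)) :=
          tsum_geomHalf_mul_ofReal hnonneg hsum
      _ ≤ ENNReal.ofReal (loopPotential P f u t (x, v) + δ / α ^ 2) := by
          refine ENNReal.ofReal_le_ofReal ?_
          have e1 : ‖a‖ ^ 2 = ‖v - u‖ ^ 2 - 2 * (α⁻¹ * inner ℝ (s - p) (v - u)) +
              α⁻¹ ^ 2 * ‖s - p‖ ^ 2 := by
            rw [ha, norm_sub_sq_real, norm_smul, mul_pow, inner_smul_right, Real.norm_eq_abs,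
              sq_abs, real_inner_comm]
          have e2 : P.μ / 2 * M = 11 / 64 * S := by rw [hM]; field_simp; norm_num; ring
          have e3 : loopPotential P f u t (x, v) = (1 / α ^ 2 - 1 / α) *
              (maxFun P.Y f x - maxFun P.Y f u) + P.μ / 2 * ‖v - u‖ ^ 2 := by
            rw [hα2, loopPotential]; ring
          have h1 : c ≤ ((1 - α) * (maxFun P.Y f x - maxFun P.Y f u) +
              P.μ * α * inner ℝ (s - p) (v - u) - P.μ / 2 * ‖s - p‖ ^ 2 - 11 / 64 * S + δ) /
                α ^ 2 := div_le_div_of_nonneg_right hkey (by positivity)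
          have e4 : ((1 - α) * (maxFun P.Y f x - maxFun P.Y f u) +
              P.μ * α * inner ℝ (s - p) (v - u) - P.μ / 2 * ‖s - p‖ ^ 2 - 11 / 64 * S + δ) /
                α ^ 2 = (1 / α ^ 2 - 1 / α) * (maxFun P.Y f x - maxFun P.Y f u) +
              P.μ * (α⁻¹ * inner ℝ (s - p) (v - u)) - P.μ / 2 * (α⁻¹ ^ 2 * ‖s - p‖ ^ 2) -
              α⁻¹ ^ 2 * (P.μ / 2 * M) + δ / α ^ 2 := by
            rw [e2]; field_simp
          rw [e4] at h1
          rw [e3, e1]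
          linarith
      _ ≤ _ := by rw [hδ']; exact ENNReal.ofReal_add_le
  · rw [hd.cost_bind]
    gcongr
    rw [← hcost, ← add_zero ((unbiasedProx P b δ s x).cost g)]
    exact cost_bind_le (always_true _) fun a _ => le_of_eq (cost_pure _)

end IsMaxProblem

end AcceleratedLoop

/-! ### Expected accuracy and query bounds of the full algorithms. -/

section Guarantees

/-- Each term is at most 1/(4t + 2) - 1/(4t + 6), so the sum telescopes. -/
theorem sum_one_div_sq_le (T : ℕ) :
    ∑ t ∈ Finset.range T, 1 / (4 * ((t : ℝ) + 1) ^ 2) ≤ 1 / 2 := by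
  have : ∑ t ∈ Finset.range T, 1 / (4 * ((t : ℝ) + 1) ^ 2) ≤
      1 / 2 - 1 / (4 * (T : ℝ) + 2) := by
    induction T with
    | zero => simp
    | succ T ih =>
      rw [Finset.sum_range_succ]
      have h : 1 / (4 * ((T : ℝ) + 1) ^ 2) ≤ 1 / (4 * (T : ℝ) + 2) - 1 / (4 * ((T + 1 : ℕ) : ℝ) + 2) := by
        push_cast
        rw [div_sub_div _ _ (by positivity) (by positivity),
          div_le_div_iff₀ (by positivity) (by positivity)]
        nlinarith
      linarith
  have h : (0 : ℝ) ≤ 1 / (4 * (T : ℝ) + 2) := by positivity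
  linarith

variable {E F : Type}
variable [NormedAddCommGroup E] [InnerProductSpace ℝ E]
variable [NormedAddCommGroup F] [InnerProductSpace ℝ F]
variable {P : Input E F} {R' : ℝ} {f : E → F → ℝ} {g : E × F → E × F} {b : Budget}

/-- A bound for the expected number of queries of one iteration of the loop. -/
def stepQueries (b : Budget) (δ : ℝ) : ℝ≥0∞ :=
  proxQueries b δ + (proxQueries b (δ / 8) + ∑' n, geomHalf n *
    (∑ j ∈ Finset.range (n + 2), proxQueries b (δ / 8 / 4 ^ (j + 1)) : ℕ))

namespace IsMaxProblem

variable [ProperSpace E] [ProperSpace F] (hP : IsMaxProblem P R' f g)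
include hP

theorem recappLoop_always (hb : IsSufficient P R' b) {σ : ℝ} (hσ : 0 < σ) (T : ℕ) {x : E}
    (hx : x ∈ P.X) : (recappLoop P b σ T x).Always g (· ∈ P.X) := by
  obtain ⟨u, hu, hmin, -⟩ := hP.exists_minimizer hb.mu_pos hb.L_pos.le
  rw [recappLoop_eq]
  exact always_bind (always_loop (fun t r hr =>
    (hP.recappStep_spec hb hσ hu hmin t hr.1 hr.2).1) T ⟨hx, hx⟩) fun r hr => always_pure hr.1

theorem recappLoop_cost (hb : IsSufficient P R' b) {σ : ℝ} (hσ : 0 < σ) (T : ℕ) {x : E}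
    (hx : x ∈ P.X) {c : ℝ≥0∞} (hc : ∀ t < T, stepQueries b (loopError P σ t) ≤ c) :
    (recappLoop P b σ T x).cost g ≤ T * c := by
  obtain ⟨u, hu, hmin, -⟩ := hP.exists_minimizer hb.mu_pos hb.L_pos.le
  rw [recappLoop_eq, ← add_zero (_ * c)]
  refine (cost_bind_le (always_true _) fun a _ => le_of_eq (cost_pure _)).trans ?_
  gcongr
  exact cost_loop_le (S := fun r => r.1 ∈ P.X ∧ r.2 ∈ P.X) T (fun t r hr =>
    (hP.recappStep_spec hb hσ hu hmin t hr.1 hr.2).1) (fun t ht r hr =>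
    (hP.recappStep_spec hb hσ hu hmin t hr.1 hr.2).2.2.trans (hc t ht)) ⟨hx, hx⟩

theorem recappLoop_ev (hb : IsSufficient P R' b) {σ : ℝ} (hσ : 0 < σ) {u : E} (hu : u ∈ P.X)
    (hmin : ∀ x ∈ P.X, maxFun P.Y f u ≤ maxFun P.Y f x) (T : ℕ) {x : E} (hx : x ∈ P.X) :
    (recappLoop P b σ T x).ev g (fun x => ENNReal.ofReal (maxFun P.Y f x - maxFun P.Y f u)) ≤
      ENNReal.ofReal (alpha T ^ 2 * (maxFun P.Y f x - maxFun P.Y f u + P.μ / 2 * ‖x - u‖ ^ 2 +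
        σ * (P.μ * P.R ^ 2) / 2)) := by
  have hμ := hb.mu_pos
  have hα := alpha_pos T
  have hxu := sub_nonneg.2 (hmin x hx)
  have hstep : ∀ (t : ℕ) (r : E × E), (r.1 ∈ P.X ∧ r.2 ∈ P.X) → _ :=
    fun t r hr => hP.recappStep_spec hb hσ hu hmin t hr.1 hr.2
  have halw := always_loop (fun t r hr => (hstep t r hr).1) T (a := (x, x)) ⟨hx, hx⟩
  have hev := ev_loop_le (Φ := fun t r => ENNReal.ofReal (loopPotential P f u t r))
    (fun t r hr => (hstep t r hr).1) (fun t r hr => (hstep t r hr).2.1) T (a := (x, x)) ⟨hx, hx⟩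
  rw [recappLoop_eq, Prog.ev_bind]
  simp only [ev_pure]
  calc _ ≤ (loop T (recappStep P b σ) (x, x)).ev g fun r =>
        ENNReal.ofReal (alpha T ^ 2) * ENNReal.ofReal (loopPotential P f u T r) := by
        refine ev_mono halw fun r hr => ?_
        rw [← ENNReal.ofReal_mul (by positivity)]
        refine ENNReal.ofReal_le_ofReal ?_
        have h : alpha T ^ 2 * loopPotential P f u T r = maxFun P.Y f r.1 - maxFun P.Y f u +
            alpha T ^ 2 * (P.μ / 2 * ‖r.2 - u‖ ^ 2) := by
          rw [loopPotential]; field_simp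
        rw [h]
        have : 0 ≤ alpha T ^ 2 * (P.μ / 2 * ‖r.2 - u‖ ^ 2) := by positivity
        linarith
    _ = ENNReal.ofReal (alpha T ^ 2) * (loop T (recappStep P b σ) (x, x)).ev g fun r =>
        ENNReal.ofReal (loopPotential P f u T r) := ev_const_mul _ _ _
    _ ≤ ENNReal.ofReal (alpha T ^ 2) * ENNReal.ofReal (maxFun P.Y f x - maxFun P.Y f u +
          P.μ / 2 * ‖x - u‖ ^ 2 + σ * (P.μ * P.R ^ 2) / 2) := by
        gcongr
        refine hev.trans ?_
        rw [← ENNReal.ofReal_sum_of_nonneg (fun t _ => by positivity),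
          ← ENNReal.ofReal_add (by rw [loopPotential]; positivity)
            (Finset.sum_nonneg fun t _ => by positivity)]
        refine ENNReal.ofReal_le_ofReal ?_
        have h1 : loopPotential P f u 0 (x, x) = maxFun P.Y f x - maxFun P.Y f u +
            P.μ / 2 * ‖x - u‖ ^ 2 := by simp [loopPotential, alpha]
        have h2 := mul_le_mul_of_nonneg_left (sum_one_div_sq_le T)
          (show 0 ≤ σ * (P.μ * P.R ^ 2) by positivity)
        rw [Finset.mul_sum] at h2
        rw [h1]
        have h3 : ∀ t : ℕ, σ * (P.μ * P.R ^ 2 / (4 * ((t : ℝ) + 1) ^ 2)) =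
            σ * (P.μ * P.R ^ 2) * (1 / (4 * ((t : ℝ) + 1) ^ 2)) := fun t => by ring
        simp only [h3]
        linarith
    _ = _ := (ENNReal.ofReal_mul (by positivity)).symm

omit [ProperSpace E] in
-- The pair (p, y*(p)) is a saddle point of a function that is μ-strongly convex-concave; testing
-- the duality gap there bounds the squared distance.
theorem mirrorProx_contract (hμ : 0 < P.μ) (hμL : P.μ ≤ P.L) {s p : E} (hp : IsProx P f g s p)
    {x₀ : E} {y₀ : F} {N : ℕ} (hN : 512 * P.L ≤ N * P.μ) {u : E} (hu : u ∈ P.X) {v : F}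
    (hv : v ∈ P.Y)
    (h : ∀ x ∈ P.X, ∀ y ∈ P.Y,
      N * (f u y + P.μ / 2 * ‖u - s‖ ^ 2 - (f x v + P.μ / 2 * ‖x - s‖ ^ 2)) ≤
        (P.L + P.μ) / 2 * (‖x₀ - x‖ ^ 2 + ‖y₀ - y‖ ^ 2)) :
    256 * (‖u - p‖ ^ 2 + ‖v - bestResp P f p‖ ^ 2) ≤
      ‖x₀ - p‖ ^ 2 + ‖y₀ - bestResp P f p‖ ^ 2 := by
  have hL : 0 < P.L := hμ.trans_le hμL
  have m := hP.bestResp_mem hp.1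
  have h1 := h p hp.1 _ m
  have h2 := hP.add_sq_le_bestResp hp.1 hv
  have h3 := hP.gradient_le_left hp.1 hu m
  have h4 := hp.2 u hu
  have h5 : ‖u - s‖ ^ 2 = ‖u - p‖ ^ 2 + 2 * inner ℝ (p - s) (u - p) + ‖p - s‖ ^ 2 := by
    rw [real_inner_comm, ← norm_add_sq_real]; congr 2; abel
  rw [inner_add_left, inner_smul_left, maxGrad] at h4
  simp only [conj_trivial] at h4
  set D := ‖u - p‖ ^ 2 + ‖v - bestResp P f p‖ ^ 2 with hD
  set D₀ := ‖x₀ - p‖ ^ 2 + ‖y₀ - bestResp P f p‖ ^ 2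
  have hD0 : 0 ≤ D := by positivity
  have hD₀ : 0 ≤ D₀ := by positivity
  have h6 : P.μ / 2 * D ≤ f u (bestResp P f p) + P.μ / 2 * ‖u - s‖ ^ 2 -
      (f p v + P.μ / 2 * ‖p - s‖ ^ 2) := by rw [h5, hD]; linarith
  have h7 := mul_le_mul_of_nonneg_left h6 (Nat.cast_nonneg (α := ℝ) N)
  have h8 : N * P.μ * D ≥ 512 * P.L * D := mul_le_mul_of_nonneg_right hN hD0
  have h9 : (P.L + P.μ) / 2 * D₀ ≤ P.L * D₀ := mul_le_mul_of_nonneg_right (by linarith) hD₀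
  refine le_of_mul_le_mul_left ?_ hL
  linarith

theorem warmStart_det (hb : IsSufficient P R' b) (hK : (P.L / P.μ) ^ 2 ≤ 256 ^ b.warmEpochs)
    (hK1 : 1 ≤ b.warmEpochs) {u : E} (hu : u ∈ P.X) :
    ∃ x ∈ P.X, Det g (warmStart P b) x
        (1 + b.agdIters (P.L * P.R ^ 2 / 2) + b.warmEpochs * (2 * b.warmIters)) ∧
      maxFun P.Y f x - maxFun P.Y f u ≤ 21 / 2 * (P.μ * P.R ^ 2) := by
  have hμ := hb.mu_pos
  have hL := hb.L_pos
  have hR := hb.R_pos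
  obtain ⟨p, hp⟩ := hP.exists_isProx hμ hL.le P.xinit
  obtain ⟨y, hy, hyY, hyδ⟩ := hP.agd_det hμ hb.mu_le hP.xinit_mem
    (b.agdIters (P.L * P.R ^ 2 / 2))
  have hy2 := hyδ.trans (hb.agd (P.L * P.R ^ 2 / 2) (by positivity))
  set D₀ := ‖P.xinit - p‖ ^ 2 + ‖y - bestResp P f p‖ ^ 2 with hD₀
  obtain ⟨z, hz, hz1, hz2, -, hzg⟩ := Det.loop_inv (O := g)
    (step := fun _ z => mirrorProx P P.xinit z b.warmIters) (c := 2 * b.warmIters)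
    (I := fun i z => z.1 ∈ P.X ∧ z.2 ∈ P.Y ∧
      256 ^ i * (‖z.1 - p‖ ^ 2 + ‖z.2 - bestResp P f p‖ ^ 2) ≤ D₀ ∧
      -- The starting point has no gap bound; it arises from the distance bound of the preceding
      -- epoch, hence the condition on i.
      (1 ≤ i → 256 ^ i * proxGap P f P.xinit p z.1 ≤ 2 * (P.μ * D₀)))
    (fun i z ⟨h1, h2, h3, h4⟩ => by
      obtain ⟨x', hx', v, hv, hd, h⟩ := hP.mirrorProx_det hμ hL P.xinit h1 h2
        (iters_pos hL (by norm_num) hb.warm)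
      have c1 := hP.mirrorProx_contract hμ hb.mu_le hp hb.warm hx' hv h
      have c2 := hP.mirrorProx_proxGap_le hμ hb.mu_le hp hb.warm hx' hv h
      have h256 : (0 : ℝ) < 256 ^ i := by positivity
      refine ⟨(x', v), hd, hx', hv, ?_, fun _ => ?_⟩
      · rw [pow_succ, mul_assoc]
        exact (mul_le_mul_of_nonneg_left c1 h256.le).trans h3
      · rw [pow_succ, mul_assoc]
        have c3 : P.μ * (‖z.1 - p‖ ^ 2 + 2 * ‖z.2 - bestResp P f p‖ ^ 2) ≤
            2 * (P.μ * (‖z.1 - p‖ ^ 2 + ‖z.2 - bestResp P f p‖ ^ 2)) := by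
          have : 0 ≤ P.μ * ‖z.1 - p‖ ^ 2 := by positivity
          linarith
        have c4 := mul_le_mul_of_nonneg_left (c2.trans c3) h256.le
        have c5 := mul_le_mul_of_nonneg_left h3 hμ.le
        linarith) b.warmEpochs (a := (P.xinit, y))
    ⟨hP.xinit_mem, hyY, by simp [hD₀], fun h => absurd h (by norm_num)⟩
  refine ⟨z.1, hz1, ?_, ?_⟩
  · exact Det.bind (n := 1 + b.agdIters (P.L * P.R ^ 2 / 2))
      (m := b.warmEpochs * (2 * b.warmIters)) hy (Det.bind (m := 0)
        (k := fun z : E × F => (pure z.1 : GradProg E F E)) hz (Det.pure _))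
  have d1 := pow_le_pow_left₀ (norm_nonneg _) (hP.diamX P.xinit hP.xinit_mem p hp.1) 2
  have d2 := norm_sub_sq_le_two_mul y (bestResp P f P.xinit) (bestResp P f p)
  have d3 := pow_le_pow_left₀ (by positivity)
    (hP.mul_norm_bestResp_sub_le hL.le hp.1 hP.xinit_mem) 2
  set κ := P.L / P.μ with hκ
  have hκ1 : 1 ≤ κ := (one_le_div hμ).2 hb.mu_le
  have hLκ : P.L = κ * P.μ := by rw [hκ]; field_simp
  have d4 : ‖bestResp P f P.xinit - bestResp P f p‖ ^ 2 ≤ κ ^ 2 * P.R ^ 2 := by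
    rw [mul_pow, mul_pow, hLκ, mul_pow] at d3
    have hμ2 : 0 < P.μ ^ 2 := by positivity
    have h5 := mul_le_mul_of_nonneg_left d1 (show 0 ≤ κ ^ 2 * P.μ ^ 2 by positivity)
    refine le_of_mul_le_mul_left ?_ hμ2
    linarith
  have d5 : ‖y - bestResp P f P.xinit‖ ^ 2 ≤ κ ^ 2 * P.R ^ 2 := by
    have h5 : P.μ * ‖y - bestResp P f P.xinit‖ ^ 2 ≤ P.μ * (κ * P.R ^ 2) := by
      rw [hLκ] at hy2; linarith
    have h6 := le_of_mul_le_mul_left h5 hμ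
    have h7 : κ * P.R ^ 2 ≤ κ ^ 2 * P.R ^ 2 :=
      mul_le_mul_of_nonneg_right (by nlinarith) (sq_nonneg _)
    linarith
  -- The 5 is 1 + 2 + 2: the distance in x, the error of the initial best response, and the
  -- best-response shift, each at most κ²R².
  have d6 : D₀ ≤ 5 * (256 ^ b.warmEpochs * P.R ^ 2) := by
    have h7 : P.R ^ 2 ≤ κ ^ 2 * P.R ^ 2 :=
      le_mul_of_one_le_left (sq_nonneg _) (one_le_pow₀ hκ1)
    have h8 : κ ^ 2 * P.R ^ 2 ≤ 256 ^ b.warmEpochs * P.R ^ 2 :=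
      mul_le_mul_of_nonneg_right hK (sq_nonneg _)
    linarith
  have d7 : proxGap P f P.xinit p z.1 ≤ 10 * (P.μ * P.R ^ 2) := by
    have h256 : (0 : ℝ) < 256 ^ b.warmEpochs := by positivity
    refine le_of_mul_le_mul_left ?_ h256
    have := mul_le_mul_of_nonneg_left d6 hμ.le
    have := hzg hK1
    linarith
  have d8 := hP.proxGap_nonneg hμ hp hu
  have d9 := pow_le_pow_left₀ (norm_nonneg _) (hP.diamX u hu P.xinit hP.xinit_mem) 2
  have d10 := mul_le_mul_of_nonneg_left d9 hμ.le
  have d11 : 0 ≤ P.μ * ‖z.1 - P.xinit‖ ^ 2 := by positivity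
  rw [proxGap] at d7 d8
  linarith

theorem recapp_spec (hb : IsSufficient P R' b) (hK : (P.L / P.μ) ^ 2 ≤ 256 ^ b.warmEpochs)
    (hK1 : 1 ≤ b.warmEpochs) (T : ℕ) {ε : ℝ} (hε : alpha T ^ 2 * (12 * (P.μ * P.R ^ 2)) ≤ ε)
    {c N : ℝ} (hc : 0 ≤ c)
    (hcost : ∀ t < T, stepQueries b (loopError P 1 t) ≤ ENNReal.ofReal c)
    (hN : (1 + b.agdIters (P.L * P.R ^ 2 / 2) + b.warmEpochs * (2 * b.warmIters) : ℕ) + T * c ≤ N) :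
    Solves P f g (recapp P b T) ε N := by
  have hμ := hb.mu_pos
  have hα := alpha_pos T
  obtain ⟨u, hu, hmin, hinf⟩ := hP.exists_minimizer hμ hb.L_pos.le
  obtain ⟨x, hx, hd, hgap⟩ := hP.warmStart_det hb hK hK1 hu
  refine ⟨Always.of_mem_support (hd.always_bind (hP.recappLoop_always hb one_pos T hx)), ?_, ?_⟩
  · rw [hinf, expect_run_fst (h := fun x => ENNReal.ofReal (maxFun P.Y f x - maxFun P.Y f u))]
    rw [recapp, hd.ev_bind]
    refine (hP.recappLoop_ev hb one_pos hu hmin T hx).trans (ENNReal.ofReal_le_ofReal ?_)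
    -- The 12 covers 21/2 from the warm start, 1/2 from the distance term and 1/2 from the additive
    -- errors.
    refine le_trans (mul_le_mul_of_nonneg_left ?_ (sq_nonneg _)) hε
    have h1 := pow_le_pow_left₀ (norm_nonneg _) (hP.diamX x hx u hu) 2
    have h2 := mul_le_mul_of_nonneg_left h1 hμ.le
    have h3 : 0 ≤ P.μ * P.R ^ 2 := by positivity
    linarith
  · rw [expect_run_snd, recapp, hd.cost_bind]
    calc _ ≤ _ + T * ENNReal.ofReal c :=
          add_le_add_right (hP.recappLoop_cost hb one_pos T hx hcost) _
      _ = ENNReal.ofReal ((1 + b.agdIters (P.L * P.R ^ 2 / 2) +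
            b.warmEpochs * (2 * b.warmIters) : ℕ) + T * c) := by
          rw [ENNReal.ofReal_add (by positivity) (by positivity),
            ENNReal.ofReal_mul (by positivity), ENNReal.ofReal_natCast, ENNReal.ofReal_natCast]
      _ ≤ _ := ENNReal.ofReal_le_ofReal hN

theorem restartedRecapp_spec (hb : IsSufficient P R' b)
    (hK : (P.L / P.μ) ^ 2 ≤ 256 ^ b.warmEpochs) (hK1 : 1 ≤ b.warmEpochs) {γ : ℝ} (hγ : 0 < γ)
    (hF : StrongConvexOn P.X γ (maxFun P.Y f)) (T K : ℕ) {ε : ℝ}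
    (hT : alpha T ^ 2 * (1 + P.μ / γ) ≤ 1 / 4) (hT' : alpha T ^ 2 ≤ 1 / 8)
    (hε : 12 * (P.μ * P.R ^ 2) ≤ 2 ^ K * ε) {c N : ℝ} (hc : 0 ≤ c)
    (hcost : ∀ k < K, ∀ t < T, stepQueries b (loopError P ((1 / 2) ^ (k + 1)) t) ≤
      ENNReal.ofReal c)
    (hN : (1 + b.agdIters (P.L * P.R ^ 2 / 2) + b.warmEpochs * (2 * b.warmIters) : ℕ) +
      K * (T * c) ≤ N) :
    Solves P f g (restartedRecapp P b T K) ε N := by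
  have hμ := hb.mu_pos
  have hR := hb.R_pos
  have hα := alpha_pos T
  obtain ⟨u, hu, hmin, hinf⟩ := hP.exists_minimizer hμ hb.L_pos.le
  obtain ⟨x, hx, hd, hgap⟩ := hP.warmStart_det hb hK hK1 hu
  have hσ : ∀ k : ℕ, (0 : ℝ) < (1 / 2) ^ (k + 1) := fun k => by positivity
  have halw : ∀ (k : ℕ) (x : E), x ∈ P.X →
      (recappLoop P b ((1 / 2) ^ (k + 1)) T x).Always g (· ∈ P.X) :=
    fun k x hx => hP.recappLoop_always hb (hσ k) T hx
  refine ⟨Always.of_mem_support (hd.always_bind (always_loop halw K hx)), ?_, ?_⟩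
  · rw [hinf, expect_run_fst (h := fun x => ENNReal.ofReal (maxFun P.Y f x - maxFun P.Y f u))]
    rw [restartedRecapp, hd.ev_bind]
    have hev := ev_loop_le (O := g) (step := fun k x => recappLoop P b ((1 / 2) ^ (k + 1)) T x)
      (S := (· ∈ P.X))
      -- Weights 4^k offset the contraction by 1/4. Errors halved per epoch then contribute of order
      -- 2^k, so division by 4^K leaves a gap of order 2^(-K)μR².
      (Φ := fun k x => ENNReal.ofReal (4 ^ k) *
        ENNReal.ofReal (maxFun P.Y f x - maxFun P.Y f u))
      (e := fun k => ENNReal.ofReal (2 ^ k * (P.μ * P.R ^ 2) / 8)) halw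
      (fun k x hx => by
        rw [ev_const_mul]
        have hxu := sub_nonneg.2 (hmin x hx)
        have h1 := hP.recappLoop_ev hb (hσ k) hu hmin T hx
        have h2 := strongConvexOn_quadratic_growth hF hu hmin hx
        have h3 : P.μ / 2 * ‖x - u‖ ^ 2 ≤ P.μ / γ * (maxFun P.Y f x - maxFun P.Y f u) := by
          have h4 : P.μ / 2 * ‖x - u‖ ^ 2 = P.μ / γ * (γ / 2 * ‖x - u‖ ^ 2) := by field_simp
          rw [h4]
          exact mul_le_mul_of_nonneg_left (by linarith) (by positivity)
        calc _ ≤ ENNReal.ofReal (4 ^ (k + 1)) * _ := by gcongr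
          _ = ENNReal.ofReal (4 ^ (k + 1) * _) := (ENNReal.ofReal_mul (by positivity)).symm
          _ ≤ ENNReal.ofReal (4 ^ k * (maxFun P.Y f x - maxFun P.Y f u) +
                2 ^ k * (P.μ * P.R ^ 2) / 8) := by
              refine ENNReal.ofReal_le_ofReal ?_
              have e : (4 : ℝ) ^ (k + 1) * (1 / 2) ^ (k + 1) = 2 * 2 ^ k := by
                rw [← mul_pow, pow_succ]; norm_num; ring
              have h5 : alpha T ^ 2 * (maxFun P.Y f x - maxFun P.Y f u + P.μ / 2 * ‖x - u‖ ^ 2 +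
                  (1 / 2) ^ (k + 1) * (P.μ * P.R ^ 2) / 2) ≤
                  1 / 4 * (maxFun P.Y f x - maxFun P.Y f u) +
                    (1 / 2) ^ (k + 1) * (P.μ * P.R ^ 2) / 16 := by
                have h6 := mul_le_mul_of_nonneg_left h3 (sq_nonneg (alpha T))
                have h7 := mul_le_mul_of_nonneg_right hT hxu
                have h8 := mul_le_mul_of_nonneg_right hT'
                  (show 0 ≤ (1 / 2) ^ (k + 1) * (P.μ * P.R ^ 2) / 2 by positivity)
                linarith
              have h9 := mul_le_mul_of_nonneg_left h5 (show (0 : ℝ) ≤ 4 ^ (k + 1) by positivity)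
              refine h9.trans (le_of_eq ?_)
              rw [mul_add, mul_div_assoc', ← mul_assoc, ← mul_assoc, e, pow_succ]; ring
          _ = _ := by
              rw [ENNReal.ofReal_add (by positivity) (by positivity),
                ENNReal.ofReal_mul (by positivity)]) K hx
    rw [ev_const_mul, pow_zero, ENNReal.ofReal_one, one_mul,
      ← ENNReal.ofReal_sum_of_nonneg (fun t _ => by positivity),
      ← ENNReal.ofReal_add (sub_nonneg.2 (hmin x hx))
        (Finset.sum_nonneg fun t _ => by positivity)] at hev
    have h4 : ENNReal.ofReal (4 ^ K) ≠ 0 := by simp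
    refine (ENNReal.mul_le_mul_iff_right h4 ENNReal.ofReal_ne_top).1 (hev.trans ?_)
    rw [← ENNReal.ofReal_mul (by positivity)]
    refine ENNReal.ofReal_le_ofReal ?_
    have h5 : ∑ k ∈ Finset.range K, 2 ^ k * (P.μ * P.R ^ 2) / 8 =
        (2 ^ K - 1) * (P.μ * P.R ^ 2) / 8 := by
      rw [← Finset.sum_div, ← Finset.sum_mul, geom_sum_eq (by norm_num)]; norm_num
    rw [h5]
    have h6 : (1 : ℝ) ≤ 2 ^ K := one_le_pow₀ (by norm_num)
    have h7 : (4 : ℝ) ^ K = 2 ^ K * 2 ^ K := by rw [← mul_pow]; norm_num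
    have h8 := mul_le_mul_of_nonneg_left hε (show (0 : ℝ) ≤ 2 ^ K by positivity)
    have h9 := mul_le_mul_of_nonneg_right h6 (show 0 ≤ P.μ * P.R ^ 2 by positivity)
    have h10 : 0 ≤ P.μ * P.R ^ 2 := by positivity
    rw [h7]
    generalize (2 : ℝ) ^ K = q at *
    linarith
  · rw [expect_run_snd, restartedRecapp, hd.cost_bind]
    calc _ ≤ _ + K * (T * ENNReal.ofReal c) := by
          refine add_le_add_right ?_ _
          exact cost_loop_le K halw (fun k hk x hx =>
            hP.recappLoop_cost hb (hσ k) T hx (hcost k hk)) hx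
      _ = ENNReal.ofReal ((1 + b.agdIters (P.L * P.R ^ 2 / 2) +
            b.warmEpochs * (2 * b.warmIters) : ℕ) + K * (T * c)) := by
          rw [ENNReal.ofReal_add (by positivity) (by positivity),
            ENNReal.ofReal_mul (by positivity), ENNReal.ofReal_mul (by positivity),
            ENNReal.ofReal_natCast, ENNReal.ofReal_natCast, ENNReal.ofReal_natCast]
      _ ≤ _ := ENNReal.ofReal_le_ofReal hN

end IsMaxProblem

end Guarantees

/-! ### Iteration numbers and query counts -/

theorem one_le_logB (z : ℝ) : 1 ≤ logB z := le_max_left _ _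

theorem logB_pos (z : ℝ) : 0 < logB z := one_pos.trans_le (one_le_logB z)

theorem log_le_logB (z : ℝ) : Real.log z ≤ logB z := le_max_right _ _

theorem logB_mono {a c : ℝ} (ha : 0 < a) (h : a ≤ c) : logB a ≤ logB c :=
  max_le_max le_rfl (Real.log_le_log ha h)

theorem logB_two_pow_mul_le (k : ℕ) {z : ℝ} (hz : 0 < z) : logB (2 ^ k * z) ≤ k + logB z := by
  refine max_le ?_ ?_
  · linarith [one_le_logB z, Nat.cast_nonneg (α := ℝ) k]
  · rw [Real.log_mul (by positivity) hz.ne', Real.log_pow]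
    have h1 : Real.log 2 ≤ 1 := by linarith [Real.log_two_lt_d9]
    have h2 := mul_le_mul_of_nonneg_left h1 (Nat.cast_nonneg (α := ℝ) k)
    linarith [log_le_logB z]

theorem logB_sq_le (z : ℝ) : logB (z ^ 2) ≤ 2 * logB z := by
  refine max_le ?_ ?_
  · linarith [one_le_logB z]
  · rw [Real.log_pow]
    push_cast
    linarith [log_le_logB z]

theorem logB_le_of_le_two_pow_mul_sq (k : ℕ) {a z : ℝ} (ha : 0 < a) (hz : 0 < z)
    (h : a ≤ 2 ^ k * z ^ 2) : logB a ≤ (k + 2) * logB z := by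
  have h1 := (logB_mono ha h).trans (logB_two_pow_mul_le k (z := z ^ 2) (by positivity))
  have h2 := logB_sq_le z
  have h3 := mul_le_mul_of_nonneg_left (one_le_logB z) (Nat.cast_nonneg (α := ℝ) k)
  linarith

theorem ceil_le_two_mul {x : ℝ} (hx : 1 ≤ x) : (⌈x⌉₊ : ℝ) ≤ 2 * x := by
  linarith [Nat.ceil_lt_add_one (zero_le_one.trans hx)]

/-- Iteration numbers of the subroutines. -/
def stdBudget (L μ R' : ℝ) : Budget where
  mirrorIters := ⌈512 * (L / μ)⌉₊
  agdIters δ := ⌈√(L / μ) * logB (L * R' ^ 2 / δ)⌉₊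
  warmIters := ⌈512 * (L / μ)⌉₊
  warmEpochs := ⌈logB (L / μ)⌉₊

section Budget

variable {L μ R' : ℝ}

theorem one_le_sqrt_div (hμ : 0 < μ) (hμL : μ ≤ L) : 1 ≤ √(L / μ) :=
  Real.one_le_sqrt.2 ((one_le_div hμ).2 hμL)

theorem stdBudget_mirrorIters_le (hμ : 0 < μ) (hμL : μ ≤ L) :
    ((stdBudget L μ R').mirrorIters : ℝ) ≤ 513 * (L / μ) := by
  have h := (one_le_div hμ).2 hμL
  have := Nat.ceil_lt_add_one (show 0 ≤ 512 * (L / μ) by positivity)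
  change (⌈512 * (L / μ)⌉₊ : ℝ) ≤ _
  linarith

theorem stdBudget_agdIters_le (hμ : 0 < μ) (hμL : μ ≤ L) (δ : ℝ) :
    ((stdBudget L μ R').agdIters δ : ℝ) ≤ 2 * (√(L / μ) * logB (L * R' ^ 2 / δ)) :=
  ceil_le_two_mul (one_le_mul_of_one_le_of_one_le (one_le_sqrt_div hμ hμL) (one_le_logB _))

theorem stdBudget_warmEpochs_le : ((stdBudget L μ R').warmEpochs : ℝ) ≤ 2 * logB (L / μ) :=
  ceil_le_two_mul (one_le_logB _)

theorem one_le_stdBudget_warmEpochs : 1 ≤ (stdBudget L μ R').warmEpochs :=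
  Nat.one_le_ceil_iff.2 (logB_pos _)

theorem sq_le_pow_stdBudget_warmEpochs (hμ : 0 < μ) (hμL : μ ≤ L) :
    (L / μ) ^ 2 ≤ 256 ^ (stdBudget L μ R').warmEpochs := by
  have hL : 0 < L / μ := div_pos (hμ.trans_le hμL) hμ
  have h1 : L / μ ≤ Real.exp ((stdBudget L μ R').warmEpochs) := by
    rw [← Real.log_le_iff_le_exp hL]
    exact (log_le_logB _).trans (Nat.le_ceil _)
  have h2 : Real.exp ((stdBudget L μ R').warmEpochs) ≤ 16 ^ (stdBudget L μ R').warmEpochs := by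
    rw [← Real.exp_one_pow]
    exact pow_le_pow_left₀ (Real.exp_pos _).le (by linarith [Real.exp_one_lt_d9]) _
  calc (L / μ) ^ 2 ≤ (16 ^ (stdBudget L μ R').warmEpochs) ^ 2 :=
        pow_le_pow_left₀ hL.le (h1.trans h2) 2
    _ = _ := by rw [← pow_mul, mul_comm, pow_mul]; norm_num

/-- The inequality 1 - θ ≤ exp(-θ) with θ = √(μ/L) turns the step count into a factor at most
δ/(LR'²). -/
theorem stdBudget_agd (hμ : 0 < μ) (hμL : μ ≤ L) (hR' : 0 < R') {δ : ℝ} (hδ : 0 < δ) :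
    (1 - √(μ / L)) ^ (stdBudget L μ R').agdIters δ * (L * R' ^ 2 / 2) ≤ δ := by
  have hL := hμ.trans_le hμL
  set N := (stdBudget L μ R').agdIters δ with hN
  have hN1 : √(L / μ) * logB (L * R' ^ 2 / δ) ≤ N := Nat.le_ceil _
  have h0 : 0 ≤ 1 - √(μ / L) := sub_nonneg.2 (Real.sqrt_le_one.2 ((div_le_one hL).2 hμL))
  have h1 : (1 - √(μ / L)) ^ N ≤ Real.exp (-logB (L * R' ^ 2 / δ)) := by
    calc (1 - √(μ / L)) ^ N ≤ Real.exp (-√(μ / L)) ^ N :=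
          pow_le_pow_left₀ h0 (Real.one_sub_le_exp_neg _) N
      _ = Real.exp (-(√(μ / L) * N)) := by rw [← Real.exp_nat_mul]; congr 1; ring
      _ ≤ _ := by
          rw [Real.exp_le_exp, neg_le_neg_iff]
          have h2 := mul_le_mul_of_nonneg_left hN1 (Real.sqrt_nonneg (μ / L))
          have h3 : √(μ / L) * √(L / μ) = 1 := by
            rw [← Real.sqrt_mul (div_pos hμ hL).le, div_mul_div_comm, mul_comm μ L,
              div_self (by positivity), Real.sqrt_one]
          rwa [← mul_assoc, h3, one_mul] at h2
  have hz : 0 < L * R' ^ 2 / δ := by positivity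
  have h2 : Real.exp (-logB (L * R' ^ 2 / δ)) ≤ (L * R' ^ 2 / δ)⁻¹ := by
    rw [Real.exp_neg]
    refine inv_anti₀ hz ?_
    rw [← Real.log_le_iff_le_exp hz]
    exact log_le_logB _
  calc _ ≤ (L * R' ^ 2 / δ)⁻¹ * (L * R' ^ 2 / 2) :=
        mul_le_mul_of_nonneg_right (h1.trans h2) (by positivity)
    _ = δ / 2 := by field_simp
    _ ≤ δ := by linarith

theorem stdBudget_isSufficient {E F : Type} {P : Input E F} (hμ : 0 < P.μ) (hμL : P.μ ≤ P.L)
    (hR : 0 < P.R) (hR' : 0 < R') : IsSufficient P R' (stdBudget P.L P.μ R') where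
  mu_pos := hμ
  mu_le := hμL
  R_pos := hR
  mirror := by
    have h : 512 * (P.L / P.μ) ≤ (⌈512 * (P.L / P.μ)⌉₊ : ℝ) := Nat.le_ceil _
    change 512 * P.L ≤ (⌈512 * (P.L / P.μ)⌉₊ : ℝ) * P.μ
    rwa [← div_le_iff₀ hμ, mul_div_assoc]
  warm := by
    have h : 512 * (P.L / P.μ) ≤ (⌈512 * (P.L / P.μ)⌉₊ : ℝ) := Nat.le_ceil _
    change 512 * P.L ≤ (⌈512 * (P.L / P.μ)⌉₊ : ℝ) * P.μ
    rwa [← div_le_iff₀ hμ, mul_div_assoc]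
  agd _ hδ := stdBudget_agd hμ hμL hR' hδ

theorem proxQueries_stdBudget_le (hμ : 0 < μ) (hμL : μ ≤ L) {δ ℓ : ℝ}
    (hℓ : logB (L * R' ^ 2 / δ) ≤ ℓ) :
    (proxQueries (stdBudget L μ R') δ : ℝ) ≤ 1027 * (L / μ) + 2 * (√(L / μ) * ℓ) := by
  have h := (one_le_div hμ).2 hμL
  have h1 := stdBudget_mirrorIters_le (R' := R') hμ hμL
  have h2 := stdBudget_agdIters_le (R' := R') hμ hμL δ
  have h3 := mul_le_mul_of_nonneg_left hℓ (Real.sqrt_nonneg (L / μ))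
  rw [proxQueries]
  push_cast
  linarith

theorem level_weight_le (n : ℕ) : ((n : ℝ) + 2) * (n + 7) ≤ 14 * (7 / 4) ^ n := by
  induction n with
  | zero => norm_num
  | succ n ih =>
    rw [pow_succ]
    push_cast
    nlinarith [Nat.cast_nonneg (α := ℝ) n]

/-- Level j costs at most (2j + 4)W, so a draw n costs (n + 2)(n + 7)W. Bounding this by 14(7/4)^n W
leaves a geometric series of ratio 7/8; the total is 1 + 4 + 56 = 61. -/
theorem stepQueries_stdBudget_le (hμ : 0 < μ) (hμL : μ ≤ L) (hR' : 0 < R') {δ ℓ : ℝ} (hδ : 0 < δ)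
    (hℓ : logB (L * R' ^ 2 / δ) ≤ ℓ) :
    stepQueries (stdBudget L μ R') δ ≤
      ENNReal.ofReal (61 * (1027 * (L / μ) + 2 * (√(L / μ) * ℓ))) := by
  have hL := hμ.trans_le hμL
  have hz : 0 < L * R' ^ 2 / δ := by positivity
  have hℓ1 : 1 ≤ ℓ := (one_le_logB _).trans hℓ
  set W := 1027 * (L / μ) + 2 * (√(L / μ) * ℓ) with hW
  have hW0 : 0 ≤ W := by positivity
  have hq : ∀ j : ℕ, (proxQueries (stdBudget L μ R') (δ / 8 / 4 ^ j) : ℝ) ≤ (2 * j + 4) * W := by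
    intro j
    have e : L * R' ^ 2 / (δ / 8 / 4 ^ j) = 2 ^ (3 + 2 * j) * (L * R' ^ 2 / δ) := by
      rw [pow_add, pow_mul]; norm_num; field_simp
    have h1 : logB (L * R' ^ 2 / (δ / 8 / 4 ^ j)) ≤ (2 * j + 4) * ℓ := by
      rw [e]
      refine (logB_two_pow_mul_le _ hz).trans ?_
      push_cast
      have := mul_le_mul_of_nonneg_left hℓ1 (show (0 : ℝ) ≤ 3 + 2 * j by positivity)
      linarith
    refine (proxQueries_stdBudget_le hμ hμL h1).trans ?_
    have h2 : 0 ≤ 1027 * (L / μ) * (2 * j + 3) := by positivity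
    rw [hW]
    linarith
  have hq0 : (proxQueries (stdBudget L μ R') (δ / 8) : ℝ) ≤ 4 * W := by simpa using hq 0
  have hδq : (proxQueries (stdBudget L μ R') δ : ℝ) ≤ W := proxQueries_stdBudget_le hμ hμL hℓ
  have hsum : ∀ n : ℕ, ((∑ j ∈ Finset.range (n + 2),
      proxQueries (stdBudget L μ R') (δ / 8 / 4 ^ (j + 1)) : ℕ) : ℝ) ≤ W * (14 * (7 / 4) ^ n) := by
    intro n
    have e : ∀ m : ℕ, ∑ j ∈ Finset.range m, (2 * ((j + 1 : ℕ) : ℝ) + 4) * W =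
        (m * (m + 5)) * W := by
      intro m
      induction m with
      | zero => simp
      | succ m ih => rw [Finset.sum_range_succ, ih]; push_cast; ring
    push_cast
    refine (Finset.sum_le_sum fun j _ => hq (j + 1)).trans ?_
    rw [e, mul_comm]
    refine mul_le_mul_of_nonneg_left (le_trans (le_of_eq ?_) (level_weight_le n)) hW0
    push_cast
    ring
  have hgeo : HasSum (fun n : ℕ => (1 / 2 : ℝ) ^ (n + 1) * (W * (14 * (7 / 4) ^ n))) (56 * W) := by
    have h := (hasSum_geometric_of_lt_one (r := (7 / 8 : ℝ)) (by norm_num) (by norm_num)).mul_left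
      (7 * W)
    have e : 7 * W * (1 - 7 / 8)⁻¹ = 56 * W := by norm_num; ring
    rw [e] at h
    refine (congrArg (fun w : ℕ → ℝ => HasSum w (56 * W)) ?_).mpr h
    funext n
    have e2 : (7 / 8 : ℝ) ^ n = (1 / 2) ^ n * (7 / 4) ^ n := by rw [← mul_pow]; norm_num
    rw [e2, pow_succ]; ring
  have hcast : ∀ (n : ℕ) (c : ℝ), (n : ℝ) ≤ c → (n : ℝ≥0∞) ≤ ENNReal.ofReal c := fun n c h => by
    rw [← ENNReal.ofReal_natCast]; exact ENNReal.ofReal_le_ofReal h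
  calc stepQueries (stdBudget L μ R') δ
      ≤ ENNReal.ofReal W + (ENNReal.ofReal (4 * W) + ∑' n, geomHalf n *
          ENNReal.ofReal (W * (14 * (7 / 4) ^ n))) := by
        refine add_le_add (hcast _ _ hδq) (add_le_add (hcast _ _ hq0) ?_)
        exact ENNReal.tsum_le_tsum fun n => mul_le_mul_right (hcast _ _ (hsum n)) _
    _ = ENNReal.ofReal (61 * W) := by
        rw [tsum_geomHalf_mul_ofReal (fun n => by positivity) hgeo,
          ← ENNReal.ofReal_add (by positivity) (by positivity),
          ← ENNReal.ofReal_add (by positivity) (by positivity)]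
        congr 1; ring

theorem logB_div_loopError_le {E F : Type} {P : Input E F} (hμ : 0 < P.μ) (hL : 0 < P.L)
    (hR : 0 < P.R) (hR' : 0 < R') {σ : ℝ} (hσ : 0 < σ) {t T : ℕ} (ht : t < T) :
    0 < loopError P σ t ∧ logB (P.L * R' ^ 2 / loopError P σ t) ≤
      logB (4 * (P.L / P.μ) * (R' / P.R) ^ 2 * ((T : ℝ) + 1) ^ 4 / σ) := by
  have hα := alpha_pos (t + 1)
  have h0 : 0 < loopError P σ t := by rw [loopError]; positivity
  refine ⟨h0, logB_mono (by positivity) ?_⟩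
  have htT : (t : ℝ) + 1 ≤ T := by exact_mod_cast ht
  have h1 : 1 / ((T : ℝ) + 1) ≤ alpha (t + 1) := by
    refine le_trans ?_ (le_alpha (t + 1))
    push_cast
    exact one_div_le_one_div_of_le (by positivity) (by linarith)
  have h2 : σ * (P.μ * P.R ^ 2) / (4 * ((T : ℝ) + 1) ^ 4) ≤ loopError P σ t := by
    rw [loopError]
    push_cast
    calc σ * (P.μ * P.R ^ 2) / (4 * ((T : ℝ) + 1) ^ 4)
        = σ * ((1 / ((T : ℝ) + 1)) ^ 2 * P.μ * P.R ^ 2 / (4 * ((T : ℝ) + 1) ^ 2)) := by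
          field_simp
      _ ≤ _ := by gcongr
  calc P.L * R' ^ 2 / loopError P σ t
      ≤ P.L * R' ^ 2 / (σ * (P.μ * P.R ^ 2) / (4 * ((T : ℝ) + 1) ^ 4)) := by gcongr
    _ = _ := by field_simp

theorem warm_queries_le {R : ℝ} (hμ : 0 < μ) (hμL : μ ≤ L) (hR : 0 < R) (hR' : 0 < R') :
    ((1 + (stdBudget L μ R').agdIters (L * R ^ 2 / 2) +
      (stdBudget L μ R').warmEpochs * (2 * (stdBudget L μ R').warmIters) : ℕ) : ℝ) ≤
      2053 * (L / μ * logB (L / μ)) + 6 * (√(L / μ) * logB (R' / R)) := by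
  have hL := hμ.trans_le hμL
  have h := (one_le_div hμ).2 hμL
  have h1 := stdBudget_agdIters_le (R' := R') hμ hμL (L * R ^ 2 / 2)
  have h2 : logB (L * R' ^ 2 / (L * R ^ 2 / 2)) ≤ 3 * logB (R' / R) := by
    have e : L * R' ^ 2 / (L * R ^ 2 / 2) = 2 ^ 1 * (R' / R) ^ 2 := by field_simp
    have := logB_le_of_le_two_pow_mul_sq 1 (z := R' / R)
      (show 0 < L * R' ^ 2 / (L * R ^ 2 / 2) by positivity) (by positivity) e.le
    norm_num at this
    exact this
  have h3 := mul_le_mul_of_nonneg_left h2 (Real.sqrt_nonneg (L / μ))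
  have h4 : ((stdBudget L μ R').warmEpochs : ℝ) * (stdBudget L μ R').warmIters ≤
      2 * logB (L / μ) * (513 * (L / μ)) :=
    mul_le_mul stdBudget_warmEpochs_le (stdBudget_mirrorIters_le (R' := R') hμ hμL)
      (Nat.cast_nonneg _) (by linarith [logB_pos (L / μ)])
  have h5 : 1 ≤ L / μ * logB (L / μ) := one_le_mul_of_one_le_of_one_le h (one_le_logB _)
  push_cast
  linarith

end Budget

/-! ### Conversion of iteration counts into the stated rates. -/

section Rates

variable {L μ R R' ε γ : ℝ}

theorem sqrt_div_mul_div (hμ : 0 < μ) (hε : 0 < ε) : √(μ / ε) * (L / μ) = L / √(μ * ε) := by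
  have h1 : √(μ / ε) * √(μ * ε) = μ := by
    rw [← Real.sqrt_mul (div_pos hμ hε).le, div_mul_eq_mul_div, mul_left_comm, mul_div_assoc,
      mul_div_cancel_right₀ _ hε.ne', Real.sqrt_mul_self hμ.le]
  have h2 : √(μ * ε) ≠ 0 := (Real.sqrt_pos.2 (by positivity)).ne'
  rw [eq_div_iff h2, mul_right_comm, h1]
  field_simp

theorem sqrt_div_mul_sqrt_div (hμ : 0 < μ) (hε : 0 < ε) : √(μ / ε) * √(L / μ) = √(L / ε) := by
  rw [← Real.sqrt_mul (div_pos hμ hε).le]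
  congr 1; field_simp

/-- The T⁴ from the smallest additive error cancels the denominators μ and R², leaving a constant
times the square of the target argument. The case T = 0 is excluded so that T + 1 ≤ 2T. -/
theorem additive_logB_le (hμ : 0 < μ) (hμL : μ ≤ L) (hR : 0 < R) (hR' : 0 < R') (hε : 0 < ε)
    {T : ℕ} (hT : 1 ≤ T) (hT' : (T : ℝ) ≤ 7 * (R * √(μ / ε))) :
    logB (4 * (L / μ) * (R' / R) ^ 2 * ((T : ℝ) + 1) ^ 4 / 1) ≤
      20 * logB (L * (R + R') ^ 2 / ε) := by
  have hL := hμ.trans_le hμL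
  have hT1 : (1 : ℝ) ≤ T := by exact_mod_cast hT
  have h1 : ((T : ℝ) + 1) ^ 4 ≤ 38416 * (R ^ 4 * (μ / ε) ^ 2) := by
    calc ((T : ℝ) + 1) ^ 4 ≤ (14 * (R * √(μ / ε))) ^ 4 :=
          pow_le_pow_left₀ (by positivity) (by linarith) 4
      _ = 38416 * (R ^ 4 * (√(μ / ε) ^ 2) ^ 2) := by ring
      _ = _ := by rw [Real.sq_sqrt (div_pos hμ hε).le]
  have h := logB_le_of_le_two_pow_mul_sq 18 (z := L * (R + R') ^ 2 / ε)
    (show 0 < 4 * (L / μ) * (R' / R) ^ 2 * ((T : ℝ) + 1) ^ 4 / 1 by positivity) (by positivity) ?_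
  · norm_num at h ⊢
    exact h
  calc 4 * (L / μ) * (R' / R) ^ 2 * ((T : ℝ) + 1) ^ 4 / 1
      ≤ 4 * (L / μ) * (R' / R) ^ 2 * (38416 * (R ^ 4 * (μ / ε) ^ 2)) / 1 := by gcongr
    _ = 153664 * ((L * μ) * (R' ^ 2 * R ^ 2)) / ε ^ 2 := by field_simp; norm_num
    _ ≤ 2 ^ 18 * ((L * L) * ((R + R') ^ 2 * (R + R') ^ 2)) / ε ^ 2 := by
        gcongr
        · norm_num
        · linarith
        · linarith
    _ = _ := by rw [div_pow, mul_pow]; ring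

theorem restarted_logB_le (hμ : 0 < μ) (hμL : μ ≤ L) (hR : 0 < R) (hR' : 0 < R') (hε : 0 < ε)
    (hγ : 0 < γ) (hγμ : γ ≤ μ) {T K : ℕ} (hT : (T : ℝ) ≤ 7 * √(μ / γ))
    (hK1 : 1 < 12 * (μ * R ^ 2) / ε) (hK : (2 : ℝ) ^ K ≤ 2 * (12 * (μ * R ^ 2) / ε)) {k : ℕ}
    (hk : k < K) :
    logB (4 * (L / μ) * (R' / R) ^ 2 * ((T : ℝ) + 1) ^ 4 / (1 / 2) ^ (k + 1)) ≤
      25 * logB (μ * L * (R + R') ^ 2 / (γ * ε)) := by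
  have hL := hμ.trans_le hμL
  have hs : 1 ≤ √(μ / γ) := one_le_sqrt_div hγ hγμ
  have h1 : ((T : ℝ) + 1) ^ 4 ≤ 4096 * (μ / γ) ^ 2 := by
    calc ((T : ℝ) + 1) ^ 4 ≤ (8 * √(μ / γ)) ^ 4 :=
          pow_le_pow_left₀ (by positivity) (by linarith) 4
      _ = 4096 * (√(μ / γ) ^ 2) ^ 2 := by ring
      _ = _ := by rw [Real.sq_sqrt (div_pos hμ hγ).le]
  have h2 : (1 : ℝ) / (1 / 2) ^ (k + 1) ≤ 2 * (12 * (μ * R ^ 2) / ε) := by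
    refine le_trans ?_ hK
    rw [one_div, ← inv_pow]
    norm_num
    exact pow_le_pow_right₀ (by norm_num) hk
  have h := logB_le_of_le_two_pow_mul_sq 23 (z := μ * L * (R + R') ^ 2 / (γ * ε))
    (show 0 < 4 * (L / μ) * (R' / R) ^ 2 * ((T : ℝ) + 1) ^ 4 / (1 / 2) ^ (k + 1) by positivity)
    (by positivity) ?_
  · norm_num at h ⊢
    exact h
  -- An extra factor at least 1 completes the square of the target argument; it is available only
  -- when a restart takes place.
  have h3 : 1 ≤ 12 * (L * R ^ 2) / ε := by
    refine hK1.le.trans ?_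
    gcongr
  calc 4 * (L / μ) * (R' / R) ^ 2 * ((T : ℝ) + 1) ^ 4 / (1 / 2) ^ (k + 1)
      = 4 * (L / μ) * (R' / R) ^ 2 * ((T : ℝ) + 1) ^ 4 * (1 / (1 / 2) ^ (k + 1)) := by
        rw [mul_one_div]
    _ ≤ 4 * (L / μ) * (R' / R) ^ 2 * (4096 * (μ / γ) ^ 2) * (2 * (12 * (μ * R ^ 2) / ε)) := by
        gcongr
    _ = 393216 * (L * R' ^ 2 * μ ^ 2 / (γ ^ 2 * ε)) * 1 := by field_simp; norm_num
    _ ≤ 393216 * (L * R' ^ 2 * μ ^ 2 / (γ ^ 2 * ε)) * (12 * (L * R ^ 2) / ε) := by gcongr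
    _ = 4718592 * (μ ^ 2 * L ^ 2 * (R' ^ 2 * R ^ 2)) / (γ ^ 2 * ε ^ 2) := by field_simp; norm_num
    _ ≤ 2 ^ 23 * (μ ^ 2 * L ^ 2 * ((R + R') ^ 2 * (R + R') ^ 2)) / (γ ^ 2 * ε ^ 2) := by
        gcongr
        · norm_num
        · linarith
        · linarith
    _ = _ := by rw [div_pow, mul_pow, mul_pow]; ring

theorem restarts_spec (hε : 0 < ε) (hμ : 0 < μ) (hμL : μ ≤ L) (hR : 0 < R) :
    12 * (μ * R ^ 2) ≤ 2 ^ ⌈Real.logb 2 (12 * (μ * R ^ 2) / ε)⌉₊ * ε ∧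
    (⌈Real.logb 2 (12 * (μ * R ^ 2) / ε)⌉₊ : ℝ) ≤ 11 * logB (L * R ^ 2 / ε) ∧
    (0 < ⌈Real.logb 2 (12 * (μ * R ^ 2) / ε)⌉₊ → 1 < 12 * (μ * R ^ 2) / ε ∧
      (2 : ℝ) ^ ⌈Real.logb 2 (12 * (μ * R ^ 2) / ε)⌉₊ ≤ 2 * (12 * (μ * R ^ 2) / ε)) := by
  have hL := hμ.trans_le hμL
  set q := 12 * (μ * R ^ 2) / ε with hq
  have hq0 : 0 < q := by positivity
  set K := ⌈Real.logb 2 q⌉₊ with hK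
  have h2 : (1 : ℝ) < 2 := one_lt_two
  refine ⟨?_, ?_, fun h => ?_⟩
  · rw [← div_le_iff₀ hε, ← hq]
    have := (Real.logb_le_iff_le_rpow h2 hq0).1 (Nat.le_ceil (Real.logb 2 q))
    rwa [Real.rpow_natCast] at this
  · rcases le_or_gt q 1 with h1 | h1
    · have : K = 0 := Nat.ceil_eq_zero.2 (Real.logb_nonpos h2 hq0.le h1)
      rw [this, Nat.cast_zero]
      exact mul_nonneg (by norm_num) (logB_pos _).le
    · have h3 := Nat.ceil_lt_add_one (Real.logb_nonneg h2 h1.le)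
      have h4 : Real.logb 2 q ≤ 2 * Real.log q := by
        rw [Real.logb, div_le_iff₀ (Real.log_pos h2)]
        have := mul_le_mul_of_nonneg_left
          (show (1 / 2 : ℝ) ≤ Real.log 2 by linarith [Real.log_two_gt_d9]) (Real.log_pos h1).le
        linarith
      have h5 : Real.log q ≤ 4 + logB (L * R ^ 2 / ε) := by
        have h6 := (log_le_logB q).trans (logB_mono (c := 2 ^ 4 * (L * R ^ 2 / ε)) hq0 (by
          rw [hq, ← mul_div_assoc]
          gcongr
          norm_num))
        exact h6.trans (by simpa using logB_two_pow_mul_le 4 (show 0 < L * R ^ 2 / ε by positivity))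
      linarith [one_le_logB (L * R ^ 2 / ε)]
  · have h3 : 0 < Real.logb 2 q := Nat.ceil_pos.1 h
    have h1 : 1 < q := (Real.logb_pos_iff h2 hq0).1 h3
    refine ⟨h1, ?_⟩
    have h4 := (Nat.ceil_lt_add_one h3.le).le
    rw [← Real.rpow_natCast]
    calc (2 : ℝ) ^ (K : ℝ) ≤ 2 ^ (Real.logb 2 q + 1) := Real.rpow_le_rpow_of_exponent_le h2.le h4
      _ = 2 * q := by
        rw [Real.rpow_add two_pos, Real.rpow_logb two_pos h2.ne' hq0, Real.rpow_one, mul_comm]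

theorem alpha_sq_mul_le {B ε : ℝ} {T : ℕ} (h : 4 * B ≤ ((T : ℝ) + 2) ^ 2 * ε) (hB : 0 ≤ B) :
    alpha T ^ 2 * B ≤ ε := by
  have h1 := pow_le_pow_left₀ (alpha_pos T).le (alpha_le T) 2
  refine (mul_le_mul_of_nonneg_right h1 hB).trans ?_
  rw [div_pow, div_mul_eq_mul_div, div_le_iff₀ (by positivity)]
  linarith

end Rates

/-! ### Choice of T and K. -/

section Main

variable {E F : Type}
variable [NormedAddCommGroup E] [InnerProductSpace ℝ E] [ProperSpace E]
variable [NormedAddCommGroup F] [InnerProductSpace ℝ F] [ProperSpace F]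
variable {P : Input E F} {R' : ℝ} {f : E → F → ℝ} {g : E × F → E × F}

theorem recapp_solves (hP : IsMaxProblem P R' f g) (hμ : 0 < P.μ) (hμL : P.μ ≤ P.L)
    (hR : 0 < P.R) (hR' : 0 < R') {ε : ℝ} (hε : 0 < ε) :
    Solves P f g (recapp P (stdBudget P.L P.μ R') ⌊7 * (P.R * √(P.μ / ε))⌋₊) ε
      (10 ^ 7 * (P.L * P.R / √(P.μ * ε) + P.L / P.μ * logB (P.L / P.μ) +
        √(P.L / P.μ) * logB (R' / P.R) +
        P.R * √(P.L / ε) * logB (P.L * (P.R + R') ^ 2 / ε))) := by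
  have hL := hμ.trans_le hμL
  -- Rounding down keeps T proportional to R√(μ/ε) even when this is small; then T may be 0 and the
  -- warm start alone suffices. The 7 works because 49 ≥ 4·12.
  set T := ⌊7 * (P.R * √(P.μ / ε))⌋₊ with hT
  set ℓ := logB (P.L * (P.R + R') ^ 2 / ε) with hℓ
  have hℓ0 : 0 < ℓ := logB_pos _
  have hT1 : (T : ℝ) ≤ 7 * (P.R * √(P.μ / ε)) := Nat.floor_le (by positivity)
  have hT2 : 7 * (P.R * √(P.μ / ε)) < T + 1 := Nat.lt_floor_add_one _
  refine hP.recapp_spec (stdBudget_isSufficient hμ hμL hR hR')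
    (sq_le_pow_stdBudget_warmEpochs hμ hμL) one_le_stdBudget_warmEpochs T (alpha_sq_mul_le ?_ ?_)
    (c := 61 * (1027 * (P.L / P.μ) + 2 * (√(P.L / P.μ) * (20 * ℓ)))) (by positivity)
    (fun t ht => ?_) ?_
  · have h1 : (7 * (P.R * √(P.μ / ε))) ^ 2 ≤ ((T : ℝ) + 2) ^ 2 :=
      pow_le_pow_left₀ (by positivity) (by linarith) 2
    have h2 := mul_le_mul_of_nonneg_right h1 hε.le
    have e : (7 * (P.R * √(P.μ / ε))) ^ 2 * ε = 49 * (P.μ * P.R ^ 2) := by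
      rw [mul_pow, mul_pow, Real.sq_sqrt (div_pos hμ hε).le]; field_simp; norm_num
    have : 0 ≤ P.μ * P.R ^ 2 := by positivity
    linarith
  · positivity
  · obtain ⟨h0, h1⟩ := logB_div_loopError_le (P := P) hμ hL hR hR' one_pos ht
    exact stepQueries_stdBudget_le hμ hμL hR' h0
      (h1.trans (additive_logB_le hμ hμL hR hR' hε (by omega) hT1))
  · have h1 := warm_queries_le hμ hμL hR hR'
    have h2 := mul_le_mul_of_nonneg_right hT1
      (show 0 ≤ 61 * (1027 * (P.L / P.μ) + 2 * (√(P.L / P.μ) * (20 * ℓ))) by positivity)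
    have e1 : 7 * (P.R * √(P.μ / ε)) * (61 * (1027 * (P.L / P.μ) + 2 * (√(P.L / P.μ) * (20 * ℓ)))) =
        438529 * (P.L * P.R / √(P.μ * ε)) + 17080 * (P.R * √(P.L / ε) * ℓ) := by
      rw [← sqrt_div_mul_sqrt_div (L := P.L) hμ hε, mul_comm P.L P.R, mul_div_assoc, ← sqrt_div_mul_div (L := P.L) hμ hε]
      ring
    rw [e1] at h2
    have n1 : 0 ≤ P.L * P.R / √(P.μ * ε) := by positivity
    have n2 : 0 ≤ P.R * √(P.L / ε) * ℓ := by positivity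
    have n3 : 0 ≤ P.L / P.μ * logB (P.L / P.μ) := by have := logB_pos (P.L / P.μ); positivity
    have n4 : 0 ≤ √(P.L / P.μ) * logB (R' / P.R) := by have := logB_pos (R' / P.R); positivity
    linarith

theorem restartedRecapp_solves (hP : IsMaxProblem P R' f g) (hμ : 0 < P.μ) (hμL : P.μ ≤ P.L)
    (hR : 0 < P.R) (hR' : 0 < R') {γ ε : ℝ} (hγ : 0 < γ) (hγμ : γ ≤ P.μ) (hε : 0 < ε)
    (hF : StrongConvexOn P.X γ (maxFun P.Y f)) :
    Solves P f g (restartedRecapp P (stdBudget P.L P.μ R') ⌈6 * √(P.μ / γ)⌉₊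
        ⌈Real.logb 2 (12 * (P.μ * P.R ^ 2) / ε)⌉₊) ε
      (10 ^ 7 * (P.L / √(P.μ * γ) * logB (P.L * P.R ^ 2 / ε) + P.L / P.μ * logB (P.L / P.μ) +
        √(P.L / P.μ) * logB (R' / P.R) +
        √(P.L / γ) * logB (P.μ * P.L * (P.R + R') ^ 2 / (γ * ε)) *
          logB (P.L * P.R ^ 2 / ε))) := by
  have hL := hμ.trans_le hμL
  obtain ⟨hK1, hK2, hK3⟩ := restarts_spec hε hμ hμL hR
  -- With 6 one has (T + 2)² ≥ 36μ/γ, which covers both the 32μ/γ needed for contraction by 1/4 and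
  -- the 32 needed for α_T² ≤ 1/8.
  set T := ⌈6 * √(P.μ / γ)⌉₊ with hT
  set K := ⌈Real.logb 2 (12 * (P.μ * P.R ^ 2) / ε)⌉₊
  set ℓ := logB (P.μ * P.L * (P.R + R') ^ 2 / (γ * ε)) with hℓ
  set ℓ' := logB (P.L * P.R ^ 2 / ε)
  have hℓ0 : 0 < ℓ := logB_pos _
  have hℓ'0 : 0 < ℓ' := logB_pos _
  have hs : 1 ≤ √(P.μ / γ) := one_le_sqrt_div hγ hγμ
  have hs2 : √(P.μ / γ) ^ 2 = P.μ / γ := Real.sq_sqrt (div_pos hμ hγ).le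
  have hr : 1 ≤ P.μ / γ := (one_le_div hγ).2 hγμ
  have hT1 : (T : ℝ) ≤ 7 * √(P.μ / γ) := by
    linarith [Nat.ceil_lt_add_one (show 0 ≤ 6 * √(P.μ / γ) by positivity)]
  have hT2 : 6 * √(P.μ / γ) ≤ T := Nat.le_ceil _
  have hT3 : 36 * (P.μ / γ) ≤ ((T : ℝ) + 2) ^ 2 := by
    have := pow_le_pow_left₀ (by positivity) (hT2.trans (show (T : ℝ) ≤ T + 2 by linarith)) 2
    rw [mul_pow, hs2] at this
    linarith
  refine hP.restartedRecapp_spec (stdBudget_isSufficient hμ hμL hR hR')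
    (sq_le_pow_stdBudget_warmEpochs hμ hμL) one_le_stdBudget_warmEpochs hγ hF T K
    (alpha_sq_mul_le (by linarith) (by positivity)) ?_ hK1
    (c := 61 * (1027 * (P.L / P.μ) + 2 * (√(P.L / P.μ) * (25 * ℓ)))) (by positivity)
    (fun k hk t ht => ?_) ?_
  · rw [← mul_one (alpha T ^ 2)]
    exact alpha_sq_mul_le (by linarith) (by positivity)
  · obtain ⟨h0, h1⟩ := logB_div_loopError_le (P := P) hμ hL hR hR'
      (show (0 : ℝ) < (1 / 2) ^ (k + 1) by positivity) ht
    obtain ⟨hq, hq2⟩ := hK3 (by omega)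
    exact stepQueries_stdBudget_le hμ hμL hR' h0
      (h1.trans (restarted_logB_le hμ hμL hR hR' hε hγ hγμ hT1 hq hq2 hk))
  · have h1 := warm_queries_le hμ hμL hR hR'
    have h2 : (K : ℝ) * (T * (61 * (1027 * (P.L / P.μ) + 2 * (√(P.L / P.μ) * (25 * ℓ))))) ≤
        11 * ℓ' * (7 * √(P.μ / γ) * (61 * (1027 * (P.L / P.μ) +
          2 * (√(P.L / P.μ) * (25 * ℓ))))) := by gcongr
    have e1 : 11 * ℓ' * (7 * √(P.μ / γ) * (61 * (1027 * (P.L / P.μ) +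
          2 * (√(P.L / P.μ) * (25 * ℓ))))) =
        4823819 * (P.L / √(P.μ * γ) * ℓ') + 234850 * (√(P.L / γ) * ℓ * ℓ') := by
      rw [← sqrt_div_mul_sqrt_div (L := P.L) hμ hγ, ← sqrt_div_mul_div (L := P.L) hμ hγ]
      ring
    rw [e1] at h2
    have n1 : 0 ≤ P.L / √(P.μ * γ) * ℓ' := by positivity
    have n2 : 0 ≤ √(P.L / γ) * ℓ * ℓ' := by positivity
    have n3 : 0 ≤ P.L / P.μ * logB (P.L / P.μ) := by have := logB_pos (P.L / P.μ); positivity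
    have n4 : 0 ≤ √(P.L / P.μ) * logB (R' / P.R) := by have := logB_pos (R' / P.R); positivity
    linarith

end Main

end Recapp

end

theorem mainTheorem3 :
    ∃ C : ℝ, 0 < C ∧ ∀ L μ R R' : ℝ, 0 < μ → μ ≤ L → 0 < R → 0 < R' →
      ∃ b : Budget,
        ((b.mirrorIters : ℝ) ≤ C * (L / μ)) ∧
        (∀ δ : ℝ, 0 < δ → (b.agdIters δ : ℝ) ≤ C * (√(L / μ) * logB (L * R' ^ 2 / δ))) ∧
        ((b.warmIters : ℝ) ≤ C * (L / μ)) ∧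
        ((b.warmEpochs : ℝ) ≤ C * logB (L / μ)) ∧
        (∀ ε : ℝ, 0 < ε → ∃ T : ℕ, (T : ℝ) ≤ C * (R * √(μ / ε)) ∧
          ∀ (n m : ℕ) (P : Input (EuclideanSpace ℝ (Fin n)) (EuclideanSpace ℝ (Fin m)))
            (f : EuclideanSpace ℝ (Fin n) → EuclideanSpace ℝ (Fin m) → ℝ)
            (g : EuclideanSpace ℝ (Fin n) × EuclideanSpace ℝ (Fin m) →
              EuclideanSpace ℝ (Fin n) × EuclideanSpace ℝ (Fin m)),
            P.L = L → P.μ = μ → P.R = R → IsMaxProblem P R' f g →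
            Solves P f g (recapp P b T) ε
              (C * (L * R / √(μ * ε) + L / μ * logB (L / μ) + √(L / μ) * logB (R' / R) +
                R * √(L / ε) * logB (L * (R + R') ^ 2 / ε)))) ∧
        (∀ γ ε : ℝ, 0 < γ → γ ≤ μ → 0 < ε → ∃ T K : ℕ,
          (T : ℝ) ≤ C * √(μ / γ) ∧ (K : ℝ) ≤ C * logB (L * R ^ 2 / ε) ∧
          ∀ (n m : ℕ) (P : Input (EuclideanSpace ℝ (Fin n)) (EuclideanSpace ℝ (Fin m)))
            (f : EuclideanSpace ℝ (Fin n) → EuclideanSpace ℝ (Fin m) → ℝ)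
            (g : EuclideanSpace ℝ (Fin n) × EuclideanSpace ℝ (Fin m) →
              EuclideanSpace ℝ (Fin n) × EuclideanSpace ℝ (Fin m)),
            P.L = L → P.μ = μ → P.R = R → IsMaxProblem P R' f g →
            StrongConvexOn P.X γ (maxFun P.Y f) →
            Solves P f g (restartedRecapp P b T K) ε
              (C * (L / √(μ * γ) * logB (L * R ^ 2 / ε) + L / μ * logB (L / μ) +
                √(L / μ) * logB (R' / R) +
                √(L / γ) * logB (μ * L * (R + R') ^ 2 / (γ * ε)) *
                  logB (L * R ^ 2 / ε)))) := by
  -- The largest coefficient to dominate is 4823819 = 11·7·61·1027, from the mirror-prox queries of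
  -- the restarted method.
  refine ⟨10 ^ 7, by norm_num, fun L μ R R' hμ hμL hR hR' => ⟨stdBudget L μ R', ?_, ?_, ?_, ?_,
    fun ε hε => ?_, fun γ ε hγ hγμ hε => ?_⟩⟩
  · have : 0 < L / μ := div_pos (hμ.trans_le hμL) hμ
    linarith [stdBudget_mirrorIters_le (R' := R') hμ hμL]
  · intro δ _
    have := mul_pos (zero_lt_one.trans_le (one_le_sqrt_div hμ hμL)) (logB_pos (L * R' ^ 2 / δ))
    linarith [stdBudget_agdIters_le (R' := R') hμ hμL δ]
  · have : 0 < L / μ := div_pos (hμ.trans_le hμL) hμ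
    exact (stdBudget_mirrorIters_le (R' := R') hμ hμL).trans (by linarith)
  · linarith [stdBudget_warmEpochs_le (L := L) (μ := μ) (R' := R'), logB_pos (L / μ)]
  · refine ⟨⌊7 * (R * √(μ / ε))⌋₊, ?_, ?_⟩
    · have h : 0 ≤ R * √(μ / ε) := by positivity
      linarith [Nat.floor_le (show 0 ≤ 7 * (R * √(μ / ε)) by positivity)]
    · rintro n m P f g rfl rfl rfl hP
      exact recapp_solves hP hμ hμL hR hR' hε
  · refine ⟨⌈6 * √(μ / γ)⌉₊, ⌈Real.logb 2 (12 * (μ * R ^ 2) / ε)⌉₊, ?_, ?_, ?_⟩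
    · have hs : 1 ≤ √(μ / γ) := one_le_sqrt_div hγ hγμ
      linarith [Nat.ceil_lt_add_one (show 0 ≤ 6 * √(μ / γ) by positivity)]
    · linarith [(restarts_spec hε hμ hμL hR).2.1, logB_pos (L * R ^ 2 / ε)]
    · rintro n m P f g rfl rfl rfl hP hF
      exact restartedRecapp_solves hP hμ hμL hR hR' hγ hγμ hε hF
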